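/- There is a universal constant $C>0$ such that the following holds. Let $n\ge 0$, $d\ge 1$, $0\le\iota\le 1$, and let $X_1,\dots,X_n$ be independent random vectors in $\mathbb R^d$, $X_i=(X_{i1},\dots,X_{id})$, defined on a probability space $(\Omega,\mathcal A,\mathbb P)$, with $\mathbb E X_{ij}=0$ and $\mathbb E|X_{ij}|^{2+\iota}<\infty$ for all $i,j$. Put $\Sigma_i=\mathbb E(X_iX_i^{\mathsf T})$ and let $Y_1,\dots,Y_n$ be independent random vectors in $\mathbb R^d$ (on any probability space) with $Y_i\sim N(0,\Sigma_i)$; in particular the $X_i$ may have a common covariance matrix $\Sigma$. Put $Z=\max_{1\le j\le d}\sum_{i=1}^n X_{ij}$. For $\gamma,\delta>0$ let $$L_n(\gamma,\delta,\iota)=\min\Big\{\gamma^2\delta^{-1}\Big(\mathbb E\max_{1\le j\le d}\sum_{i=1}^n|X_{ij}|^3+\mathbb E\max_{1\le j\le d}\sum_{i=1}^n|Y_{ij}|^3\Big),\ \gamma^{\frac{4+2\iota}{3}}\delta^{-\frac{2+\iota}{3}}\sum_{i=1}^n\Big(\mathbb E\max_{1\le j\le d}|X_{ij}|^{2+\iota}+\mathbb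 E\max_{1\le j\le d}|Y_{ij}|^{2+\iota}\Big)\Big\},$$ where expectations of nonnegative variables may equal $+\infty$. Then for all $\gamma,\delta>0$ with $\gamma\delta>1$ and $\varepsilon=\gamma\delta\exp\{-(\gamma^2\delta^2-1)/2\}<1$ there is a random variable $Z^\dagger$, defined on the probability space enlarged by an independent uniform random variable (that is, on $\Omega\times[0,1]$ with the product of $\mathbb P$ and Lebesgue measure, to which $Z$ is extended by $Z(\omega,u)=Z(\omega)$), such that $Z^\dagger$ has the same distribution as $\max_{1\le j\le d}\sum_{i=1}^n Y_{ij}$ and $$\mathbb P\big(|Z-Z^\dagger|\ge \gamma^{-1}\log d+3\delta\big)\le C\,\frac{\varepsilon+L_n(\gamma,\delta,\iota)}{1-\varepsilon}.$$ -/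

import Mathlib

open MeasureTheory ProbabilityTheory
open scoped ENNReal unitInterval

noncomputable section

namespace GaussMax

/-- The maximum over the coordinates `j` of the sum `∑ i, V i j` of random vectors `V 1, …, V n`
in `ℝ^d` (a maximum of finitely many reals; used for `1 ≤ d`). -/
def maxSum {Ω : Type*} {n d : ℕ} (V : Fin n → Ω → EuclideanSpace ℝ (Fin d)) (ω : Ω) : ℝ :=
  ⨆ j : Fin d, ∑ i : Fin n, V i ω j

/-- The second-moment matrix `E (V Vᵀ)` of a random vector in `ℝ^d`. -/
def secondMoment {Ω : Type*} [MeasurableSpace Ω] {d : ℕ} (μ : Measure Ω)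
    (V : Ω → EuclideanSpace ℝ (Fin d)) : Matrix (Fin d) (Fin d) ℝ :=
  Matrix.of fun j k => ∫ ω, V ω j * V ω k ∂μ

/-- `E max_j ∑_i |V_ij|^3`, with value `∞` when the expectation diverges. -/
def maxSumCube {Ω : Type*} [MeasurableSpace Ω] {n d : ℕ} (μ : Measure Ω)
    (V : Fin n → Ω → EuclideanSpace ℝ (Fin d)) : ℝ≥0∞ :=
  ∫⁻ ω, ⨆ j : Fin d, ∑ i : Fin n, ENNReal.ofReal (|V i ω j| ^ 3) ∂μ

/-- `E max_j |V_j|^q` for one random vector, with value `∞` when the expectation diverges. -/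
def maxMoment {Ω : Type*} [MeasurableSpace Ω] {d : ℕ} (μ : Measure Ω)
    (V : Ω → EuclideanSpace ℝ (Fin d)) (q : ℝ) : ℝ≥0∞ :=
  ∫⁻ ω, ⨆ j : Fin d, ENNReal.ofReal (|V ω j| ^ q) ∂μ

/-- `L_n(γ, δ, ι)`: the minimum of the third-moment bound
`γ² δ⁻¹ (E max_j ∑_i |X_ij|³ + E max_j ∑_i |Y_ij|³)` and the bound
`γ^((4+2ι)/3) δ^(-(2+ι)/3) ∑_i (E max_j |X_ij|^(2+ι) + E max_j |Y_ij|^(2+ι))`. -/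
def Ln {Ω Ω' : Type*} [MeasurableSpace Ω] [MeasurableSpace Ω'] {n d : ℕ}
    (μ : Measure Ω) (X : Fin n → Ω → EuclideanSpace ℝ (Fin d))
    (ν : Measure Ω') (Y : Fin n → Ω' → EuclideanSpace ℝ (Fin d)) (γ δ ι : ℝ) : ℝ≥0∞ :=
  min
    (ENNReal.ofReal (γ ^ 2 * δ⁻¹) * (maxSumCube μ X + maxSumCube ν Y))
    (ENNReal.ofReal (γ ^ ((4 + 2 * ι) / 3) * δ ^ (-((2 + ι) / 3))) *
      ∑ i : Fin n, (maxMoment μ (X i) (2 + ι) + maxMoment ν (Y i) (2 + ι)))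

/-- `ε(γ, δ) = γ δ exp(-(γ² δ² - 1) / 2)`. -/
def eps (γ δ : ℝ) : ℝ := γ * δ * Real.exp (-((γ ^ 2 * δ ^ 2 - 1) / 2))

end GaussMax

end

/-!
The error probability is bounded by a multiple of `L_n(γ, δ, ι)` alone; the factor with `ε` only
enlarges the bound. After multiplying all vectors by `γ` the smoothing scale is `γ δ ≥ 1`, and the
maximum is within `log d` of the smooth maximum `log ∑ exp`. A bounded noise of size `γ δ` added to
the smooth maximum turns the indicator of any event into a function `f` with three derivatives of
order `1 / (γ δ)` (`exists_smoothing_noise`). If the expectations of all these `f` at the two smooth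
maxima differ by at most `η`, the noisy smooth maxima are within `η` in total variation, so a
maximal coupling (`exists_maximal_coupling`) makes them equal with probability `1 - η`. Composing
the noise kernel, the coupling kernel and the conditional law of the Gaussian maximum given its
noisy smooth version, and realizing the resulting kernel by a function of a uniform variable, gives
the required copy (`exists_coupled_copy`).

It remains to compare `E f(smoothMax)` for two independent families with matching first and second
moments. Both families are joined to a common symmetric midpoint (`pathFun`). At time `s` every
summand is deleted, taken from its own family with scale `1 + s²`, or taken from the other family
with scale `2 s`, with probabilities that keep the second moments fixed. In the derivative the
contributions of order zero, one and two therefore cancel (`integral_pathTerm`), leaving `O(s)`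
times the Taylor remainders of one random step added to the sum `w` of the other summands.

The remainders contain third moments averaged under softmax weights along the segment from `w` to
`w + x`. Softmax weights form an exponential family, so by the monotone likelihood ratio the
negative parts are dominated by their averages at `w`, the positive parts by their averages at
`w + x` (`softAvg_segment_le`). A centred step turns this, for any `l ≥ 1`, into
`l` times third moments averaged at `w + x` plus `1 / l` times third moments averaged at `w`
(`integral_endAvg_le`). Both averages are then rewritten with the softmax weights of the full
interpolated sum: passing from `w + x` to the full sum costs a bounded factor, while passing from
`w` to the full sum is possible because the summand is deleted with probability of order `s²`
(`weight_mul_integral_erase_le`). The choice `l = 1 / s` balances the two. The weights of the full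
sum are the same for all summands, so the sum over the summands is taken inside the average and is
at most the expected maximum of the sums of cubes (`abs_deriv_pathFun_le_cube`). The bound with
moments of order `2 + ι` only uses the crude estimate of the remainders by powers of the sup norm
(`abs_deriv_pathFun_le_rpow`).
-/

noncomputable section

set_option linter.unusedSectionVars false

namespace GaussMax

section Softmax

variable {J : Type*} [Fintype J]

/-! ### Softmax averages -/

/-- The partition function `∑ j, exp (w j)`. -/
def partition (w : J → ℝ) : ℝ := ∑ j, Real.exp (w j)

/-- The smooth maximum `log ∑ j, exp (w j)` (at inverse temperature `1`). -/
def smoothMax (w : J → ℝ) : ℝ := Real.log (partition w)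

/-- The average of `c` under the softmax probability vector `exp (w j) / ∑ k, exp (w k)`. -/
def softAvg (w c : J → ℝ) : ℝ := (∑ j, Real.exp (w j) * c j) / partition w

lemma partition_pos [Nonempty J] (w : J → ℝ) : 0 < partition w :=
  Finset.sum_pos (fun _ _ => Real.exp_pos _) Finset.univ_nonempty

lemma partition_nonneg (w : J → ℝ) : 0 ≤ partition w :=
  Finset.sum_nonneg fun _ _ => (Real.exp_pos _).le

lemma exp_smoothMax [Nonempty J] (w : J → ℝ) : Real.exp (smoothMax w) = partition w :=
  Real.exp_log (partition_pos w)

lemma softAvg_mono {w c c' : J → ℝ} (h : ∀ j, c j ≤ c' j) : softAvg w c ≤ softAvg w c' := by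
  unfold softAvg
  have := partition_nonneg w
  gcongr with j
  exact h j

lemma softAvg_nonneg {w c : J → ℝ} (h : ∀ j, 0 ≤ c j) : 0 ≤ softAvg w c :=
  div_nonneg (Finset.sum_nonneg fun j _ => mul_nonneg (Real.exp_pos _).le (h j))
    (partition_nonneg w)

lemma softAvg_add (w c c' : J → ℝ) :
    softAvg w (fun j => c j + c' j) = softAvg w c + softAvg w c' := by
  simp [softAvg, mul_add, Finset.sum_add_distrib, add_div]

lemma softAvg_const_mul (w c : J → ℝ) (a : ℝ) :
    softAvg w (fun j => a * c j) = a * softAvg w c := by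
  simp only [softAvg, ← mul_div_assoc, Finset.mul_sum]
  congr 1
  exact Finset.sum_congr rfl fun j _ => by ring

lemma softAvg_sum {N : Type*} (s : Finset N) (w : J → ℝ) (c : N → J → ℝ) :
    softAvg w (fun j => ∑ i ∈ s, c i j) = ∑ i ∈ s, softAvg w (c i) := by
  simp only [softAvg, Finset.mul_sum, ← Finset.sum_div]
  rw [Finset.sum_comm]

lemma softAvg_const [Nonempty J] (w : J → ℝ) (a : ℝ) : softAvg w (fun _ => a) = a := by
  have h := (partition_pos w).ne'
  simp only [softAvg, ← Finset.sum_mul]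
  change partition w * a / partition w = a
  field_simp

lemma softAvg_le [Nonempty J] {w c : J → ℝ} {a : ℝ} (h : ∀ j, c j ≤ a) : softAvg w c ≤ a :=
  (softAvg_mono h).trans_eq (softAvg_const w a)

lemma abs_softAvg_le (w c : J → ℝ) : |softAvg w c| ≤ softAvg w (fun j => |c j|) := by
  rw [softAvg, abs_div, abs_of_nonneg (partition_nonneg w), softAvg]
  have := partition_nonneg w
  gcongr
  refine (Finset.abs_sum_le_sum_abs _ _).trans (Finset.sum_le_sum fun j _ => ?_)
  rw [abs_mul, abs_of_pos (Real.exp_pos _)]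

lemma softAvg_le_sum [Nonempty J] {w c : J → ℝ} (h : ∀ j, 0 ≤ c j) : softAvg w c ≤ ∑ j, c j :=
  softAvg_le fun j => Finset.single_le_sum (fun k _ => h k) (Finset.mem_univ j)

/-- Chebyshev's association inequality for a softmax average. -/
lemma softAvg_mul_le_of_monovary [Nonempty J] (w : J → ℝ) {b c : J → ℝ}
    (h : ∀ j k, 0 ≤ (b j - b k) * (c j - c k)) :
    softAvg w b * softAvg w c ≤ softAvg w (fun j => b j * c j) := by
  have hp := partition_pos w
  have key : (∑ j, Real.exp (w j) * b j) * (∑ j, Real.exp (w j) * c j) ≤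
      (∑ j, Real.exp (w j) * (b j * c j)) * partition w := by
    have h0 : 0 ≤ ∑ j, ∑ k, Real.exp (w j) * Real.exp (w k) * ((b j - b k) * (c j - c k)) :=
      Finset.sum_nonneg fun j _ => Finset.sum_nonneg fun k _ => by
        have := h j k
        positivity
    have h1 : ∑ j, ∑ k, Real.exp (w j) * Real.exp (w k) * ((b j - b k) * (c j - c k)) =
        2 * ((∑ j, Real.exp (w j) * (b j * c j)) * partition w) -
        2 * ((∑ j, Real.exp (w j) * b j) * (∑ j, Real.exp (w j) * c j)) := by
      have e1 : (∑ j, Real.exp (w j) * (b j * c j)) * partition w =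
          ∑ j, ∑ k, Real.exp (w j) * Real.exp (w k) * (b j * c j) := by
        rw [partition, Finset.sum_mul_sum]
        exact Finset.sum_congr rfl fun j _ => Finset.sum_congr rfl fun k _ => by ring
      have e2 : (∑ j, Real.exp (w j) * (b j * c j)) * partition w =
          ∑ j, ∑ k, Real.exp (w j) * Real.exp (w k) * (b k * c k) := by
        rw [e1, Finset.sum_comm]
        exact Finset.sum_congr rfl fun j _ => Finset.sum_congr rfl fun k _ => by ring
      have e3 : (∑ j, Real.exp (w j) * b j) * (∑ j, Real.exp (w j) * c j) =
          ∑ j, ∑ k, Real.exp (w j) * Real.exp (w k) * (b j * c k) := by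
        rw [Finset.sum_mul_sum]
        exact Finset.sum_congr rfl fun j _ => Finset.sum_congr rfl fun k _ => by ring
      have e4 : (∑ j, Real.exp (w j) * b j) * (∑ j, Real.exp (w j) * c j) =
          ∑ j, ∑ k, Real.exp (w j) * Real.exp (w k) * (b k * c j) := by
        rw [e3, Finset.sum_comm]
        exact Finset.sum_congr rfl fun j _ => Finset.sum_congr rfl fun k _ => by ring
      rw [two_mul, two_mul]
      nth_rw 1 [e1]
      nth_rw 1 [e2]
      nth_rw 1 [e3]
      rw [e4]
      simp only [← Finset.sum_add_distrib, ← Finset.sum_sub_distrib]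
      exact Finset.sum_congr rfl fun j _ => Finset.sum_congr rfl fun k _ => by ring
    linarith
  simp only [softAvg]
  rw [div_mul_div_comm, div_le_div_iff₀ (by positivity) hp]
  nlinarith

/-- Adding `y` to the exponents reweights the softmax average by `exp y`. -/
lemma softAvg_add_left [Nonempty J] (w y c : J → ℝ) :
    softAvg (w + y) c * softAvg w (fun j => Real.exp (y j)) =
      softAvg w (fun j => Real.exp (y j) * c j) := by
  have hp := (partition_pos w).ne'
  have hp' := (partition_pos (w + y)).ne'
  have h : partition (w + y) = ∑ j, Real.exp (w j) * Real.exp (y j) := by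
    simp [partition, Real.exp_add]
  simp only [softAvg, ← h, Pi.add_apply, Real.exp_add, mul_assoc]
  field_simp

/-- Tilting in a direction increasing with `c` increases the softmax average of `c`: monotone
likelihood ratio. -/
lemma softAvg_le_softAvg_add [Nonempty J] (w : J → ℝ) {y c : J → ℝ}
    (h : ∀ j k, y j < y k → c j ≤ c k) : softAvg w c ≤ softAvg (w + y) c := by
  have h1 := softAvg_mul_le_of_monovary w (b := fun j => Real.exp (y j)) (c := c) (fun j k => by
    rcases lt_trichotomy (y j) (y k) with hj | hj | hj
    · have := h j k hj
      have := Real.exp_lt_exp.2 hj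
      nlinarith
    · simp [hj]
    · have := h k j hj
      have := Real.exp_lt_exp.2 hj
      nlinarith)
  rw [← softAvg_add_left, mul_comm] at h1
  refine le_of_mul_le_mul_right h1 ?_
  exact div_pos (Finset.sum_pos (fun j _ => by positivity) Finset.univ_nonempty) (partition_pos w)

lemma hasDerivAt_exp_line {J : Type*} (w x : J → ℝ) (j : J) (t : ℝ) :
    HasDerivAt (fun t : ℝ => Real.exp (w j + t * x j)) (Real.exp (w j + t * x j) * x j) t := by
  have h : HasDerivAt (fun t : ℝ => w j + t * x j) (x j) t := by
    simpa using ((hasDerivAt_id t).mul_const (x j)).const_add (w j)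
  exact h.exp

lemma hasDerivAt_partition_line (w x : J → ℝ) (t : ℝ) :
    HasDerivAt (fun t : ℝ => partition (w + t • x))
      (∑ j, Real.exp ((w + t • x) j) * x j) t := by
  simpa [partition] using HasDerivAt.fun_sum fun j (_ : j ∈ Finset.univ) =>
    hasDerivAt_exp_line w x j t

lemma hasDerivAt_smoothMax_line [Nonempty J] (w x : J → ℝ) (t : ℝ) :
    HasDerivAt (fun t : ℝ => smoothMax (w + t • x)) (softAvg (w + t • x) x) t :=
  (hasDerivAt_partition_line w x t).log (partition_pos _).ne'

lemma hasDerivAt_softAvg_line [Nonempty J] (w x c : J → ℝ) (t : ℝ) :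
    HasDerivAt (fun t : ℝ => softAvg (w + t • x) c)
      (softAvg (w + t • x) (fun j => c j * x j) -
        softAvg (w + t • x) c * softAvg (w + t • x) x) t := by
  have h1 : HasDerivAt (fun t : ℝ => ∑ j, Real.exp ((w + t • x) j) * c j)
      (∑ j, Real.exp ((w + t • x) j) * (c j * x j)) t := by
    have := HasDerivAt.fun_sum fun j (_ : j ∈ Finset.univ) =>
      (hasDerivAt_exp_line w x j t).mul_const (c j)
    refine (this.congr_deriv ?_).congr_of_eventuallyEq (by simp)
    exact Finset.sum_congr rfl fun j _ => by simp; ring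
  have hp := (partition_pos (w + t • x)).ne'
  refine (h1.div (hasDerivAt_partition_line w x t) hp).congr_deriv ?_
  simp only [softAvg]
  field_simp

/-- The smooth maximum is convex: its increment is at most the tilted average of the step. -/
lemma smoothMax_add_sub_le [Nonempty J] (w x : J → ℝ) :
    smoothMax (w + x) - smoothMax w ≤ softAvg (w + x) x := by
  set m := softAvg (w + x) x with hm
  have h1 : Real.exp (-m) * partition (w + x) ≤ partition w := by
    have h2 : ∀ j, Real.exp ((w + x) j) * (Real.exp (-m) * (1 + m - x j)) ≤ Real.exp (w j) := by
      intro j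
      have h3 := Real.add_one_le_exp (m - x j)
      have h4 : Real.exp (w j) = Real.exp ((w + x) j) * (Real.exp (-m) * Real.exp (m - x j)) := by
        rw [← Real.exp_add, ← Real.exp_add]
        congr 1
        simp only [Pi.add_apply]
        ring
      rw [h4]
      gcongr
      linarith
    have h5 := Finset.sum_le_sum fun j (_ : j ∈ Finset.univ) => h2 j
    have h6 : ∑ j, Real.exp ((w + x) j) * x j = m * partition (w + x) := by
      rw [hm, softAvg, div_mul_cancel₀ _ (partition_pos _).ne']
    have h7 : ∑ j, Real.exp ((w + x) j) * (Real.exp (-m) * (1 + m - x j)) =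
        Real.exp (-m) * ((1 + m) * partition (w + x) - ∑ j, Real.exp ((w + x) j) * x j) := by
      rw [partition, Finset.mul_sum, ← Finset.sum_sub_distrib, Finset.mul_sum]
      exact Finset.sum_congr rfl fun j _ => by ring
    rw [h7, h6] at h5
    calc _ = _ := by ring
      _ ≤ _ := h5
  have h8 := Real.log_le_log (mul_pos (Real.exp_pos _) (partition_pos _)) h1
  rw [Real.log_mul (Real.exp_pos _).ne' (partition_pos _).ne', Real.log_exp] at h8
  simp only [smoothMax]
  linarith

lemma abs_smoothMax_add_sub_le [Nonempty J] (w x : J → ℝ) :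
    |smoothMax (w + x) - smoothMax w| ≤ ∑ j, |x j| := by
  have h1 := smoothMax_add_sub_le w x
  have h2 := smoothMax_add_sub_le (w + x) (-x)
  rw [add_neg_cancel_right] at h2
  have h3 : ∀ w' y : J → ℝ, softAvg w' y ≤ ∑ j, |y j| := fun w' y =>
    (softAvg_mono fun j => le_abs_self (y j)).trans (softAvg_le_sum fun j => abs_nonneg _)
  have h4 := h3 w (-x)
  simp only [Pi.neg_apply, abs_neg] at h4
  rw [abs_le]
  constructor <;> linarith [h3 (w + x) x]

lemma le_smoothMax [Nonempty J] (w : J → ℝ) (j : J) : w j ≤ smoothMax w := by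
  rw [smoothMax, Real.le_log_iff_exp_le (partition_pos w)]
  exact Finset.single_le_sum (f := fun j => Real.exp (w j)) (fun k _ => (Real.exp_pos _).le)
    (Finset.mem_univ j)

lemma smoothMax_le [Nonempty J] {w : J → ℝ} {a : ℝ} (h : ∀ j, w j ≤ a) :
    smoothMax w ≤ a + Real.log (Fintype.card J) := by
  have hc : (0 : ℝ) < Fintype.card J := by exact_mod_cast Fintype.card_pos
  rw [smoothMax, Real.log_le_iff_le_exp (partition_pos w), Real.exp_add, Real.exp_log hc, mul_comm]
  calc partition w ≤ ∑ _j : J, Real.exp a := Finset.sum_le_sum fun j _ => Real.exp_le_exp.2 (h j)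
    _ = _ := by simp

/-! ### Second-order expansion along a direction -/

/-- `f` is three times differentiable with derivatives `f₁`, `f₂`, `f₃`, all bounded by `K`. -/
structure HasBoundedDerivs (K : ℝ) (f f₁ f₂ f₃ : ℝ → ℝ) : Prop where
  deriv₁ : ∀ x, HasDerivAt f (f₁ x) x
  deriv₂ : ∀ x, HasDerivAt f₁ (f₂ x) x
  deriv₃ : ∀ x, HasDerivAt f₂ (f₃ x) x
  bound₁ : ∀ x, |f₁ x| ≤ K
  bound₂ : ∀ x, |f₂ x| ≤ K
  bound₃ : ∀ x, |f₃ x| ≤ K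

lemma HasBoundedDerivs.nonneg {K : ℝ} {f f₁ f₂ f₃ : ℝ → ℝ} (h : HasBoundedDerivs K f f₁ f₂ f₃) :
    0 ≤ K := (abs_nonneg _).trans (h.bound₁ 0)

/-- The derivative of `f ∘ smoothMax` at `w` in direction `x`. -/
def lin (f₁ : ℝ → ℝ) (w x : J → ℝ) : ℝ := f₁ (smoothMax w) * softAvg w x

/-- The second derivative of `f ∘ smoothMax` at `w` in direction `x`. -/
def quad (f₁ f₂ : ℝ → ℝ) (w x : J → ℝ) : ℝ :=
  f₂ (smoothMax w) * softAvg w x ^ 2 +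
    f₁ (smoothMax w) * (softAvg w (fun j => x j ^ 2) - softAvg w x ^ 2)

/-- The Taylor remainder of order two of `f ∘ smoothMax`. -/
def rem₀ (f f₁ f₂ : ℝ → ℝ) (w x : J → ℝ) : ℝ :=
  f (smoothMax (w + x)) - f (smoothMax w) - lin f₁ w x - quad f₁ f₂ w x / 2

/-- The Taylor remainder of order one of the directional derivative of `f ∘ smoothMax`. -/
def rem₁ (f₁ f₂ : ℝ → ℝ) (w x : J → ℝ) : ℝ :=
  lin f₁ (w + x) x - lin f₁ w x - quad f₁ f₂ w x

/-- The bound for softmax averages along the segment from `w` to `w + x`: the negative part of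
`x` is averaged at `w` and the positive part at `w + x`. -/
def endAvg (k : ℕ) (w x : J → ℝ) : ℝ :=
  softAvg w (fun j => (max (-x j) 0) ^ k) + softAvg (w + x) (fun j => (max (x j) 0) ^ k)

lemma abs_pow_eq_max_pow (y : ℝ) {k : ℕ} (hk : k ≠ 0) :
    |y| ^ k = max (-y) 0 ^ k + max y 0 ^ k := by
  rcases le_total 0 y with h | h
  · rw [abs_of_nonneg h, max_eq_right (by linarith), max_eq_left h, zero_pow hk, zero_add]
  · rw [abs_of_nonpos h, max_eq_left (by linarith), max_eq_right h, zero_pow hk, add_zero]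

/-- Along the segment from `w` to `w + x` the average of an increasing function of `x` increases and
that of a decreasing one decreases, so both parts of `|x| ^ k` are extremal at an endpoint. -/
lemma softAvg_segment_le [Nonempty J] (w x : J → ℝ) {k : ℕ} (hk : k ≠ 0) {t : ℝ} (ht0 : 0 ≤ t)
    (ht1 : t ≤ 1) : softAvg (w + t • x) (fun j => |x j| ^ k) ≤ endAvg k w x := by
  simp only [abs_pow_eq_max_pow _ hk, softAvg_add]
  refine add_le_add ?_ ?_
  · have h := softAvg_le_softAvg_add w (y := t • x) (c := fun j => -(max (-x j) 0) ^ k)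
      (fun j l hjl => by
        have h1 : x j ≤ x l := by
          simp only [Pi.smul_apply, smul_eq_mul] at hjl
          by_contra! hc
          nlinarith
        have : max (-x l) 0 ≤ max (-x j) 0 := max_le_max (by linarith) le_rfl
        exact neg_le_neg (pow_le_pow_left₀ (le_max_right _ _) this k))
    have e : ∀ w' : J → ℝ, softAvg w' (fun j => -(max (-x j) 0) ^ k) =
        -softAvg w' (fun j => (max (-x j) 0) ^ k) := fun w' => by
      simpa using softAvg_const_mul w' (fun j => (max (-x j) 0) ^ k) (-1)
    rw [e, e] at h
    linarith
  · have h := softAvg_le_softAvg_add (w + t • x) (y := (1 - t) • x) (c := fun j => (max (x j) 0) ^ k)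
      (fun j l hjl => by
        have h1 : x j ≤ x l := by
          simp only [Pi.smul_apply, smul_eq_mul] at hjl
          by_contra! hc
          nlinarith
        have : max (x j) 0 ≤ max (x l) 0 := max_le_max h1 le_rfl
        exact pow_le_pow_left₀ (le_max_right _ _) this k)
    rw [show w + t • x + (1 - t) • x = w + x by rw [add_assoc, ← add_smul]; simp] at h
    exact h

lemma taylor_two_remainders {ψ ψ₁ ψ₂ : ℝ → ℝ} (h0 : ∀ t, HasDerivAt ψ (ψ₁ t) t)
    (h1 : ∀ t, HasDerivAt ψ₁ (ψ₂ t) t) {M : ℝ}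
    (hM : ∀ t ∈ Set.Icc (0 : ℝ) 1, |ψ₂ t - ψ₂ 0| ≤ M) :
    |ψ 1 - ψ 0 - ψ₁ 0 - ψ₂ 0 / 2| ≤ M ∧ |ψ₁ 1 - ψ₁ 0 - ψ₂ 0| ≤ M := by
  have hM0 : 0 ≤ M := (abs_nonneg _).trans (hM 0 (by simp))
  have A : ∀ t ∈ Set.Icc (0 : ℝ) 1, |ψ₁ t - ψ₁ 0 - t * ψ₂ 0| ≤ M := by
    intro t ht
    have hd : ∀ s ∈ Set.Icc (0 : ℝ) 1, HasDerivWithinAt (fun s => ψ₁ s - s * ψ₂ 0)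
        (ψ₂ s - ψ₂ 0) (Set.Icc 0 1) s := fun s _ => by
      simpa using ((h1 s).fun_sub ((hasDerivAt_id' s).mul_const (ψ₂ 0))).hasDerivWithinAt
    have := (convex_Icc (0 : ℝ) 1).norm_image_sub_le_of_norm_hasDerivWithin_le hd
      (fun s hs => hM s hs) (x := 0) (y := t) (by simp) ht
    simp only [Real.norm_eq_abs, zero_mul, sub_zero] at this
    calc _ = |ψ₁ t - t * ψ₂ 0 - ψ₁ 0| := by congr 1; ring
      _ ≤ M * |t| := this
      _ ≤ M := mul_le_of_le_one_right hM0 (abs_le.2 ⟨by linarith [ht.1], ht.2⟩)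
  refine ⟨?_, by simpa using A 1 (by simp)⟩
  have hd : ∀ s ∈ Set.Icc (0 : ℝ) 1, HasDerivWithinAt (fun s => ψ s - s * ψ₁ 0 - s ^ 2 / 2 * ψ₂ 0)
      (ψ₁ s - ψ₁ 0 - s * ψ₂ 0) (Set.Icc 0 1) s := fun s _ => by
    have e2 : HasDerivAt (fun s : ℝ => s ^ 2 / 2) s s := by
      simpa using (hasDerivAt_pow 2 s).div_const 2
    simpa using (((h0 s).fun_sub ((hasDerivAt_id' s).mul_const (ψ₁ 0))).fun_sub
      (e2.mul_const (ψ₂ 0))).hasDerivWithinAt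
  have := (convex_Icc (0 : ℝ) 1).norm_image_sub_le_of_norm_hasDerivWithin_le hd
      (fun s hs => A s hs) (x := 0) (y := 1) (by simp) (by simp)
  simp only [Real.norm_eq_abs] at this
  convert this using 1
  · congr 1
    ring
  · simp

section

variable [Nonempty J] {K : ℝ} {f f₁ f₂ f₃ : ℝ → ℝ}

lemma hasDerivAt_comp_smoothMax_line (hf : HasBoundedDerivs K f f₁ f₂ f₃)
    (w x : J → ℝ) (t : ℝ) :
    HasDerivAt (fun t : ℝ => f (smoothMax (w + t • x))) (lin f₁ (w + t • x) x) t :=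
  (hf.deriv₁ _).comp t (hasDerivAt_smoothMax_line w x t)

lemma hasDerivAt_lin_line (hf : HasBoundedDerivs K f f₁ f₂ f₃)
    (w x : J → ℝ) (t : ℝ) :
    HasDerivAt (fun t : ℝ => lin f₁ (w + t • x) x) (quad f₁ f₂ (w + t • x) x) t := by
  have h := ((hf.deriv₂ _).comp t (hasDerivAt_smoothMax_line w x t)).mul
    (hasDerivAt_softAvg_line w x x t)
  refine h.congr_deriv ?_
  simp only [quad, Function.comp, pow_two]
  ring

/-- The third directional derivative of `f ∘ smoothMax` is controlled by the softmax average of the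
third absolute powers of the direction. -/
lemma exists_hasDerivAt_quad_line (hf : HasBoundedDerivs K f f₁ f₂ f₃)
    (w x : J → ℝ) (t : ℝ) :
    ∃ D, HasDerivAt (fun t : ℝ => quad f₁ f₂ (w + t • x) x) D t ∧
      |D| ≤ 10 * K * softAvg (w + t • x) (fun j => |x j| ^ 3) := by
  have hF := hasDerivAt_smoothMax_line w x t
  have hm := hasDerivAt_softAvg_line w x x t
  have hq := hasDerivAt_softAvg_line w x (fun j => x j ^ 2) t
  refine ⟨_, (((hf.deriv₃ _).comp t hF).mul (hm.pow 2)).add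
    (((hf.deriv₂ _).comp t hF).mul (hq.sub (hm.pow 2))), ?_⟩
  simp only [Function.comp, Nat.cast_ofNat, Nat.add_one_sub_one, pow_one, ← pow_two, Pi.pow_apply,
    ← pow_succ, Nat.reduceAdd]
  set w' := w + t • x
  have b1 := hf.bound₁ (smoothMax w')
  have b2 := hf.bound₂ (smoothMax w')
  have b3 := hf.bound₃ (smoothMax w')
  have hK := hf.nonneg
  set φ₁ := f₁ (smoothMax w')
  set φ₂ := f₂ (smoothMax w')
  set φ₃ := f₃ (smoothMax w')
  set m := softAvg w' x
  set q := softAvg w' (fun j => x j ^ 2)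
  set c := softAvg w' (fun j => x j ^ 3)
  set A1 := softAvg w' (fun j => |x j|)
  set A3 := softAvg w' (fun j => |x j| ^ 3)
  have hA1 : 0 ≤ A1 := softAvg_nonneg fun j => abs_nonneg _
  have hmA : |m| ≤ A1 := abs_softAvg_le w' x
  have hc : |c| ≤ A3 := (abs_softAvg_le w' _).trans_eq (by simp only [abs_pow]; rfl)
  have hmono : ∀ j k, 0 ≤ (|x j| - |x k|) * (|x j| - |x k|) := fun j k => mul_self_nonneg _
  have hA1q : A1 * A1 ≤ q := by
    refine (softAvg_mul_le_of_monovary w' hmono).trans_eq ?_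
    simp only [← pow_two, sq_abs]
    rfl
  have hq0 : 0 ≤ q := (mul_self_nonneg _).trans hA1q
  have hqA : q * A1 ≤ A3 := by
    have := softAvg_mul_le_of_monovary w' (b := fun j => x j ^ 2) (c := fun j => |x j|)
      (fun j k => by
        rw [← sq_abs (x j), ← sq_abs (x k)]
        nlinarith [abs_nonneg (x j), abs_nonneg (x k), sq_nonneg (|x j| - |x k|)])
    refine this.trans_eq ?_
    congr 1
    ext j
    rw [← sq_abs]
    ring
  have hm2 : m ^ 2 ≤ q := by
    rw [← sq_abs]
    nlinarith [abs_nonneg m]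
  have hmq : |m| * q ≤ A3 := by nlinarith
  have hm3 : |m| * m ^ 2 ≤ A3 := by nlinarith [abs_nonneg m]
  have key : ∀ u a y : ℝ, |u| ≤ K → |y| ≤ a * A3 → |u * y| ≤ a * K * A3 := by
    intro u a y hu hy
    rw [abs_mul, mul_comm a K, mul_assoc]
    exact mul_le_mul hu hy (abs_nonneg _) hK
  have hv : |q - m ^ 2| ≤ q := by
    rw [abs_le]
    constructor <;> nlinarith [sq_nonneg m]
  have h1 : |φ₃ * (m * m ^ 2)| ≤ 1 * K * A3 := key _ _ _ b3 (by
    rw [abs_mul, abs_of_nonneg (sq_nonneg m)]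
    linarith)
  have h2 : |φ₂ * (m * (q - m ^ 2))| ≤ 1 * K * A3 := key _ _ _ b2 (by
    rw [abs_mul]
    nlinarith [mul_le_mul_of_nonneg_left hv (abs_nonneg m)])
  have h3 : |φ₁ * (c - q * m - 2 * (m * (q - m ^ 2)))| ≤ 4 * K * A3 := key _ _ _ b1 (by
    have e1 : |m * (q - m ^ 2)| ≤ A3 := by
      rw [abs_mul]
      nlinarith [mul_le_mul_of_nonneg_left hv (abs_nonneg m)]
    have e2 : |q * m| ≤ A3 := by
      rw [abs_mul, abs_of_nonneg hq0]
      linarith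
    rw [abs_le] at *
    constructor <;> linarith [e1.1, e1.2, e2.1, e2.2, hc.1, hc.2])
  rw [abs_le] at h1 h2 h3 ⊢
  have hA3 : 0 ≤ K * A3 := mul_nonneg hK (softAvg_nonneg fun j => by positivity)
  constructor <;> nlinarith [h1.1, h1.2, h2.1, h2.2, h3.1, h3.2]

lemma abs_quad_le (hf : HasBoundedDerivs K f f₁ f₂ f₃)
    (w x : J → ℝ) :
    |quad f₁ f₂ w x| ≤ 2 * K * softAvg w (fun j => |x j| ^ 2) := by
  have b1 := hf.bound₁ (smoothMax w)
  have b2 := hf.bound₂ (smoothMax w)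
  have hK := hf.nonneg
  simp only [quad, sq_abs]
  set q := softAvg w (fun j => x j ^ 2)
  set m := softAvg w x
  have hm2 : m ^ 2 ≤ q := by
    have := softAvg_mul_le_of_monovary w (b := x) (c := x) (fun j k => mul_self_nonneg _)
    simp only [← pow_two] at this
    exact this
  have h1 : |f₂ (smoothMax w) * m ^ 2| ≤ K * q := by
    rw [abs_mul]
    exact mul_le_mul b2 (by rwa [abs_of_nonneg (sq_nonneg m)]) (abs_nonneg _) hK
  have h2 : |f₁ (smoothMax w) * (q - m ^ 2)| ≤ K * q := by
    rw [abs_mul]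
    refine mul_le_mul b1 ?_ (abs_nonneg _) hK
    rw [abs_of_nonneg (by linarith)]
    linarith [sq_nonneg m]
  exact (abs_add_le _ _).trans (by linarith)

lemma abs_rem_le_of_quad (hf : HasBoundedDerivs K f f₁ f₂ f₃)
    (w x : J → ℝ) {M : ℝ}
    (hM : ∀ t ∈ Set.Icc (0 : ℝ) 1, |quad f₁ f₂ (w + t • x) x - quad f₁ f₂ w x| ≤ M) :
    |rem₀ f f₁ f₂ w x| ≤ M ∧ |rem₁ f₁ f₂ w x| ≤ M := by
  have := taylor_two_remainders (hasDerivAt_comp_smoothMax_line hf w x)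
    (hasDerivAt_lin_line hf w x) (M := M) (by simpa using hM)
  simpa [rem₀, rem₁] using this

lemma abs_rem_le_endAvg_three (hf : HasBoundedDerivs K f f₁ f₂ f₃)
    (w x : J → ℝ) :
    |rem₀ f f₁ f₂ w x| ≤ 10 * K * endAvg 3 w x ∧ |rem₁ f₁ f₂ w x| ≤ 10 * K * endAvg 3 w x := by
  refine abs_rem_le_of_quad hf w x fun t ht => ?_
  choose D hD hDb using exists_hasDerivAt_quad_line hf w x
  have hK := hf.nonneg
  have hb : ∀ s ∈ Set.Icc (0 : ℝ) 1, ‖D s‖ ≤ 10 * K * endAvg 3 w x := fun s hs =>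
    (hDb s).trans (by
      gcongr
      exact softAvg_segment_le w x (by norm_num) hs.1 hs.2)
  have := (convex_Icc (0 : ℝ) 1).norm_image_sub_le_of_norm_hasDerivWithin_le
    (fun s _ => (hD s).hasDerivWithinAt) hb (x := 0) (y := t) (by simp) ht
  simp only [Real.norm_eq_abs, zero_smul, add_zero, sub_zero] at this
  refine this.trans (mul_le_of_le_one_right ((norm_nonneg _).trans (hb 0 (by simp))) ?_)
  exact abs_le.2 ⟨by linarith [ht.1], ht.2⟩

lemma abs_rem_le_endAvg_two (hf : HasBoundedDerivs K f f₁ f₂ f₃)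
    (w x : J → ℝ) :
    |rem₀ f f₁ f₂ w x| ≤ 4 * K * endAvg 2 w x ∧ |rem₁ f₁ f₂ w x| ≤ 4 * K * endAvg 2 w x := by
  refine abs_rem_le_of_quad hf w x fun t ht => ?_
  have hK := hf.nonneg
  have hb : ∀ s ∈ Set.Icc (0 : ℝ) 1, |quad f₁ f₂ (w + s • x) x| ≤ 2 * K * endAvg 2 w x :=
    fun s hs => (abs_quad_le hf _ x).trans (by
      gcongr
      exact softAvg_segment_le w x (by norm_num) hs.1 hs.2)
  have h0 := hb 0 (by simp)
  simp only [zero_smul, add_zero] at h0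
  have h1 := hb t ht
  exact (abs_sub _ _).trans (by linarith)

end

lemma abs_lin_le {K : ℝ} {f f₁ f₂ f₃ : ℝ → ℝ} (hf : HasBoundedDerivs K f f₁ f₂ f₃) (w x : J → ℝ) :
    |lin f₁ w x| ≤ K * softAvg w (fun j => |x j|) := by
  rw [lin, abs_mul]
  exact mul_le_mul (hf.bound₁ _) (abs_softAvg_le _ _) (abs_nonneg _) hf.nonneg

end Softmax

section OneStep

variable {J : Type*} [Fintype J]

/-! ### Expected remainders for one random step -/

lemma measurable_softAvg {Ω : Type*} [MeasurableSpace Ω] {g c : Ω → J → ℝ} (hg : Measurable g)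
    (hc : Measurable c) : Measurable fun ω => softAvg (g ω) (c ω) := by
  unfold softAvg partition
  fun_prop

lemma measurable_smoothMax : Measurable (smoothMax : (J → ℝ) → ℝ) := by
  unfold smoothMax partition
  fun_prop

lemma integrable_softAvg [Nonempty J] {Ω : Type*} [MeasurableSpace Ω] {μ : Measure Ω}
    {g c : Ω → J → ℝ} (hg : Measurable g) (hcm : Measurable c)
    (hc : ∀ j, Integrable (fun ω => c ω j) μ) :
    Integrable (fun ω => softAvg (g ω) (c ω)) μ := by
  refine Integrable.mono' (integrable_finsetSum Finset.univ fun j _ => (hc j).abs)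
    (measurable_softAvg hg hcm).aestronglyMeasurable (Filter.Eventually.of_forall fun ω => ?_)
  exact (abs_softAvg_le _ _).trans (softAvg_le_sum fun j => abs_nonneg _)

lemma integral_softAvg_left {Ω : Type*} [MeasurableSpace Ω] {μ : Measure Ω} (w : J → ℝ)
    {c : Ω → J → ℝ} (hc : ∀ j, Integrable (fun ω => c ω j) μ) :
    ∫ ω, softAvg w (c ω) ∂μ = softAvg w fun j => ∫ ω, c ω j ∂μ := by
  simp only [softAvg]
  rw [integral_div, integral_finsetSum _ fun j _ => (hc j).const_mul _]
  simp only [integral_const_mul]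

lemma integrable_abs_rpow_of_le {Ω : Type*} [MeasurableSpace Ω] {μ : Measure Ω} [IsFiniteMeasure μ]
    {y : Ω → ℝ} (hy : Measurable y) {q : ℝ} (h3 : Integrable (fun ω => |y ω| ^ q) μ) {p : ℝ}
    (hp : 0 ≤ p) (hpq : p ≤ q) : Integrable (fun ω => |y ω| ^ p) μ := by
  refine Integrable.mono' ((integrable_const 1).add h3)
    (hy.abs.pow_const p).aestronglyMeasurable (Filter.Eventually.of_forall fun ω => ?_)
  rw [Real.norm_of_nonneg (by positivity), Pi.add_apply]
  have h0 : 0 ≤ |y ω| ^ q := by positivity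
  rcases le_total |y ω| 1 with h | h
  · linarith [Real.rpow_le_one (abs_nonneg _) h hp]
  · linarith [Real.rpow_le_rpow_of_exponent_le h hpq]

/-- The coordinatewise third absolute moments of a law on `ℝ^J`. -/
def cubeMoment {J : Type*} (m : Measure (J → ℝ)) (j : J) : ℝ := ∫ x, |x j| ^ 3 ∂m

/-- The third moments averaged under the softmax weights after the random step, both for the step
itself and for an independent copy of it. -/
def stepMoment (m : Measure (J → ℝ)) (w : J → ℝ) : ℝ :=
  ∫ x, softAvg (w + x) (fun j => |x j| ^ 3 + cubeMoment m j) ∂m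

lemma cubeMoment_nonneg {J : Type*} (m : Measure (J → ℝ)) (j : J) : 0 ≤ cubeMoment m j :=
  integral_nonneg fun x => by positivity

lemma max_zero_le_one_add_cube (y : ℝ) : max y 0 ≤ 1 + |y| ^ 3 := by
  have h0 := abs_nonneg y
  have : |y| ≤ 1 + |y| ^ 3 := by
    nlinarith [sq_nonneg (|y| - 1), mul_nonneg h0 (sq_nonneg (|y| - 1))]
  exact max_le ((le_abs_self y).trans this) (by positivity)

lemma max_zero_sq_le_one_add_cube (y : ℝ) : max y 0 ^ 2 ≤ 1 + |y| ^ 3 := by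
  have h0 := abs_nonneg y
  have h2 : max y 0 ^ 2 ≤ |y| ^ 2 :=
    pow_le_pow_left₀ (le_max_right _ _) (max_le (le_abs_self y) h0) 2
  have h3 : |y| ^ 2 ≤ 1 + |y| ^ 3 := by
    nlinarith [sq_nonneg (|y| - 1), mul_nonneg h0 (sq_nonneg (|y| - 1))]
  exact h2.trans h3

lemma integrable_of_cube {J : Type*} {m : Measure (J → ℝ)} [IsFiniteMeasure m]
    (h3 : ∀ j, Integrable (fun x : J → ℝ => |x j| ^ 3) m) {φ : ℝ → ℝ}
    (hφ : Measurable φ) (hb : ∀ y, |φ y| ≤ 1 + |y| ^ 3) (j : J) :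
    Integrable (fun x : J → ℝ => φ (x j)) m :=
  Integrable.mono' ((integrable_const 1).add (h3 j))
    (hφ.comp (measurable_pi_apply j)).aestronglyMeasurable
    (Filter.Eventually.of_forall fun x => hb (x j))

lemma integrable_coord_of_cube {J : Type*} {m : Measure (J → ℝ)} [IsFiniteMeasure m]
    (h3 : ∀ j, Integrable (fun x : J → ℝ => |x j| ^ 3) m) (j : J) :
    Integrable (fun x : J → ℝ => x j) m :=
  integrable_of_cube h3 measurable_id (fun y => by
    have h0 := abs_nonneg y
    simp only [id]
    nlinarith [sq_nonneg (|y| - 1), mul_nonneg h0 (sq_nonneg (|y| - 1))]) j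

lemma integrable_negPart_pow {J : Type*} {m : Measure (J → ℝ)} [IsFiniteMeasure m]
    (h3 : ∀ j, Integrable (fun x : J → ℝ => |x j| ^ 3) m) {k : ℕ}
    (hk : k ≤ 3) (j : J) : Integrable (fun x : J → ℝ => max (-x j) 0 ^ k) m :=
  integrable_of_cube (φ := fun y => max (-y) 0 ^ k) h3 (by fun_prop) (fun y => by
    have h0 := abs_nonneg y
    have h1 : max (-y) 0 ≤ |y| := max_le (neg_le_abs y) h0
    rw [abs_of_nonneg (by positivity)]
    refine (pow_le_pow_left₀ (le_max_right _ _) h1 k).trans ?_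
    rcases le_total |y| 1 with h | h
    · linarith [pow_le_one₀ (n := k) h0 h, pow_nonneg h0 3]
    · linarith [pow_le_pow_right₀ h hk]) j

lemma integrable_posPart_pow {J : Type*} {m : Measure (J → ℝ)} [IsFiniteMeasure m]
    (h3 : ∀ j, Integrable (fun x : J → ℝ => |x j| ^ 3) m) {k : ℕ}
    (hk : k ≤ 3) (j : J) : Integrable (fun x : J → ℝ => max (x j) 0 ^ k) m :=
  integrable_of_cube (φ := fun y => max y 0 ^ k) h3 (by fun_prop) (fun y => by
    have h0 := abs_nonneg y
    have h1 : max y 0 ≤ |y| := max_le (le_abs_self y) h0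
    rw [abs_of_nonneg (by positivity)]
    refine (pow_le_pow_left₀ (le_max_right _ _) h1 k).trans ?_
    rcases le_total |y| 1 with h | h
    · linarith [pow_le_one₀ (n := k) h0 h, pow_nonneg h0 3]
    · linarith [pow_le_pow_right₀ h hk]) j

section

variable [Nonempty J] {m : Measure (J → ℝ)} [IsProbabilityMeasure m]

lemma stepMoment_eq_add (h3 : ∀ j, Integrable (fun x : J → ℝ => |x j| ^ 3) m) (w : J → ℝ) :
    stepMoment m w = ∫ x, softAvg (w + x) (fun j => |x j| ^ 3) ∂m +
      ∫ x, softAvg (w + x) (cubeMoment m) ∂m := by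
  simp only [stepMoment, softAvg_add]
  exact integral_add (integrable_softAvg (by fun_prop) (by fun_prop) h3)
    (integrable_softAvg (by fun_prop) (by fun_prop) fun j => integrable_const _)

/-- A function growing at most like the cube is averaged, after the step, to at most `1` plus the
average of the cubes. -/
lemma integral_tilt_le (h3 : ∀ j, Integrable (fun x : J → ℝ => |x j| ^ 3) m) (w : J → ℝ)
    {φ : ℝ → ℝ} (hφm : Measurable φ) (hφ : ∀ y, |φ y| ≤ 1 + |y| ^ 3) :
    ∫ x, softAvg (w + x) (fun j => φ (x j)) ∂m ≤
      1 + ∫ x, softAvg (w + x) (fun j => |x j| ^ 3) ∂m := by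
  have hi : Integrable (fun x => softAvg (w + x) (fun j => |x j| ^ 3)) m :=
    integrable_softAvg (by fun_prop) (by fun_prop) h3
  have : (1 : ℝ) + ∫ x, softAvg (w + x) (fun j => |x j| ^ 3) ∂m =
      ∫ x, (1 + softAvg (w + x) (fun j => |x j| ^ 3)) ∂m := by
    rw [integral_add (integrable_const _) hi]
    simp
  rw [this]
  refine integral_mono (integrable_softAvg (by fun_prop) (by fun_prop)
    (integrable_of_cube h3 hφm hφ)) ((integrable_const _).add hi) fun x => ?_
  have h1 := softAvg_mono (w := w + x) (c := fun j => φ (x j)) (c' := fun j => 1 + |x j| ^ 3)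
    fun j => (le_abs_self _).trans (hφ (x j))
  rw [softAvg_add, softAvg_const] at h1
  exact h1

/-- The softmax weights do not decrease, on average over a centred step, by more than the
exponential of the mean increment of the smooth maximum: Jensen's inequality for the exponential. -/
lemma softAvg_le_exp_mul_integral (hmean : ∀ j, ∫ x : J → ℝ, x j ∂m = 0)
    (h1 : ∀ j, Integrable (fun x : J → ℝ => x j) m) (w : J → ℝ) {c : J → ℝ} (hc : ∀ j, 0 ≤ c j) :
    softAvg w c ≤ Real.exp (∫ x, (smoothMax (w + x) - smoothMax w) ∂m) *
      ∫ x, softAvg (w + x) c ∂m := by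
  set D : (J → ℝ) → ℝ := fun x => smoothMax (w + x) - smoothMax w with hD
  set l := ∫ x, D x ∂m with hl
  have hDm : Measurable D :=
    (measurable_smoothMax.comp (measurable_const_add w)).sub_const _
  have hDi : Integrable D m := Integrable.mono' (integrable_finsetSum Finset.univ
    fun j _ => (h1 j).abs) hDm.aestronglyMeasurable
    (Filter.Eventually.of_forall fun x => abs_smoothMax_add_sub_le w x)
  have hi : ∀ j, Integrable (fun x : J → ℝ => Real.exp (-l) * (1 + x j - D x + l) * c j) m :=
    fun j => ((((integrable_const (1 : ℝ)).add (h1 j)).sub hDi).add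
      (integrable_const l)).const_mul _ |>.mul_const _
  have key : ∀ x, softAvg w (fun j => Real.exp (-l) * (1 + x j - D x + l) * c j) ≤
      softAvg (w + x) c := by
    intro x
    have e : softAvg (w + x) c = softAvg w (fun j => Real.exp (x j - D x) * c j) := by
      simp only [softAvg, ← exp_smoothMax, hD, Finset.sum_div]
      refine Finset.sum_congr rfl fun j _ => ?_
      rw [mul_comm, mul_div_assoc, ← Real.exp_sub, ← mul_assoc, mul_comm _ (c j), mul_div_assoc,
        ← Real.exp_add, ← Real.exp_sub, Pi.add_apply]
      congr 2
      ring
    rw [e]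
    refine softAvg_mono fun j => mul_le_mul_of_nonneg_right ?_ (hc j)
    have h2 := Real.add_one_le_exp (x j - D x + l)
    have h3 : Real.exp (x j - D x) = Real.exp (-l) * Real.exp (x j - D x + l) := by
      rw [← Real.exp_add]
      congr 1
      ring
    rw [h3]
    gcongr
    linarith
  have h2 := integral_mono (integrable_softAvg (g := fun _ => w) measurable_const
    (by fun_prop) hi) (integrable_softAvg (g := fun x => w + x) (c := fun _ => c) (by fun_prop)
    measurable_const fun j => integrable_const _) key
  rw [integral_softAvg_left w hi] at h2
  have e2 : (fun j => ∫ x : J → ℝ, Real.exp (-l) * (1 + x j - D x + l) * c j ∂m) =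
      fun j => Real.exp (-l) * c j := by
    ext j
    have i1 : Integrable (fun x : J → ℝ => 1 + x j) m := (integrable_const (1 : ℝ)).add (h1 j)
    have i2 : Integrable (fun x : J → ℝ => 1 + x j - D x) m := i1.sub hDi
    rw [integral_mul_const, integral_const_mul, integral_add i2 (integrable_const l),
      integral_sub i1 hDi, integral_add (integrable_const (1 : ℝ)) (h1 j), hmean j]
    simp [← hl]
  rw [e2, softAvg_const_mul] at h2
  calc softAvg w c = Real.exp l * (Real.exp (-l) * softAvg w c) := by
        rw [← mul_assoc, ← Real.exp_add]; simp
    _ ≤ _ := by gcongr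

/-- For a centred step, either the third-order or the second-order endpoint average is controlled
by the third moments averaged after the step, up to a multiple `1 / l` of the third moments averaged
before the step. -/
lemma integral_endAvg_le (hmean : ∀ j, ∫ x : J → ℝ, x j ∂m = 0)
    (h3 : ∀ j, Integrable (fun x : J → ℝ => |x j| ^ 3) m) (w : J → ℝ) {l : ℝ} (hl : 1 ≤ l) :
    10 * ∫ x, endAvg 3 w x ∂m ≤ 90 * l * stepMoment m w + 2 * (softAvg w (cubeMoment m) / l) ∨
    4 * ∫ x, endAvg 2 w x ∂m ≤ 90 * l * stepMoment m w + 2 * (softAvg w (cubeMoment m) / l) := by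
  have h1 := integrable_coord_of_cube h3
  have hT := stepMoment_eq_add h3 w
  set T₁ := ∫ x, softAvg (w + x) (fun j => |x j| ^ 3) ∂m with hT₁
  set T₂ := ∫ x, softAvg (w + x) (cubeMoment m) ∂m with hT₂
  set V := softAvg w (cubeMoment m) with hV
  have hT1 : 0 ≤ T₁ := integral_nonneg fun x => softAvg_nonneg fun j => by positivity
  have hT2 : 0 ≤ T₂ := integral_nonneg fun x => softAvg_nonneg (cubeMoment_nonneg m)
  have hV0 : 0 ≤ V := softAvg_nonneg (cubeMoment_nonneg m)
  have hVl : 0 ≤ V / l := by positivity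
  have hsplit : ∀ k : ℕ, k ≤ 3 → ∫ x, endAvg k w x ∂m =
      softAvg w (fun j => ∫ x : J → ℝ, max (-x j) 0 ^ k ∂m) +
      ∫ x, softAvg (w + x) (fun j => max (x j) 0 ^ k) ∂m := by
    intro k hk
    simp only [endAvg]
    rw [integral_add (integrable_softAvg (g := fun _ => w) measurable_const (by fun_prop)
      (integrable_negPart_pow h3 hk)) (integrable_softAvg (by fun_prop) (by fun_prop)
      (integrable_posPart_pow h3 hk)), integral_softAvg_left w (integrable_negPart_pow h3 hk)]
  have hneg3 : softAvg w (fun j => ∫ x : J → ℝ, max (-x j) 0 ^ 3 ∂m) ≤ V :=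
    softAvg_mono fun j => integral_mono (integrable_negPart_pow h3 le_rfl j) (h3 j) fun x =>
      pow_le_pow_left₀ (le_max_right _ _) (max_le (neg_le_abs _) (abs_nonneg _)) 3
  rcases le_total T₁ 1 with hc | hc
  -- A small step changes the smooth maximum by a bounded amount on average, so averages before the
  -- step are comparable to averages after it.
  · left
    have hpos3 : ∫ x, softAvg (w + x) (fun j => max (x j) 0 ^ 3) ∂m ≤ T₁ :=
      integral_mono (integrable_softAvg (by fun_prop) (by fun_prop)
        (integrable_posPart_pow h3 le_rfl)) (integrable_softAvg (by fun_prop) (by fun_prop) h3)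
        fun x => softAvg_mono fun j =>
          pow_le_pow_left₀ (le_max_right _ _) (max_le (le_abs_self _) (abs_nonneg _)) 3
    have hDm : Measurable fun x => smoothMax (w + x) - smoothMax w :=
      (measurable_smoothMax.comp (measurable_const_add w)).sub_const _
    have hD : ∫ x, (smoothMax (w + x) - smoothMax w) ∂m ≤ 2 := by
      have h2 : ∫ x, (smoothMax (w + x) - smoothMax w) ∂m ≤ ∫ x, softAvg (w + x) x ∂m :=
        integral_mono (Integrable.mono' (integrable_finsetSum Finset.univ
          fun j _ => (h1 j).abs) hDm.aestronglyMeasurable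
          (Filter.Eventually.of_forall fun x => abs_smoothMax_add_sub_le w x))
          (integrable_softAvg (by fun_prop) measurable_id h1) fun x => smoothMax_add_sub_le w x
      have h4 := integral_tilt_le h3 w measurable_id (fun y => by
        have h0 := abs_nonneg y
        simp only [id]
        nlinarith [sq_nonneg (|y| - 1), mul_nonneg h0 (sq_nonneg (|y| - 1))])
      simp only [id] at h4
      linarith
    have hV2 := softAvg_le_exp_mul_integral hmean h1 w (cubeMoment_nonneg m)
    have he : Real.exp (∫ x, (smoothMax (w + x) - smoothMax w) ∂m) ≤ 8 := by
      refine (Real.exp_le_exp.2 hD).trans ?_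
      have := Real.exp_one_lt_d9
      rw [show (2 : ℝ) = 1 + 1 by norm_num, Real.exp_add]
      nlinarith [Real.exp_pos 1]
    have hV3 : V ≤ 8 * T₂ := hV2.trans (mul_le_mul_of_nonneg_right he hT2)
    rw [hsplit 3 le_rfl, hT]
    nlinarith [mul_le_mul_of_nonneg_right hl (add_nonneg hT1 hT2)]
  -- A large step has `1 ≤ T₁`, so constants are absorbed and the second-order bound suffices.
  · right
    have hpos2 : ∫ x, softAvg (w + x) (fun j => max (x j) 0 ^ 2) ∂m ≤ 1 + T₁ :=
      integral_tilt_le h3 w (φ := fun y => max y 0 ^ 2) (by fun_prop) fun y => by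
        rw [abs_of_nonneg (by positivity)]
        exact max_zero_sq_le_one_add_cube y
    have hpos1 : ∫ x, softAvg (w + x) (fun j => max (x j) 0) ∂m ≤ 1 + T₁ :=
      integral_tilt_le h3 w (φ := fun y => max y 0) (by fun_prop) fun y => by
        rw [abs_of_nonneg (by positivity)]
        exact max_zero_le_one_add_cube y
    have ip : ∀ j, Integrable (fun x : J → ℝ => max (x j) 0) m := fun j => by
      simpa using integrable_posPart_pow h3 (k := 1) (by norm_num) j
    have ineg : ∀ j, Integrable (fun x : J → ℝ => max (-x j) 0) m := fun j => by
      simpa using integrable_negPart_pow h3 (k := 1) (by norm_num) j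
    -- Centring turns the negative part at `w` into the positive part, which tilting increases.
    have hneg1 : softAvg w (fun j => ∫ x : J → ℝ, max (-x j) 0 ∂m) ≤ 1 + T₁ := by
      have e : (fun j => ∫ x : J → ℝ, max (-x j) 0 ∂m) = fun j => ∫ x : J → ℝ, max (x j) 0 ∂m := by
        ext j
        have h4 : ∀ x : J → ℝ, max (-x j) 0 = max (x j) 0 - x j := fun x => by
          rcases le_total 0 (x j) with h | h
          · rw [max_eq_right (by linarith), max_eq_left h, sub_self]
          · rw [max_eq_left (by linarith), max_eq_right h, zero_sub]
        simp only [h4]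
        rw [integral_sub (ip j) (h1 j), hmean j, sub_zero]
      rw [e, ← integral_softAvg_left w ip]
      refine le_trans (integral_mono (integrable_softAvg (g := fun _ => w) measurable_const
        (by fun_prop) ip) (integrable_softAvg (g := fun x => w + x) (by fun_prop) (by fun_prop) ip)
        fun x => softAvg_le_softAvg_add w fun j k hjk => ?_) hpos1
      exact max_le_max hjk.le le_rfl
    -- Young's inequality `y² ≤ l y / 2 + y³ / (2 l)`.
    have hneg2 : softAvg w (fun j => ∫ x : J → ℝ, max (-x j) 0 ^ 2 ∂m) ≤
        l / 2 * (1 + T₁) + V / l / 2 := by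
      have h4 : ∀ j, ∫ x : J → ℝ, max (-x j) 0 ^ 2 ∂m ≤
          l / 2 * (∫ x : J → ℝ, max (-x j) 0 ∂m) +
            (1 / l / 2) * ∫ x : J → ℝ, max (-x j) 0 ^ 3 ∂m := by
        intro j
        rw [← integral_const_mul, ← integral_const_mul, ← integral_add ((ineg j).const_mul _)
          ((integrable_negPart_pow h3 le_rfl j).const_mul _)]
        refine integral_mono (integrable_negPart_pow h3 (by norm_num) j)
          (((ineg j).const_mul _).add ((integrable_negPart_pow h3 le_rfl j).const_mul _))
          fun x => ?_
        have hy : 0 ≤ max (-x j) 0 := le_max_right _ _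
        generalize max (-x j) 0 = y at hy
        have hl0 : 0 < l := by linarith
        have : l / 2 * y + 1 / l / 2 * y ^ 3 - y ^ 2 = y * (y - l) ^ 2 / (2 * l) := by
          field_simp
          ring
        have h5 : 0 ≤ y * (y - l) ^ 2 / (2 * l) := by positivity
        simp only
        linarith
      refine (softAvg_mono h4).trans ?_
      rw [softAvg_add, softAvg_const_mul, softAvg_const_mul]
      refine add_le_add (by gcongr) ?_
      calc _ ≤ 1 / l / 2 * V := by gcongr
        _ = _ := by ring
    rw [hsplit 2 (by norm_num), hT]
    nlinarith [mul_le_mul_of_nonneg_right hl hT1, mul_nonneg (by linarith : 0 ≤ l) hT2,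
      mul_le_mul_of_nonneg_left hc (by linarith : 0 ≤ l)]

end

section

variable [Nonempty J] {K : ℝ} {f f₁ f₂ f₃ : ℝ → ℝ}

lemma HasBoundedDerivs.measurable (hf : HasBoundedDerivs K f f₁ f₂ f₃) :
    Measurable f ∧ Measurable f₁ ∧ Measurable f₂ :=
  ⟨(continuous_iff_continuousAt.2 fun x => (hf.deriv₁ x).continuousAt).measurable,
    (continuous_iff_continuousAt.2 fun x => (hf.deriv₂ x).continuousAt).measurable,
    (continuous_iff_continuousAt.2 fun x => (hf.deriv₃ x).continuousAt).measurable⟩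

/-- The expected Taylor remainders of a centred random step. The parameter `l` trades the moments
averaged after the step against those averaged before it. -/
lemma abs_integral_rem_le {m : Measure (J → ℝ)} [IsProbabilityMeasure m]
    (hf : HasBoundedDerivs K f f₁ f₂ f₃)
    (hmean : ∀ j, ∫ x : J → ℝ, x j ∂m = 0)
    (h3 : ∀ j, Integrable (fun x : J → ℝ => |x j| ^ 3) m) (w : J → ℝ) {l : ℝ} (hl : 1 ≤ l) :
    |∫ x, rem₀ f f₁ f₂ w x ∂m| ≤
        K * (90 * l * stepMoment m w + 2 * (softAvg w (cubeMoment m) / l)) ∧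
      |∫ x, rem₁ f₁ f₂ w x ∂m| ≤
        K * (90 * l * stepMoment m w + 2 * (softAvg w (cubeMoment m) / l)) := by
  have hK := hf.nonneg
  have hi : ∀ k : ℕ, k ≤ 3 → Integrable (fun x => endAvg k w x) m := fun k hk =>
    (integrable_softAvg (g := fun _ => w) measurable_const (by fun_prop)
      (integrable_negPart_pow h3 hk)).add (integrable_softAvg (by fun_prop) (by fun_prop)
      (integrable_posPart_pow h3 hk))
  have key : ∀ (R : (J → ℝ) → ℝ) (k : ℕ) (a : ℝ), k ≤ 3 → (∀ x, |R x| ≤ a * K * endAvg k w x) →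
      a * ∫ x, endAvg k w x ∂m ≤ 90 * l * stepMoment m w + 2 * (softAvg w (cubeMoment m) / l) →
      |∫ x, R x ∂m| ≤ K * (90 * l * stepMoment m w + 2 * (softAvg w (cubeMoment m) / l)) := by
    intro R k a hk hR hb
    have h1 : |∫ x, R x ∂m| ≤ ∫ x, a * K * endAvg k w x ∂m :=
      norm_integral_le_of_norm_le (f := R) ((hi k hk).const_mul (a * K))
        (Filter.Eventually.of_forall hR)
    rw [integral_const_mul] at h1
    calc _ ≤ _ := h1
      _ = K * (a * ∫ x, endAvg k w x ∂m) := by ring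
      _ ≤ _ := by gcongr
  rcases integral_endAvg_le hmean h3 w hl with h | h
  · exact ⟨key _ 3 10 le_rfl (fun x => (abs_rem_le_endAvg_three hf w x).1) h,
      key _ 3 10 le_rfl (fun x => (abs_rem_le_endAvg_three hf w x).2) h⟩
  · exact ⟨key _ 2 4 (by norm_num) (fun x => (abs_rem_le_endAvg_two hf w x).1) h,
      key _ 2 4 (by norm_num) (fun x => (abs_rem_le_endAvg_two hf w x).2) h⟩

/-- The Taylor remainders are bounded by any power of the step between two and three. -/
lemma abs_rem_le_rpow (hf : HasBoundedDerivs K f f₁ f₂ f₃) (w x : J → ℝ) {a : ℝ}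
    (hx : ∀ j, |x j| ≤ a) {q : ℝ} (hq2 : 2 ≤ q) (hq3 : q ≤ 3) :
    |rem₀ f f₁ f₂ w x| ≤ 20 * K * a ^ q ∧ |rem₁ f₁ f₂ w x| ≤ 20 * K * a ^ q := by
  have hK := hf.nonneg
  have ha : 0 ≤ a := (abs_nonneg _).trans (hx (Classical.arbitrary J))
  have hend : ∀ k : ℕ, endAvg k w x ≤ 2 * a ^ k := by
    intro k
    have h1 : softAvg w (fun j => (max (-x j) 0) ^ k) ≤ a ^ k := softAvg_le fun j =>
      pow_le_pow_left₀ (le_max_right _ _) (max_le ((neg_le_abs _).trans (hx j)) ha) k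
    have h2 : softAvg (w + x) (fun j => (max (x j) 0) ^ k) ≤ a ^ k := softAvg_le fun j =>
      pow_le_pow_left₀ (le_max_right _ _) (max_le ((le_abs_self _).trans (hx j)) ha) k
    rw [endAvg]
    linarith
  rcases le_total a 1 with h | h
  · have h1 : a ^ 3 ≤ a ^ q := by
      rw [← Real.rpow_natCast]
      exact Real.rpow_le_rpow_of_exponent_ge_of_imp ha h (by simpa using hq3) (by
        intro _ h0
        norm_num at h0)
    have h2 : 10 * K * endAvg 3 w x ≤ 20 * K * a ^ q := by
      calc 10 * K * endAvg 3 w x ≤ 10 * K * (2 * a ^ q) := by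
            gcongr
            exact (hend 3).trans (by linarith)
        _ = _ := by ring
    have h3 := abs_rem_le_endAvg_three hf w x
    exact ⟨h3.1.trans h2, h3.2.trans h2⟩
  · have h1 : a ^ 2 ≤ a ^ q := by
      rw [← Real.rpow_natCast]
      exact Real.rpow_le_rpow_of_exponent_le h (by simpa using hq2)
    have h2 : 4 * K * endAvg 2 w x ≤ 20 * K * a ^ q := by
      calc 4 * K * endAvg 2 w x ≤ 4 * K * (2 * a ^ q) := by
            gcongr
            exact (hend 2).trans (by linarith)
        _ ≤ _ := by nlinarith [mul_nonneg hK (Real.rpow_nonneg ha q)]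
    have h3 := abs_rem_le_endAvg_two hf w x
    exact ⟨h3.1.trans h2, h3.2.trans h2⟩

end

end OneStep

section Path

variable {J : Type*}

/-! ### The interpolation path -/

/-- The random mark of a summand: `none` deletes the summand, `some b` picks the family `b`. -/
abbrev Mark := Option Bool

instance : MeasurableSpace Mark := ⊤

instance : DiscreteMeasurableSpace Mark := ⟨fun _ => trivial⟩

/-- The uniform law on the three marks. The path reweights it by densities, so that only one
reference measure is needed. -/
def markLaw : Measure Mark := (3 : ℝ≥0∞)⁻¹ • Measure.count

instance : IsProbabilityMeasure markLaw := ⟨by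
  rw [markLaw, Measure.smul_apply, Measure.count_univ]
  simp only [ENat.card_eq_coe_fintype_card, Fintype.card_option, Fintype.card_bool, smul_eq_mul]
  norm_num
  exact ENNReal.inv_mul_cancel (by norm_num) (by norm_num)⟩

lemma integral_markLaw (h : Mark → ℝ) : ∫ k, h k ∂markLaw = (∑ k, h k) / 3 := by
  rw [markLaw, integral_smul_measure, integral_count]
  simp [div_eq_inv_mul]

/-- A mark together with one candidate vector from each of the two families. -/
abbrev State (J : Type*) := Mark × (Bool → J → ℝ)

/-- The scale at time `s` of the family `b`; the path starts at the family `β`. -/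
def pathScale (β : Bool) (s : ℝ) (b : Bool) : ℝ := if b = β then 1 + s ^ 2 else 2 * s

/-- The derivative of `pathScale`. -/
def pathScaleDeriv (β : Bool) (s : ℝ) (b : Bool) : ℝ := if b = β then 2 * s else 2

/-- The probability of the family `b` at time `s`. -/
def famWeight (β : Bool) (s : ℝ) (b : Bool) : ℝ :=
  if b = β then (1 - s ^ 4 / 2) / (1 + s ^ 2) ^ 2 else s ^ 2 / 8

/-- The derivative of `famWeight`. -/
def famWeightDeriv (β : Bool) (s : ℝ) (b : Bool) : ℝ :=
  if b = β then -(4 * s + 2 * s ^ 3) / (1 + s ^ 2) ^ 3 else s / 4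

/-- The law of the mark at time `s`. It starts at the point mass at `some β`; at time `1` it is
symmetric in the two families, and the second moment of the scale is `1` at all times. -/
def pathWeight (β : Bool) (s : ℝ) : Mark → ℝ
  | none => 1 - famWeight β s β - famWeight β s (!β)
  | some b => famWeight β s b

/-- The derivative of `pathWeight`. -/
def pathWeightDeriv (β : Bool) (s : ℝ) : Mark → ℝ
  | none => - famWeightDeriv β s β - famWeightDeriv β s (!β)
  | some b => famWeightDeriv β s b

lemma hasDerivAt_pathScale (β : Bool) (s : ℝ) (b : Bool) :
    HasDerivAt (fun s => pathScale β s b) (pathScaleDeriv β s b) s := by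
  unfold pathScale pathScaleDeriv
  split_ifs
  · simpa using (hasDerivAt_pow 2 s).const_add 1
  · simpa using (hasDerivAt_id s).const_mul 2

lemma hasDerivAt_famWeight (β : Bool) (s : ℝ) (b : Bool) :
    HasDerivAt (fun s => famWeight β s b) (famWeightDeriv β s b) s := by
  unfold famWeight famWeightDeriv
  split_ifs
  · have h0 : (1 + s ^ 2) ≠ 0 := by positivity
    have h1 : HasDerivAt (fun s : ℝ => 1 - s ^ 4 / 2) (-(4 * s ^ 3 / 2)) s := by
      simpa using ((hasDerivAt_pow 4 s).div_const 2).const_sub 1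
    have h2 : HasDerivAt (fun s : ℝ => (1 + s ^ 2) ^ 2) (2 * (1 + s ^ 2) * (2 * s)) s := by
      simpa using ((hasDerivAt_pow 2 s).const_add 1).fun_pow 2
    refine (h1.fun_div h2 (by positivity)).congr_deriv ?_
    field_simp
    ring
  · refine ((hasDerivAt_pow 2 s).div_const 8).congr_deriv ?_
    simp
    ring

lemma hasDerivAt_pathWeight (β : Bool) (s : ℝ) (k : Mark) :
    HasDerivAt (fun s => pathWeight β s k) (pathWeightDeriv β s k) s := by
  cases k with
  | none => simpa [pathWeight, pathWeightDeriv] using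
      ((hasDerivAt_famWeight β s β).const_sub 1).fun_sub (hasDerivAt_famWeight β s (!β))
  | some b => exact hasDerivAt_famWeight β s b

lemma continuous_pathWeight (β : Bool) (k : Mark) : Continuous fun s => pathWeight β s k :=
  continuous_iff_continuousAt.2 fun s => (hasDerivAt_pathWeight β s k).continuousAt

lemma continuous_pathScaleDeriv (β b : Bool) : Continuous fun s => pathScaleDeriv β s b := by
  unfold pathScaleDeriv
  split_ifs <;> fun_prop

lemma continuous_famWeightDeriv (β b : Bool) : Continuous fun s => famWeightDeriv β s b := by
  unfold famWeightDeriv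
  split_ifs
  · exact Continuous.div (by fun_prop) (by fun_prop) fun s => by positivity
  · fun_prop

lemma continuous_pathWeightDeriv (β : Bool) (k : Mark) :
    Continuous fun s => pathWeightDeriv β s k := by
  have h1 := continuous_famWeightDeriv β β
  have h2 := continuous_famWeightDeriv β (!β)
  cases k with
  | none => exact h1.neg.sub h2
  | some b => exact continuous_famWeightDeriv β b

lemma sum_pathWeight (β : Bool) (s : ℝ) : ∑ k, pathWeight β s k = 1 := by
  rw [Fintype.sum_option, Fintype.sum_bool]
  cases β
  · simp only [pathWeight, Bool.not_false]
    ring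
  · simp only [pathWeight, Bool.not_true]
    ring

lemma sum_pathWeightDeriv (β : Bool) (s : ℝ) : ∑ k, pathWeightDeriv β s k = 0 := by
  rw [Fintype.sum_option, Fintype.sum_bool]
  cases β
  · simp only [pathWeightDeriv, Bool.not_false]
    ring
  · simp only [pathWeightDeriv, Bool.not_true]
    ring

/-- Half the time derivative of the second moment of the scale vanishes. -/
lemma sum_variance_deriv (β : Bool) (s : ℝ) :
    ∑ b, (famWeightDeriv β s b * pathScale β s b ^ 2 / 2 +
      famWeight β s b * pathScaleDeriv β s b * pathScale β s b) = 0 := by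
  have h0 : (1 + s ^ 2) ≠ 0 := by positivity
  rw [Fintype.sum_bool]
  cases β <;> simp [famWeight, famWeightDeriv, pathScale, pathScaleDeriv] <;> field_simp <;> ring

section bounds

variable {s : ℝ}

lemma famWeight_start_ge (hs0 : 0 < s) (hs1 : s < 1) (β : Bool) : 1 / 8 ≤ famWeight β s β := by
  have h2 : s ^ 2 ≤ 1 := by nlinarith
  have h4 : s ^ 4 ≤ 1 := by nlinarith
  rw [famWeight, if_pos rfl, le_div_iff₀ (by positivity)]
  nlinarith

/-- Every summand is absent with probability of order `s ^ 2`. -/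
lemma pathWeight_none_ge (hs0 : 0 < s) (hs1 : s < 1) (β : Bool) :
    s ^ 2 / 2 ≤ pathWeight β s none := by
  have h2 : s ^ 2 ≤ 1 := by nlinarith
  have h0 : 0 < s ^ 2 := by positivity
  have h : famWeight β s β ≤ 1 - 5 * s ^ 2 / 8 := by
    rw [famWeight, if_pos rfl, div_le_iff₀ (by positivity)]
    set r := s ^ 2
    rw [show s ^ 4 = r ^ 2 by simp [r]; ring]
    nlinarith [mul_nonneg h0.le (sub_nonneg.2 h2), mul_nonneg (sq_nonneg r) (sub_nonneg.2 h2)]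
  have h' : famWeight β s (!β) = s ^ 2 / 8 := by
    rw [famWeight, if_neg (by simp)]
  simp only [pathWeight, h']
  linarith

lemma famWeight_pos (hs0 : 0 < s) (hs1 : s < 1) (β : Bool) (b : Bool) : 0 < famWeight β s b := by
  by_cases hb : b = β
  · subst hb
    linarith [famWeight_start_ge hs0 hs1 b]
  · rw [famWeight, if_neg hb]
    positivity

lemma pathWeight_pos (hs0 : 0 < s) (hs1 : s < 1) (β : Bool) (k : Mark) : 0 < pathWeight β s k := by
  cases k with
  | none => linarith [pathWeight_none_ge hs0 hs1 β, pow_pos hs0 2]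
  | some b => exact famWeight_pos hs0 hs1 β b

lemma pathWeight_le_one (hs0 : 0 < s) (hs1 : s < 1) (β : Bool) (k : Mark) :
    pathWeight β s k ≤ 1 := by
  rw [← sum_pathWeight β s]
  exact Finset.single_le_sum (f := pathWeight β s)
    (fun k _ => (pathWeight_pos hs0 hs1 β k).le) (Finset.mem_univ k)

lemma pathScale_pos (hs0 : 0 < s) (β : Bool) (b : Bool) : 0 < pathScale β s b := by
  unfold pathScale
  split_ifs <;> positivity

lemma pathScale_le_two (hs0 : 0 < s) (hs1 : s < 1) (β : Bool) (b : Bool) : pathScale β s b ≤ 2 := by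
  unfold pathScale
  split_ifs <;> nlinarith

lemma abs_famWeightDeriv_le (hs0 : 0 < s) (hs1 : s < 1) (β : Bool) (b : Bool) :
    |famWeightDeriv β s b| ≤ 8 * s := by
  unfold famWeightDeriv
  split_ifs
  · have h2 : s ^ 2 ≤ 1 := by nlinarith
    rw [abs_div, abs_neg, abs_of_nonneg (by positivity), abs_of_nonneg (by positivity)]
    refine (div_le_self (by positivity) (one_le_pow₀ (by nlinarith))).trans ?_
    nlinarith
  · rw [abs_of_nonneg (by positivity)]
    linarith

lemma abs_logScale_le (hs0 : 0 < s) (hs1 : s < 1) (β : Bool) (b : Bool) :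
    |famWeight β s b * (pathScaleDeriv β s b / pathScale β s b)| ≤ 8 * s := by
  have h1 := famWeight_pos hs0 hs1 β b
  have h3 : famWeight β s b ≤ 1 := pathWeight_le_one hs0 hs1 β (some b)
  by_cases hb : b = β
  · rw [pathScaleDeriv, pathScale, if_pos hb, if_pos hb, abs_of_nonneg (by positivity)]
    have h2 : 2 * s / (1 + s ^ 2) ≤ 2 * s := div_le_self (by positivity) (by nlinarith)
    calc _ ≤ 1 * (2 * s) := mul_le_mul h3 h2 (by positivity) zero_le_one
      _ ≤ _ := by linarith
  · rw [pathScaleDeriv, pathScale, famWeight, if_neg hb, if_neg hb, if_neg hb,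
      abs_of_nonneg (by positivity)]
    have : s ^ 2 / 8 * (2 / (2 * s)) = s / 8 := by field_simp
    rw [this]
    linarith

lemma cube_scale_div_le (hs0 : 0 < s) (hs1 : s < 1) (β : Bool) (b : Bool) :
    pathScale β s b ^ 3 / famWeight β s b ≤ 64 := by
  rw [div_le_iff₀ (famWeight_pos hs0 hs1 β b)]
  by_cases hb : b = β
  · subst hb
    have h1 := famWeight_start_ge hs0 hs1 b
    have h2 : pathScale b s b ^ 3 ≤ 2 ^ 3 :=
      pow_le_pow_left₀ (pathScale_pos hs0 b b).le (pathScale_le_two hs0 hs1 b b) 3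
    linarith
  · rw [pathScale, famWeight, if_neg hb, if_neg hb]
    nlinarith [pow_pos hs0 2]

end bounds

/-- The vector contributed at time `s` by one summand in state `z`. -/
def pathStep (β : Bool) (s : ℝ) (z : State J) : J → ℝ :=
  z.1.elim 0 fun b => pathScale β s b • z.2 b

/-- The time derivative of `pathStep`. -/
def pathStepDeriv (β : Bool) (s : ℝ) (z : State J) : J → ℝ :=
  z.1.elim 0 fun b => pathScaleDeriv β s b • z.2 b

lemma hasDerivAt_pathStep (β : Bool) (s : ℝ) (z : State J) (j : J) :
    HasDerivAt (fun s => pathStep β s z j) (pathStepDeriv β s z j) s := by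
  obtain ⟨k, v⟩ := z
  cases k with
  | none => simpa [pathStep, pathStepDeriv] using hasDerivAt_const s (0 : ℝ)
  | some b => simpa [pathStep, pathStepDeriv] using (hasDerivAt_pathScale β s b).mul_const (v b j)

lemma measurable_pathStep (β : Bool) (s : ℝ) : Measurable (pathStep (J := J) β s) := by
  refine measurable_from_prod_countable_right fun k => ?_
  cases k with
  | none => exact measurable_const
  | some b => exact (measurable_pi_apply b).const_smul (pathScale β s b)

lemma measurable_pathStepDeriv (β : Bool) (s : ℝ) : Measurable (pathStepDeriv (J := J) β s) := by
  refine measurable_from_prod_countable_right fun k => ?_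
  cases k with
  | none => exact measurable_const
  | some b => exact (measurable_pi_apply b).const_smul (pathScaleDeriv β s b)

lemma measurable_mark {α : Type*} [MeasurableSpace α] (h : Mark → α) :
    Measurable fun z : State J => h z.1 :=
  (Measurable.of_discrete (f := h)).comp measurable_fst

end Path

section Reference

variable {J : Type*} {N : Type*} [Fintype N] [DecidableEq N]

/-! ### Resampling one coordinate of a product measure -/

lemma measurePreserving_update {α : N → Type*} [∀ i, MeasurableSpace (α i)] (μ : ∀ i, Measure (α i))
    [∀ i, IsProbabilityMeasure (μ i)] (i : N) :
    MeasurePreserving (fun p : (∀ i, α i) × α i => Function.update p.1 i p.2)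
      ((Measure.pi μ).prod (μ i)) (Measure.pi μ) := by
  have hm : Measurable fun p : (∀ i, α i) × α i => Function.update p.1 i p.2 := by
    refine measurable_pi_lambda _ fun k => ?_
    by_cases hk : k = i
    · subst hk
      simpa using measurable_snd
    · simp only [Function.update_of_ne hk]
      exact (measurable_pi_apply k).comp measurable_fst
  refine ⟨hm, (Measure.pi_eq fun t ht => ?_).symm⟩
  rw [Measure.map_apply hm (MeasurableSet.univ_pi ht)]
  have e : (fun p : (∀ i, α i) × α i => Function.update p.1 i p.2) ⁻¹' Set.univ.pi t =
      (Set.univ.pi (Function.update t i Set.univ)) ×ˢ t i := by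
    ext ⟨z, y⟩
    simp only [Set.mem_preimage, Set.mem_univ_pi, Set.mem_prod]
    constructor
    · intro h
      refine ⟨fun k => ?_, by simpa using h i⟩
      by_cases hk : k = i
      · subst hk
        simp
      · simpa [hk] using h k
    · rintro ⟨h, hi⟩ k
      by_cases hk : k = i
      · subst hk
        simpa using hi
      · simpa [hk] using h k
  rw [e, Measure.prod_prod, Measure.pi_pi, ← Finset.mul_prod_erase _ _ (Finset.mem_univ i),
    ← Finset.mul_prod_erase Finset.univ (fun k => μ k (t k)) (Finset.mem_univ i)]
  simp only [Function.update_self, measure_univ, one_mul]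
  rw [mul_comm]
  congr 1
  refine Finset.prod_congr rfl fun k hk => ?_
  rw [Function.update_of_ne (Finset.ne_of_mem_erase hk)]

/-- Fubini with one coordinate resampled. -/
lemma integral_pi_eq_integral_update {α : N → Type*} [∀ i, MeasurableSpace (α i)]
    (μ : ∀ i, Measure (α i)) [∀ i, IsProbabilityMeasure (μ i)] (i : N) {A : (∀ i, α i) → ℝ}
    (hA : Integrable A (Measure.pi μ)) :
    ∫ z, A z ∂(Measure.pi μ) =
      ∫ z, ∫ y, A (Function.update z i y) ∂(μ i) ∂(Measure.pi μ) := by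
  have hp := measurePreserving_update μ i
  have hA' : Integrable (fun p : (∀ i, α i) × α i => A (Function.update p.1 i p.2))
      ((Measure.pi μ).prod (μ i)) := hp.integrable_comp_of_integrable hA
  rw [← integral_prod _ hA']
  conv_lhs => rw [← hp.map_eq]
  rw [integral_map hp.measurable.aemeasurable (by rw [hp.map_eq]; exact hA.aestronglyMeasurable)]

/-! ### The reference measure -/

/-- The reference law of the state of one summand: a uniform mark and independent candidates from
the two families. -/
def stateLaw (L : Bool → N → Measure (J → ℝ)) (i : N) : Measure (State J) :=
  markLaw.prod (Measure.pi fun b => L b i)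

/-- The reference law of all states: the summands are independent. -/
def refLaw (L : Bool → N → Measure (J → ℝ)) : Measure (N → State J) :=
  Measure.pi (stateLaw L)

/-- The density of the law of the marks at time `s`. -/
def markDensity (β : Bool) (s : ℝ) (z : N → State J) : ℝ := ∏ i, 3 * pathWeight β s (z i).1

/-- The density of the law of the marks of all summands but `i`. -/
def markDensityErase (β : Bool) (s : ℝ) (i : N) (z : N → State J) : ℝ :=
  ∏ k ∈ Finset.univ.erase i, 3 * pathWeight β s (z k).1

/-- The interpolated sum. -/
def pathSum (β : Bool) (s : ℝ) (z : N → State J) : J → ℝ := ∑ i, pathStep β s (z i)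

/-- The interpolated sum without the summand `i`. -/
def pathSumErase (β : Bool) (s : ℝ) (i : N) (z : N → State J) : J → ℝ :=
  ∑ k ∈ Finset.univ.erase i, pathStep β s (z k)

lemma markDensity_update (β : Bool) (s : ℝ) (i : N) (z : N → State J) (y : State J) :
    markDensity β s (Function.update z i y) =
      3 * pathWeight β s y.1 * markDensityErase β s i z := by
  rw [markDensity, ← Finset.mul_prod_erase _ _ (Finset.mem_univ i), Function.update_self,
    markDensityErase]
  congr 1
  refine Finset.prod_congr rfl fun k hk => ?_
  rw [Function.update_of_ne (Finset.ne_of_mem_erase hk)]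

lemma markDensityErase_update (β : Bool) (s : ℝ) (i : N) (z : N → State J) (y : State J) :
    markDensityErase β s i (Function.update z i y) = markDensityErase β s i z := by
  refine Finset.prod_congr rfl fun k hk => ?_
  rw [Function.update_of_ne (Finset.ne_of_mem_erase hk)]

lemma pathSumErase_update (β : Bool) (s : ℝ) (i : N) (z : N → State J) (y : State J) :
    pathSumErase β s i (Function.update z i y) = pathSumErase β s i z := by
  refine Finset.sum_congr rfl fun k hk => ?_
  rw [Function.update_of_ne (Finset.ne_of_mem_erase hk)]

lemma pathSumErase_add (β : Bool) (s : ℝ) (i : N) (z : N → State J) :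
    pathSumErase β s i z + pathStep β s (z i) = pathSum β s z :=
  Finset.sum_erase_add _ _ (Finset.mem_univ i)

lemma pathSum_update (β : Bool) (s : ℝ) (i : N) (z : N → State J) (y : State J) :
    pathSum β s (Function.update z i y) = pathSumErase β s i z + pathStep β s y := by
  rw [← pathSumErase_add β s i, pathSumErase_update, Function.update_self]

lemma measurable_markDensity (β : Bool) (s : ℝ) :
    Measurable (markDensity (J := J) (N := N) β s) :=
  Finset.measurable_fun_prod _ fun i _ =>
    ((measurable_mark (pathWeight β s)).comp (measurable_pi_apply i)).const_mul 3

lemma measurable_markDensityErase (β : Bool) (s : ℝ) (i : N) :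
    Measurable (markDensityErase (J := J) β s i) :=
  Finset.measurable_fun_prod _ fun i _ =>
    ((measurable_mark (pathWeight β s)).comp (measurable_pi_apply i)).const_mul 3

lemma measurable_pathSum (β : Bool) (s : ℝ) : Measurable (pathSum (J := J) (N := N) β s) :=
  Finset.measurable_fun_sum _ fun i _ =>
    (measurable_pathStep β s).comp (measurable_pi_apply i)

lemma measurable_pathSumErase (β : Bool) (s : ℝ) (i : N) :
    Measurable (pathSumErase (J := J) β s i) :=
  Finset.measurable_fun_sum _ fun i _ =>
    (measurable_pathStep β s).comp (measurable_pi_apply i)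

section

variable (L : Bool → N → Measure (J → ℝ)) [∀ b i, IsProbabilityMeasure (L b i)]

instance (i : N) : IsProbabilityMeasure (stateLaw L i) := by
  unfold stateLaw
  infer_instance

instance : IsProbabilityMeasure (refLaw L) := by
  unfold refLaw
  infer_instance

lemma integral_stateLaw (i : N) {F : State J → ℝ} (hF : Integrable F (stateLaw L i)) :
    ∫ y, F y ∂(stateLaw L i) =
      (∑ k, ∫ v, F (k, v) ∂(Measure.pi fun b => L b i)) / 3 := by
  rw [stateLaw, integral_prod _ hF, integral_markLaw]

lemma measurePreserving_state (b : Bool) (i : N) :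
    MeasurePreserving (fun y : State J => y.2 b) (stateLaw L i) (L b i) :=
  (measurePreserving_eval (fun b => L b i) b).comp
    (measurePreserving_snd (μ := markLaw) (ν := Measure.pi fun b => L b i))

lemma measurePreserving_ref (b : Bool) :
    MeasurePreserving (fun (z : N → State J) i => (z i).2 b) (refLaw L) (Measure.pi (L b)) :=
  measurePreserving_pi (stateLaw L) (L b) fun i => measurePreserving_state L b i

lemma measurePreserving_ref_apply (b : Bool) (i : N) :
    MeasurePreserving (fun (z : N → State J) => (z i).2 b) (refLaw L) (L b i) :=
  (measurePreserving_eval (L b) i).comp (measurePreserving_ref L b)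

lemma integral_markDensity_factor (β : Bool) (s : ℝ) :
    ∫ k : N → Mark, ∏ i, 3 * pathWeight β s (k i) ∂(Measure.pi fun _ => markLaw) = 1 := by
  rw [integral_fintype_prod_eq_prod (fun _ k => 3 * pathWeight β s k)]
  refine Finset.prod_eq_one fun i _ => ?_
  rw [integral_const_mul, integral_markLaw, sum_pathWeight]
  norm_num

/-- The marks are independent of the candidate vectors. -/
lemma integral_markDensity_mul (β : Bool) (s : ℝ) (b : Bool) {h : (N → J → ℝ) → ℝ}
    (hm : Measurable h) :
    ∫ z, markDensity β s z * h (fun i => (z i).2 b) ∂(refLaw L) = ∫ x, h x ∂(Measure.pi (L b)) := by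
  have e := measurePreserving_arrowProdEquivProdArrow Mark (Bool → J → ℝ) N (fun _ => markLaw)
    (fun i => Measure.pi fun b => L b i)
  have h1 : ∫ z, markDensity β s z * h (fun i => (z i).2 b) ∂(refLaw L) =
      ∫ p : (N → Mark) × (N → Bool → J → ℝ),
        (∏ i, 3 * pathWeight β s (p.1 i)) * h (fun i => p.2 i b)
        ∂((Measure.pi fun _ => markLaw).prod (Measure.pi fun i => Measure.pi fun b => L b i)) :=
    e.integral_comp' (fun p : (N → Mark) × (N → Bool → J → ℝ) =>
        (∏ i, 3 * pathWeight β s (p.1 i)) * h (fun i => p.2 i b))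
  rw [h1, integral_prod_mul (fun k : N → Mark => ∏ i, 3 * pathWeight β s (k i))
    (fun v : N → Bool → J → ℝ => h (fun i => v i b)), integral_markDensity_factor, one_mul]
  have hp : MeasurePreserving (fun (v : N → Bool → J → ℝ) i => v i b)
      (Measure.pi fun i => Measure.pi fun b => L b i) (Measure.pi (L b)) :=
    measurePreserving_pi _ _ fun i => measurePreserving_eval (fun b => L b i) b
  rw [← hp.map_eq, integral_map hp.measurable.aemeasurable hm.aestronglyMeasurable]

end

end Reference

section PathDerivative

variable {J : Type*} [Fintype J] {N : Type*} [Fintype N] [DecidableEq N]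

/-! ### The derivative along the path -/

/-- The two families of laws are centred and have the same second moments. -/
structure MomentMatched (L : Bool → N → Measure (J → ℝ)) : Prop where
  mean : ∀ b i j, ∫ x, x j ∂(L b i) = 0
  sq : ∀ b i j, Integrable (fun x => x j ^ 2) (L b i)
  cov : ∀ i j k, ∫ x, x j * x k ∂(L true i) = ∫ x, x j * x k ∂(L false i)

lemma lin_smul (f₁ : ℝ → ℝ) (w x : J → ℝ) (c : ℝ) : lin f₁ w (c • x) = c * lin f₁ w x := by
  have : softAvg w (c • x) = c * softAvg w x := softAvg_const_mul w x c
  rw [lin, lin, this]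
  ring

lemma quad_smul (f₁ f₂ : ℝ → ℝ) (w x : J → ℝ) (c : ℝ) :
    quad f₁ f₂ w (c • x) = c ^ 2 * quad f₁ f₂ w x := by
  have h1 : softAvg w (c • x) = c * softAvg w x := softAvg_const_mul w x c
  have h2 : softAvg w (fun j => (c • x) j ^ 2) = c ^ 2 * softAvg w (fun j => x j ^ 2) := by
    rw [← softAvg_const_mul]
    congr 1
    ext j
    simp [mul_pow]
  rw [quad, quad, h1, h2]
  ring

lemma integrable_coord_of_sq {m : Measure (J → ℝ)} [IsProbabilityMeasure m]
    (h2 : ∀ j, Integrable (fun x : J → ℝ => x j ^ 2) m) (j : J) :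
    Integrable (fun x : J → ℝ => x j) m := by
  refine Integrable.mono' ((integrable_const (1 : ℝ)).add (h2 j))
    (measurable_pi_apply j).aestronglyMeasurable (Filter.Eventually.of_forall fun x => ?_)
  simp only [Pi.add_apply, Real.norm_eq_abs]
  rw [← sq_abs]
  nlinarith [sq_nonneg (|x j| - 1), abs_nonneg (x j)]

lemma integrable_coord_mul {m : Measure (J → ℝ)}
    (h2 : ∀ j, Integrable (fun x : J → ℝ => x j ^ 2) m) (j k : J) :
    Integrable (fun x : J → ℝ => x j * x k) m := by
  refine Integrable.mono' ((h2 j).add (h2 k)) (by fun_prop)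
    (Filter.Eventually.of_forall fun x => ?_)
  simp only [Pi.add_apply, Real.norm_eq_abs, abs_mul]
  rw [← sq_abs (x j), ← sq_abs (x k)]
  nlinarith [sq_nonneg (|x j| - |x k|), sq_nonneg (|x j| + |x k|)]

section Step

variable {m : Measure (J → ℝ)} [IsProbabilityMeasure m] {K : ℝ} {f f₁ f₂ f₃ : ℝ → ℝ}

lemma integrable_lin (hmean : ∀ j, Integrable (fun x : J → ℝ => x j) m) (w : J → ℝ) :
    Integrable (fun x => lin f₁ w x) m := by
  simp only [lin, softAvg]
  exact ((integrable_finsetSum _ fun j _ => (hmean j).const_mul _).div_const _).const_mul _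

lemma integral_lin (h1 : ∀ j, Integrable (fun x : J → ℝ => x j) m)
    (hmean : ∀ j, ∫ x : J → ℝ, x j ∂m = 0) (w : J → ℝ) : ∫ x, lin f₁ w x ∂m = 0 := by
  simp only [lin]
  rw [integral_const_mul, integral_softAvg_left w h1]
  simp [hmean, softAvg]

lemma sq_softAvg (w x : J → ℝ) : softAvg w x ^ 2 =
    (∑ j, ∑ k, Real.exp (w j) * Real.exp (w k) * (x j * x k)) / partition w ^ 2 := by
  rw [softAvg, div_pow, pow_two, Finset.sum_mul_sum]
  congr 1
  exact Finset.sum_congr rfl fun j _ => Finset.sum_congr rfl fun k _ => by ring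

lemma integrable_sq_softAvg (h2 : ∀ j, Integrable (fun x : J → ℝ => x j ^ 2) m) (w : J → ℝ) :
    Integrable (fun x => softAvg w x ^ 2) m := by
  simp only [sq_softAvg]
  exact (integrable_finsetSum _ fun j _ => integrable_finsetSum _ fun k _ =>
    (integrable_coord_mul h2 j k).const_mul _).div_const _

lemma integrable_softAvg_sq (h2 : ∀ j, Integrable (fun x : J → ℝ => x j ^ 2) m) (w : J → ℝ) :
    Integrable (fun x : J → ℝ => softAvg w fun j => x j ^ 2) m := by
  simp only [softAvg]
  exact (integrable_finsetSum _ fun j _ => (h2 j).const_mul _).div_const _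

lemma integrable_quad (h2 : ∀ j, Integrable (fun x : J → ℝ => x j ^ 2) m) (w : J → ℝ) :
    Integrable (fun x => quad f₁ f₂ w x) m :=
  ((integrable_sq_softAvg h2 w).const_mul _).add
    (((integrable_softAvg_sq h2 w).sub (integrable_sq_softAvg h2 w)).const_mul _)

lemma integral_quad (h2 : ∀ j, Integrable (fun x : J → ℝ => x j ^ 2) m) (w : J → ℝ) :
    ∫ x, quad f₁ f₂ w x ∂m = f₂ (smoothMax w) *
        ((∑ j, ∑ k, Real.exp (w j) * Real.exp (w k) * ∫ x : J → ℝ, x j * x k ∂m) /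
          partition w ^ 2) +
      f₁ (smoothMax w) * (softAvg w (fun j => ∫ x : J → ℝ, x j * x j ∂m) -
        (∑ j, ∑ k, Real.exp (w j) * Real.exp (w k) * ∫ x : J → ℝ, x j * x k ∂m) /
          partition w ^ 2) := by
  have hA : ∫ x, softAvg w x ^ 2 ∂m =
      (∑ j, ∑ k, Real.exp (w j) * Real.exp (w k) * ∫ x : J → ℝ, x j * x k ∂m) /
        partition w ^ 2 := by
    simp only [sq_softAvg]
    rw [integral_div, integral_finsetSum _ fun j _ => integrable_finsetSum _ fun k _ =>
      (integrable_coord_mul h2 j k).const_mul _]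
    congr 1
    refine Finset.sum_congr rfl fun j _ => ?_
    rw [integral_finsetSum _ fun k _ => (integrable_coord_mul h2 j k).const_mul _]
    exact Finset.sum_congr rfl fun k _ => integral_const_mul _ _
  have i1 : Integrable (fun x : J → ℝ => (softAvg w fun j => x j ^ 2) - softAvg w x ^ 2) m :=
    (integrable_softAvg_sq h2 w).sub (integrable_sq_softAvg h2 w)
  simp only [quad]
  rw [integral_add ((integrable_sq_softAvg h2 w).const_mul _) (i1.const_mul _),
    integral_const_mul, integral_const_mul,
    integral_sub (integrable_softAvg_sq h2 w) (integrable_sq_softAvg h2 w), hA,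
    integral_softAvg_left w h2]
  simp only [pow_two]

variable [Nonempty J]

lemma integrable_comp_smoothMax {Ω : Type*} [MeasurableSpace Ω] {μ : Measure Ω}
    [IsFiniteMeasure μ] {B : ℝ} (hf : Measurable f) (hB : ∀ x, |f x| ≤ B) {g : Ω → J → ℝ}
    (hg : Measurable g) : Integrable (fun ω => f (smoothMax (g ω))) μ :=
  Integrable.of_bound (hf.comp (measurable_smoothMax.comp hg)).aestronglyMeasurable B
    (Filter.Eventually.of_forall fun _ => hB _)

lemma integrable_lin_comp {Ω : Type*} [MeasurableSpace Ω] {μ : Measure Ω}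
    (hf : HasBoundedDerivs K f f₁ f₂ f₃) {g c : Ω → J → ℝ} (hg : Measurable g)
    (hcm : Measurable c) (hc : ∀ j, Integrable (fun ω => c ω j) μ) :
    Integrable (fun ω => lin f₁ (g ω) (c ω)) μ :=
  (integrable_softAvg hg hcm hc).bdd_mul
    (hf.measurable.2.1.comp (measurable_smoothMax.comp hg)).aestronglyMeasurable
    (Filter.Eventually.of_forall fun _ => hf.bound₁ _)

/-- Taylor expansion, in expectation, of `f ∘ smoothMax` after a centred step of scale `c`. -/
lemma integral_comp_step {B : ℝ} (hf : HasBoundedDerivs K f f₁ f₂ f₃) (hB : ∀ x, |f x| ≤ B)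
    (hmean : ∀ j, ∫ x : J → ℝ, x j ∂m = 0) (h2 : ∀ j, Integrable (fun x : J → ℝ => x j ^ 2) m)
    (w : J → ℝ) (c : ℝ) :
    ∫ x, f (smoothMax (w + c • x)) ∂m = f (smoothMax w) + c ^ 2 / 2 * ∫ x, quad f₁ f₂ w x ∂m +
      ∫ x, rem₀ f f₁ f₂ w (c • x) ∂m := by
  have h1 := integrable_coord_of_sq h2
  have i0 : Integrable (fun x => f (smoothMax (w + c • x))) m :=
    integrable_comp_smoothMax hf.measurable.1 hB (by fun_prop)
  have i1 : Integrable (fun x => c * lin f₁ w x) m := (integrable_lin h1 w).const_mul c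
  have i2 : Integrable (fun x => c ^ 2 / 2 * quad f₁ f₂ w x) m := (integrable_quad h2 w).const_mul _
  have e : ∀ x, rem₀ f f₁ f₂ w (c • x) = f (smoothMax (w + c • x)) - f (smoothMax w) -
      c * lin f₁ w x - c ^ 2 / 2 * quad f₁ f₂ w x := fun x => by
    rw [rem₀, lin_smul, quad_smul]
    ring
  have i3 : Integrable (fun x => f (smoothMax (w + c • x)) - f (smoothMax w)) m :=
    i0.sub (integrable_const _)
  have i4 : Integrable (fun x => f (smoothMax (w + c • x)) - f (smoothMax w) - c * lin f₁ w x) m :=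
    i3.sub i1
  simp only [e]
  rw [integral_sub i4 i2, integral_sub i3 i1, integral_sub i0 (integrable_const _),
    integral_const_mul, integral_const_mul, integral_lin h1 hmean]
  simp

/-- Taylor expansion, in expectation, of the derivative in the direction of a centred step. -/
lemma integral_lin_step (hf : HasBoundedDerivs K f f₁ f₂ f₃)
    (hmean : ∀ j, ∫ x : J → ℝ, x j ∂m = 0) (h2 : ∀ j, Integrable (fun x : J → ℝ => x j ^ 2) m)
    (w : J → ℝ) {c : ℝ} (hc : c ≠ 0) :
    ∫ x, lin f₁ (w + c • x) x ∂m = c * ∫ x, quad f₁ f₂ w x ∂m +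
      (∫ x, rem₁ f₁ f₂ w (c • x) ∂m) / c := by
  have h1 := integrable_coord_of_sq h2
  have i0 : Integrable (fun x => c * lin f₁ (w + c • x) x) m :=
    (integrable_lin_comp hf (by fun_prop) measurable_id h1).const_mul c
  have i1 : Integrable (fun x => c * lin f₁ w x) m := (integrable_lin h1 w).const_mul c
  have i2 : Integrable (fun x => c ^ 2 * quad f₁ f₂ w x) m := (integrable_quad h2 w).const_mul _
  have e : ∀ x, rem₁ f₁ f₂ w (c • x) = c * lin f₁ (w + c • x) x - c * lin f₁ w x -
      c ^ 2 * quad f₁ f₂ w x := fun x => by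
    rw [rem₁, lin_smul, quad_smul, lin_smul]
  have i4 : Integrable (fun x => c * lin f₁ (w + c • x) x - c * lin f₁ w x) m := i0.sub i1
  simp only [e]
  rw [integral_sub i4 i2, integral_sub i0 i1,
    integral_const_mul, integral_const_mul, integral_const_mul, integral_lin h1 hmean]
  field_simp
  ring

end Step

/-- The contribution of one summand, in state `y`, to the time derivative, with `w` the sum of the
other summands. -/
def pathTerm (f f₁ : ℝ → ℝ) (β : Bool) (s : ℝ) (w : J → ℝ) (y : State J) : ℝ :=
  3 * pathWeightDeriv β s y.1 * f (smoothMax (w + pathStep β s y)) +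
    3 * pathWeight β s y.1 * lin f₁ (w + pathStep β s y) (pathStepDeriv β s y)

section

variable {L : Bool → N → Measure (J → ℝ)} [∀ b i, IsProbabilityMeasure (L b i)]
  [Nonempty J] {K B : ℝ} {f f₁ f₂ f₃ : ℝ → ℝ}

lemma integrable_state_coord (hL : MomentMatched L) (i : N) (b : Bool) (j : J) :
    Integrable (fun y : State J => y.2 b j) (stateLaw L i) :=
  (measurePreserving_state L b i).integrable_comp_of_integrable
    (integrable_coord_of_sq (hL.sq b i) j)

lemma integrable_pathStepDeriv (hL : MomentMatched L) (β : Bool) (s : ℝ) (i : N) (j : J) :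
    Integrable (fun y : State J => pathStepDeriv β s y j) (stateLaw L i) := by
  refine Integrable.mono' (g := fun y => ∑ b, |pathScaleDeriv β s b| * |y.2 b j|)
    (integrable_finsetSum _ fun b _ => (integrable_state_coord hL i b j).abs.const_mul _)
    ((measurable_pi_apply j).comp (measurable_pathStepDeriv β s)).aestronglyMeasurable
    (Filter.Eventually.of_forall fun y => ?_)
  obtain ⟨k, v⟩ := y
  cases k with
  | none =>
    simp only [pathStepDeriv, Option.elim_none, Pi.zero_apply, norm_zero]
    positivity
  | some b =>
    simp only [pathStepDeriv, Option.elim_some, Pi.smul_apply, smul_eq_mul, norm_mul,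
      Real.norm_eq_abs]
    exact Finset.single_le_sum (f := fun b => |pathScaleDeriv β s b| * |v b j|)
      (fun b _ => by positivity) (Finset.mem_univ b)

lemma integrable_pathTerm (hf : HasBoundedDerivs K f f₁ f₂ f₃) (hB : ∀ x, |f x| ≤ B)
    (hL : MomentMatched L) (β : Bool) (s : ℝ) (w : J → ℝ) (i : N) :
    Integrable (pathTerm f f₁ β s w) (stateLaw L i) := by
  have h2 : Measurable fun y : State J => w + pathStep β s y :=
    (measurable_pathStep β s).const_add w
  have hk : ∀ h : Mark → ℝ, ∀ y : State J, ‖3 * h y.1‖ ≤ 3 * ∑ k, |h k| := fun h y => by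
    rw [norm_mul, Real.norm_of_nonneg (by norm_num)]
    gcongr
    exact Finset.single_le_sum (f := fun k => |h k|) (fun k _ => abs_nonneg _)
      (Finset.mem_univ y.1)
  refine ((integrable_comp_smoothMax hf.measurable.1 hB h2).bdd_mul
    ((measurable_mark (pathWeightDeriv β s)).const_mul 3).aestronglyMeasurable
    (Filter.Eventually.of_forall (hk _))).add
    ((integrable_lin_comp hf h2 (measurable_pathStepDeriv β s)
      (integrable_pathStepDeriv hL β s i)).bdd_mul
    ((measurable_mark (pathWeight β s)).const_mul 3).aestronglyMeasurable
    (Filter.Eventually.of_forall (hk _)))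

lemma integral_family {h : (J → ℝ) → ℝ} (hm : Measurable h) (b : Bool) (i : N) :
    ∫ v : Bool → J → ℝ, h (v b) ∂(Measure.pi fun b => L b i) = ∫ x, h x ∂(L b i) := by
  have hp := measurePreserving_eval (fun b => L b i) b
  rw [← hp.map_eq, integral_map hp.measurable.aemeasurable hm.aestronglyMeasurable]

/-- Averaged over the state of the summand, the terms of order zero, one and two cancel: the
derivative along the path consists of Taylor remainders. -/
lemma integral_pathTerm (hf : HasBoundedDerivs K f f₁ f₂ f₃) (hB : ∀ x, |f x| ≤ B)
    (hL : MomentMatched L) (β : Bool) {s : ℝ} (hs : 0 < s) (w : J → ℝ) (i : N) :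
    ∫ y, pathTerm f f₁ β s w y ∂(stateLaw L i) =
      ∑ b, (famWeightDeriv β s b * ∫ x, rem₀ f f₁ f₂ w (pathScale β s b • x) ∂(L b i) +
        famWeight β s b * (pathScaleDeriv β s b / pathScale β s b) *
          ∫ x, rem₁ f₁ f₂ w (pathScale β s b • x) ∂(L b i)) := by
  rw [integral_stateLaw L i (integrable_pathTerm hf hB hL β s w i), Fintype.sum_option]
  have hcov : ∀ b, ∫ x, quad f₁ f₂ w x ∂(L b i) = ∫ x, quad f₁ f₂ w x ∂(L false i) := by
    intro b
    cases b
    · rfl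
    · rw [integral_quad (hL.sq _ _), integral_quad (hL.sq _ _)]
      simp only [hL.cov]
  set q := ∫ x, quad f₁ f₂ w x ∂(L false i) with hq
  have h0 : ∫ v : Bool → J → ℝ, pathTerm f f₁ β s w (none, v) ∂(Measure.pi fun b => L b i) =
      3 * (pathWeightDeriv β s none * f (smoothMax w)) := by
    simp only [pathTerm, pathStep, pathStepDeriv, Option.elim_none, add_zero]
    have : lin f₁ w (0 : J → ℝ) = 0 := by
      simpa using lin_smul f₁ w (0 : J → ℝ) 0
    rw [this]
    simp [mul_assoc]
  have h1 : ∀ b, ∫ v : Bool → J → ℝ, pathTerm f f₁ β s w (some b, v)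
      ∂(Measure.pi fun b => L b i) =
      3 * (pathWeightDeriv β s (some b) * f (smoothMax w) +
        (famWeightDeriv β s b * pathScale β s b ^ 2 / 2 +
          famWeight β s b * pathScaleDeriv β s b * pathScale β s b) * q +
        (famWeightDeriv β s b * ∫ x, rem₀ f f₁ f₂ w (pathScale β s b • x) ∂(L b i) +
        famWeight β s b * (pathScaleDeriv β s b / pathScale β s b) *
          ∫ x, rem₁ f₁ f₂ w (pathScale β s b • x) ∂(L b i))) := by
    intro b
    have hc := pathScale_pos hs β b
    have hgm : Measurable fun x : J → ℝ => w + pathScale β s b • x := by fun_prop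
    have e : ∀ v : Bool → J → ℝ, pathTerm f f₁ β s w (some b, v) =
        (fun x => 3 * famWeightDeriv β s b * f (smoothMax (w + pathScale β s b • x)) +
          3 * famWeight β s b * pathScaleDeriv β s b *
            lin f₁ (w + pathScale β s b • x) x) (v b) := by
      intro v
      simp only [pathTerm, pathStep, pathStepDeriv, Option.elim_some, lin_smul, pathWeight,
        pathWeightDeriv]
      ring
    have i1 := integrable_comp_smoothMax (μ := L b i) hf.measurable.1 hB hgm
    have i2 : Integrable (fun x => lin f₁ (w + pathScale β s b • x) x) (L b i) :=
      integrable_lin_comp hf hgm measurable_id (integrable_coord_of_sq (hL.sq b i))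
    have hlm : Measurable fun x : J → ℝ => lin f₁ (w + pathScale β s b • x) x :=
      (hf.measurable.2.1.comp (measurable_smoothMax.comp hgm)).mul
        (measurable_softAvg hgm measurable_id)
    simp only [e]
    rw [integral_family (h := fun x => 3 * famWeightDeriv β s b *
        f (smoothMax (w + pathScale β s b • x)) + 3 * famWeight β s b * pathScaleDeriv β s b *
            lin f₁ (w + pathScale β s b • x) x)
      (((hf.measurable.1.comp (measurable_smoothMax.comp hgm)).const_mul _).add
        (hlm.const_mul _)), integral_add (i1.const_mul _) (i2.const_mul _), integral_const_mul,
      integral_const_mul]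
    have e2 := integral_lin_step hf (hL.mean b i) (hL.sq b i) w hc.ne'
    rw [integral_comp_step hf hB (hL.mean b i) (hL.sq b i), e2, hcov b]
    simp only [pathWeightDeriv]
    field_simp
    ring
  have h3 := sum_pathWeightDeriv β s
  have h4 := sum_variance_deriv β s
  rw [Fintype.sum_option] at h3
  simp only [h0, h1]
  simp only [← Finset.mul_sum, ← mul_add]
  rw [mul_div_cancel_left₀ _ (by norm_num : (3 : ℝ) ≠ 0)]
  simp only [Finset.sum_add_distrib (f := fun b => pathWeightDeriv β s (some b) *
    f (smoothMax w) + _)]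
  rw [Finset.sum_add_distrib, ← Finset.sum_mul, ← Finset.sum_mul, h4, ← add_assoc, ← add_assoc,
    ← add_mul, h3]
  ring

end

end PathDerivative

section LeaveOneOut

variable {J : Type*} [Fintype J] {N : Type*} [Fintype N] [DecidableEq N]

/-- The expectation of `f ∘ smoothMax` of the interpolated sum at time `s`. -/
def pathFun (f : ℝ → ℝ) (L : Bool → N → Measure (J → ℝ)) (β : Bool) (s : ℝ) : ℝ :=
  ∫ z, markDensity β s z * f (smoothMax (pathSum β s z)) ∂(refLaw L)

lemma hasDerivAt_smoothMax_curve [Nonempty J] {W : ℝ → J → ℝ} {W' : J → ℝ} {s : ℝ}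
    (hW : ∀ j, HasDerivAt (fun s => W s j) (W' j) s) :
    HasDerivAt (fun s => smoothMax (W s)) (softAvg (W s) W') s := by
  have h : HasDerivAt (fun s => partition (W s)) (∑ j, Real.exp (W s j) * W' j) s :=
    HasDerivAt.fun_sum fun j _ => (hW j).exp
  exact h.log (partition_pos _).ne'

lemma exists_bound_closedBall {ι : Type*} [Fintype ι] {h : ι → ℝ → ℝ}
    (hc : ∀ k, Continuous (h k)) (s₀ : ℝ) :
    ∃ B : ℝ, 1 ≤ B ∧ ∀ k, ∀ s ∈ Metric.closedBall s₀ 1, |h k s| ≤ B := by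
  choose B hB using fun k => (isCompact_closedBall s₀ 1).exists_bound_of_continuousOn
    (hc k).continuousOn
  have h0 : 0 ≤ ∑ k, |B k| := Finset.sum_nonneg fun k _ => abs_nonneg (B k)
  refine ⟨1 + ∑ k, |B k|, by linarith, fun k s hs => ?_⟩
  have h1 := Finset.single_le_sum (f := fun k => |B k|) (fun k _ => abs_nonneg _)
    (Finset.mem_univ k)
  have h2 := hB k s hs
  rw [Real.norm_eq_abs] at h2
  linarith [le_abs_self (B k)]

section

variable {L : Bool → N → Measure (J → ℝ)} [∀ b i, IsProbabilityMeasure (L b i)]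
  [Nonempty J] {K B : ℝ} {f f₁ f₂ f₃ : ℝ → ℝ}

lemma abs_prod_pathWeight_le (β : Bool) (s : ℝ) (t : Finset N) (z : N → State J) {b : ℝ}
    (hb : 1 ≤ b) (h : ∀ k, |pathWeight β s k| ≤ b) :
    |∏ k ∈ t, 3 * pathWeight β s (z k).1| ≤ (3 * b) ^ Fintype.card N := by
  rw [Finset.abs_prod]
  calc ∏ k ∈ t, |3 * pathWeight β s (z k).1| ≤ ∏ _k ∈ t, 3 * b := by
        refine Finset.prod_le_prod (fun _ _ => abs_nonneg _) fun k _ => ?_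
        rw [abs_mul, abs_of_pos (by norm_num : (0 : ℝ) < 3)]
        gcongr
        exact h _
    _ = (3 * b) ^ t.card := by simp
    _ ≤ _ := pow_le_pow_right₀ (by linarith) (Finset.card_le_univ _)

lemma hasDerivAt_markDensity_mul (hf : HasBoundedDerivs K f f₁ f₂ f₃) (β : Bool)
    (z : N → State J) (s : ℝ) :
    HasDerivAt (fun s => markDensity β s z * f (smoothMax (pathSum β s z)))
      (∑ i, markDensityErase β s i z * pathTerm f f₁ β s (pathSumErase β s i z) (z i)) s := by
  have h1 : HasDerivAt (fun s => markDensity β s z)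
      (∑ i, markDensityErase β s i z * (3 * pathWeightDeriv β s (z i).1)) s := by
    have := HasDerivAt.fun_finsetProd (u := Finset.univ) (x := s)
      (f := fun i s => 3 * pathWeight β s (z i).1)
      (f' := fun i => 3 * pathWeightDeriv β s (z i).1) fun i _ =>
        (hasDerivAt_pathWeight β s (z i).1).const_mul 3
    simpa only [smul_eq_mul, markDensity, markDensityErase] using this
  have h2 : HasDerivAt (fun s => f (smoothMax (pathSum β s z)))
      (lin f₁ (pathSum β s z) (∑ i, pathStepDeriv β s (z i))) s := by
    refine (hf.deriv₁ _).comp s (hasDerivAt_smoothMax_curve fun j => ?_)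
    simp only [pathSum, Finset.sum_apply]
    exact HasDerivAt.fun_sum fun i _ => hasDerivAt_pathStep β s (z i) j
  refine (h1.mul h2).congr_deriv ?_
  have h3 : lin f₁ (pathSum β s z) (∑ i, pathStepDeriv β s (z i)) =
      ∑ i, lin f₁ (pathSum β s z) (pathStepDeriv β s (z i)) := by
    have : (∑ i, pathStepDeriv β s (z i)) = fun j => ∑ i, pathStepDeriv β s (z i) j := by
      ext j
      simp
    simp only [lin, this, softAvg_sum, Finset.mul_sum]
  rw [h3, Finset.sum_mul, Finset.mul_sum, ← Finset.sum_add_distrib]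
  refine Finset.sum_congr rfl fun i _ => ?_
  have h4 : markDensity β s z = 3 * pathWeight β s (z i).1 * markDensityErase β s i z :=
    (Finset.mul_prod_erase _ (fun i => 3 * pathWeight β s (z i).1) (Finset.mem_univ i)).symm
  rw [pathTerm, pathSumErase_add, h4]
  ring

lemma measurable_pathTerm_comp (hf : HasBoundedDerivs K f f₁ f₂ f₃) (β : Bool) (s : ℝ) (i : N) :
    Measurable fun z : N → State J => pathTerm f f₁ β s (pathSumErase β s i z) (z i) := by
  have h1 := hf.measurable
  have h2 := measurable_pathSum (J := J) (N := N) β s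
  have hi : Measurable fun z : N → State J => z i := measurable_pi_apply i
  simp only [pathTerm, pathSumErase_add]
  exact ((((measurable_mark (pathWeightDeriv β s)).comp hi).const_mul 3).mul
    (h1.1.comp (measurable_smoothMax.comp h2))).add
    ((((measurable_mark (pathWeight β s)).comp hi).const_mul 3).mul
      ((h1.2.1.comp (measurable_smoothMax.comp h2)).mul
        (measurable_softAvg h2 ((measurable_pathStepDeriv β s).comp hi))))

lemma integrable_ref_coord (hL : MomentMatched L) (i : N) (b : Bool) (j : J) :
    Integrable (fun z : N → State J => (z i).2 b j) (refLaw L) :=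
  (measurePreserving_ref_apply L b i).integrable_comp_of_integrable
    (integrable_coord_of_sq (hL.sq b i) j)

/-- The derivative of the path functional and the integrability of its terms. -/
lemma hasDerivAt_pathFun (hf : HasBoundedDerivs K f f₁ f₂ f₃) (hB : ∀ x, |f x| ≤ B)
    (hL : MomentMatched L) (β : Bool) (s₀ : ℝ) :
    (∀ i, Integrable (fun z => markDensityErase β s₀ i z *
        pathTerm f f₁ β s₀ (pathSumErase β s₀ i z) (z i)) (refLaw L)) ∧
      HasDerivAt (pathFun f L β) (∑ i, ∫ z, markDensityErase β s₀ i z *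
        pathTerm f f₁ β s₀ (pathSumErase β s₀ i z) (z i) ∂(refLaw L)) s₀ := by
  have hK := hf.nonneg
  have hB0 : 0 ≤ B := (abs_nonneg _).trans (hB 0)
  obtain ⟨b₁, hb₁, h₁⟩ := exists_bound_closedBall (continuous_pathWeight β) s₀
  obtain ⟨b₂, hb₂, h₂⟩ := exists_bound_closedBall (continuous_pathWeightDeriv β) s₀
  obtain ⟨b₃, hb₃, h₃⟩ := exists_bound_closedBall (continuous_pathScaleDeriv β) s₀
  set bd : N → (N → State J) → ℝ := fun i z => (3 * b₁) ^ Fintype.card N *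
    (3 * b₂ * B + 3 * b₁ * (K * (b₃ * ∑ b, ∑ j, |(z i).2 b j|))) with hbd
  have hbi : ∀ i, Integrable (bd i) (refLaw L) := fun i =>
    ((integrable_const _).add (((integrable_finsetSum _ fun b _ => integrable_finsetSum _ fun j _ =>
      (integrable_ref_coord hL i b j).abs).const_mul _).const_mul _ |>.const_mul _)).const_mul _
  have hterm : ∀ i, ∀ s ∈ Metric.closedBall s₀ 1, ∀ z : N → State J, |markDensityErase β s i z *
      pathTerm f f₁ β s (pathSumErase β s i z) (z i)| ≤ bd i z := by
    intro i s hs z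
    have hd : ∀ j, |pathStepDeriv β s (z i) j| ≤ b₃ * ∑ b, |(z i).2 b j| := by
      intro j
      rcases hz : z i with ⟨k, v⟩
      cases k with
      | none =>
        simp only [pathStepDeriv, Option.elim_none, Pi.zero_apply, abs_zero]
        positivity
      | some b =>
        simp only [pathStepDeriv, Option.elim_some, Pi.smul_apply, smul_eq_mul, abs_mul]
        exact mul_le_mul (h₃ b s hs) (Finset.single_le_sum (f := fun b => |v b j|)
          (fun b _ => abs_nonneg _) (Finset.mem_univ b)) (abs_nonneg _) (by linarith)
    have hl : |lin f₁ (pathSumErase β s i z + pathStep β s (z i)) (pathStepDeriv β s (z i))| ≤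
        K * (b₃ * ∑ b, ∑ j, |(z i).2 b j|) := by
      refine (abs_lin_le hf _ _).trans ?_
      gcongr
      refine (softAvg_le_sum fun j => abs_nonneg _).trans ?_
      rw [Finset.sum_comm, Finset.mul_sum]
      exact Finset.sum_le_sum fun j _ => hd j
    rw [abs_mul, hbd]
    refine mul_le_mul (abs_prod_pathWeight_le β s _ z hb₁ fun k => h₁ k s hs) ?_ (abs_nonneg _)
      (by positivity)
    rw [pathTerm]
    refine (abs_add_le _ _).trans (add_le_add ?_ ?_)
    · rw [abs_mul, abs_mul, abs_of_pos (by norm_num : (0 : ℝ) < 3)]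
      have := h₂ (z i).1 s hs
      gcongr
      exact hB _
    · rw [abs_mul, abs_mul, abs_of_pos (by norm_num : (0 : ℝ) < 3)]
      have := h₁ (z i).1 s hs
      gcongr
  have hmeas : ∀ i : N, Measurable fun z : N → State J => markDensityErase β s₀ i z *
        pathTerm f f₁ β s₀ (pathSumErase β s₀ i z) (z i) := fun i =>
    (measurable_markDensityErase β s₀ i).mul (measurable_pathTerm_comp hf β s₀ i)
  have hint : ∀ i, Integrable (fun z => markDensityErase β s₀ i z *
        pathTerm f f₁ β s₀ (pathSumErase β s₀ i z) (z i)) (refLaw L) := fun i =>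
    Integrable.mono' (hbi i) (hmeas i).aestronglyMeasurable
      (Filter.Eventually.of_forall fun z => hterm i s₀ (by simp) z)
  have hFm : ∀ s, Measurable fun z : N → State J =>
      markDensity β s z * f (smoothMax (pathSum β s z)) := fun s =>
    (measurable_markDensity β s).mul
      (hf.measurable.1.comp (measurable_smoothMax.comp (measurable_pathSum β s)))
  refine ⟨hint, ?_⟩
  rw [← integral_finsetSum _ fun i _ => hint i]
  refine (hasDerivAt_integral_of_dominated_loc_of_deriv_le (bound := fun z => ∑ i, bd i z)
    (F' := fun s z => ∑ i, markDensityErase β s i z *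
      pathTerm f f₁ β s (pathSumErase β s i z) (z i))
    (Metric.closedBall_mem_nhds s₀ one_pos)
    (Filter.Eventually.of_forall fun s => (hFm s).aestronglyMeasurable) ?_
    (Finset.measurable_fun_sum _ fun i _ => hmeas i).aestronglyMeasurable
    (Filter.Eventually.of_forall fun z s hs => ?_) (integrable_finsetSum _ fun i _ => hbi i)
    (Filter.Eventually.of_forall fun z s _ => hasDerivAt_markDensity_mul hf β z s)).2
  · refine Integrable.of_bound (hFm s₀).aestronglyMeasurable
      ((3 * b₁) ^ Fintype.card N * B) (Filter.Eventually.of_forall fun z => ?_)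
    rw [norm_mul]
    exact mul_le_mul (abs_prod_pathWeight_le β s₀ _ z hb₁ fun k => h₁ k s₀ (by simp)) (hB _)
      (norm_nonneg _) (by positivity)
  · exact (Finset.abs_sum_le_sum_abs _ _).trans (Finset.sum_le_sum fun i _ => hterm i s hs z)

/-- The derivative with the state of the differentiated summand averaged out. -/
lemma integral_erase_pathTerm (hf : HasBoundedDerivs K f f₁ f₂ f₃) (hB : ∀ x, |f x| ≤ B)
    (hL : MomentMatched L) (β : Bool) (s : ℝ) (i : N) :
    ∫ z, markDensityErase β s i z * pathTerm f f₁ β s (pathSumErase β s i z) (z i) ∂(refLaw L) =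
      ∫ z, markDensityErase β s i z *
        ∫ y, pathTerm f f₁ β s (pathSumErase β s i z) y ∂(stateLaw L i) ∂(refLaw L) := by
  rw [refLaw, integral_pi_eq_integral_update (stateLaw L) i
    ((hasDerivAt_pathFun hf hB hL β s).1 i)]
  simp only [markDensityErase_update, pathSumErase_update, Function.update_self,
    integral_const_mul]

/-! ### Leave-one-out bounds -/

section weights

variable {s : ℝ}

lemma markDensity_nonneg (hs0 : 0 < s) (hs1 : s < 1) (β : Bool) (z : N → State J) :
    0 ≤ markDensity β s z :=
  Finset.prod_nonneg fun i _ => by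
    have := pathWeight_pos hs0 hs1 β (z i).1
    positivity

lemma markDensityErase_nonneg (hs0 : 0 < s) (hs1 : s < 1) (β : Bool) (i : N) (z : N → State J) :
    0 ≤ markDensityErase β s i z :=
  Finset.prod_nonneg fun i _ => by
    have := pathWeight_pos hs0 hs1 β (z i).1
    positivity

lemma abs_prod_pathWeight_le_three (hs0 : 0 < s) (hs1 : s < 1) (β : Bool) (t : Finset N)
    (z : N → State J) : |∏ k ∈ t, 3 * pathWeight β s (z k).1| ≤ 3 ^ Fintype.card N := by
  have h := abs_prod_pathWeight_le β s t z le_rfl fun k => by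
    rw [abs_of_pos (pathWeight_pos hs0 hs1 β k)]
    exact pathWeight_le_one hs0 hs1 β k
  simpa using h

/-- Giving a prescribed mark `k` to the summand `i` costs at most the inverse of the probability of
that mark. -/
lemma weight_mul_integral_erase_le (hs0 : 0 < s) (hs1 : s < 1) (β : Bool) (i : N) (k : Mark)
    {h : (Bool → J → ℝ) → J → ℝ} (hm : Measurable h) (hnn : ∀ v j, 0 ≤ h v j)
    (hi : ∀ j, Integrable (fun v => h v j) (Measure.pi fun b => L b i)) :
    pathWeight β s k * ∫ z, markDensityErase β s i z *
        ∫ v, softAvg (pathSumErase β s i z + pathStep β s (k, v)) (h v)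
          ∂(Measure.pi fun b => L b i) ∂(refLaw L) ≤
      ∫ z, markDensity β s z * softAvg (pathSum β s z) (h (z i).2) ∂(refLaw L) := by
  have hsi : ∀ j, Integrable (fun y : State J => h y.2 j) (stateLaw L i) := fun j =>
    (measurePreserving_snd (μ := markLaw)
      (ν := Measure.pi fun b => L b i)).integrable_comp_of_integrable (hi j)
  have hri : ∀ j, Integrable (fun z : N → State J => h (z i).2 j) (refLaw L) := fun j =>
    (measurePreserving_eval (stateLaw L) i).integrable_comp_of_integrable (hsi j)
  have hA : Integrable (fun z => markDensity β s z * softAvg (pathSum β s z) (h (z i).2))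
      (refLaw L) :=
    (integrable_softAvg (measurable_pathSum β s)
      (hm.comp (measurable_snd.comp (measurable_pi_apply i))) hri).bdd_mul
      (measurable_markDensity β s).aestronglyMeasurable
      (Filter.Eventually.of_forall fun z => abs_prod_pathWeight_le_three hs0 hs1 β _ z)
  rw [refLaw, integral_pi_eq_integral_update (stateLaw L) i hA, ← integral_const_mul]
  have hin : ∀ z : N → State J, pathWeight β s k * (markDensityErase β s i z *
      ∫ v, softAvg (pathSumErase β s i z + pathStep β s (k, v)) (h v)
        ∂(Measure.pi fun b => L b i)) ≤
      ∫ y, markDensity β s (Function.update z i y) * softAvg (pathSum β s (Function.update z i y))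
        (h (Function.update z i y i).2) ∂(stateLaw L i) := by
    intro z
    simp only [markDensity_update, pathSum_update, Function.update_self]
    have hI : Integrable (fun y : State J => 3 * pathWeight β s y.1 * markDensityErase β s i z *
        softAvg (pathSumErase β s i z + pathStep β s y) (h y.2)) (stateLaw L i) := by
      refine (integrable_softAvg ((measurable_pathStep β s).const_add _)
        (hm.comp measurable_snd) hsi).bdd_mul (c := 3 * |markDensityErase β s i z|)
        (((measurable_mark (pathWeight β s)).const_mul 3).mul_const _).aestronglyMeasurable
        (Filter.Eventually.of_forall fun y => ?_)
      have h1 := pathWeight_pos hs0 hs1 β y.1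
      have h2 := pathWeight_le_one hs0 hs1 β y.1
      rw [norm_mul, Real.norm_of_nonneg (by positivity), Real.norm_eq_abs]
      gcongr
      linarith
    rw [integral_stateLaw L i hI, le_div_iff₀ (by norm_num)]
    refine le_trans (le_of_eq ?_) (Finset.single_le_sum (fun k' _ => ?_) (Finset.mem_univ k))
    · change _ = ∫ v, 3 * pathWeight β s k * markDensityErase β s i z *
        softAvg (pathSumErase β s i z + pathStep β s (k, v)) (h v) ∂(Measure.pi fun b => L b i)
      rw [integral_const_mul]
      ring
    · refine integral_nonneg fun v => mul_nonneg ?_ (softAvg_nonneg (hnn v))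
      have h1 := pathWeight_pos hs0 hs1 β k'
      have h2 := markDensityErase_nonneg hs0 hs1 β i z
      positivity
  refine integral_mono_of_nonneg (Filter.Eventually.of_forall fun z => ?_)
    ?_ (Filter.Eventually.of_forall hin)
  · exact mul_nonneg (pathWeight_pos hs0 hs1 β k).le (mul_nonneg
      (markDensityErase_nonneg hs0 hs1 β i z)
      (integral_nonneg fun v => softAvg_nonneg (hnn v)))
  · have hp := (measurePreserving_update (stateLaw L) i).integrable_comp_of_integrable hA
    exact hp.integral_prod_left

lemma integral_markDensityErase (β : Bool) (s : ℝ) (i : N) :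
    ∫ z, markDensityErase β s i z ∂(refLaw L) = 1 := by
  have h : ∀ z : N → State J, markDensityErase β s i z =
      ∏ k, (if k = i then 1 else 3 * pathWeight β s (z k).1) := by
    intro z
    rw [← Finset.mul_prod_erase _ _ (Finset.mem_univ i), if_pos rfl, one_mul, markDensityErase]
    exact Finset.prod_congr rfl fun k hk => by rw [if_neg (Finset.ne_of_mem_erase hk)]
  simp only [h, refLaw]
  rw [integral_fintype_prod_eq_prod
    (fun k (y : State J) => if k = i then 1 else 3 * pathWeight β s y.1)]
  refine Finset.prod_eq_one fun k _ => ?_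
  split_ifs
  · simp
  · have hi : Integrable (fun y : State J => 3 * pathWeight β s y.1) (stateLaw L k) :=
      (Integrable.of_finite (f := fun k => 3 * pathWeight β s k)).comp_measurable
        (μ := stateLaw L k) measurable_fst
    rw [integral_stateLaw L k hi]
    simp only [integral_const, probReal_univ, one_smul, ← Finset.mul_sum, sum_pathWeight]
    norm_num

end weights

end

end LeaveOneOut

section Comparison

variable {J : Type*} [Fintype J] {N : Type*} [Fintype N] [DecidableEq N]

/-! ### Comparison of the two families -/

/-- `E max_j ∑_i |x_ij|³` as a real number. -/
def realSumCube (m : N → Measure (J → ℝ)) : ℝ :=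
  ∫ x : N → J → ℝ, ⨆ j, ∑ i, |x i j| ^ 3 ∂(Measure.pi m)

lemma measurable_rem₀ [Nonempty J] {K : ℝ} {f f₁ f₂ f₃ : ℝ → ℝ}
    (hf : HasBoundedDerivs K f f₁ f₂ f₃) (w : J → ℝ) : Measurable (rem₀ f f₁ f₂ w) := by
  have h := hf.measurable
  have h1 : Measurable fun x : J → ℝ => softAvg w x :=
    measurable_softAvg measurable_const measurable_id
  have h2 : Measurable fun x : J → ℝ => softAvg w fun j => x j ^ 2 :=
    measurable_softAvg measurable_const (by fun_prop)
  have h3 := h.1.comp (measurable_smoothMax.comp (measurable_const_add w))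
  exact ((h3.sub_const _).sub (h1.const_mul _)).sub
    ((((h1.pow_const 2).const_mul _).add ((h2.sub (h1.pow_const 2)).const_mul _)).div_const _)

lemma measurable_rem₁ [Nonempty J] {K : ℝ} {f f₁ f₂ f₃ : ℝ → ℝ}
    (hf : HasBoundedDerivs K f f₁ f₂ f₃) (w : J → ℝ) : Measurable (rem₁ f₁ f₂ w) := by
  have h := hf.measurable
  have h1 : Measurable fun x : J → ℝ => softAvg w x :=
    measurable_softAvg measurable_const measurable_id
  have h2 : Measurable fun x : J → ℝ => softAvg w fun j => x j ^ 2 :=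
    measurable_softAvg measurable_const (by fun_prop)
  have h3 := h.2.1.comp (measurable_smoothMax.comp (measurable_const_add w))
  exact ((h3.mul (measurable_softAvg (measurable_const_add w) measurable_id)).sub
    (h1.const_mul _)).sub
    (((h1.pow_const 2).const_mul _).add ((h2.sub (h1.pow_const 2)).const_mul _))

section scaled

variable (m : Measure (J → ℝ)) [IsProbabilityMeasure m] (c : ℝ)

/-- The law of `c` times a vector of law `m`. -/
def scaledLaw (m : Measure (J → ℝ)) (c : ℝ) : Measure (J → ℝ) := m.map fun x => c • x

lemma measurable_smul_vec : Measurable fun x : J → ℝ => c • x := measurable_id.const_smul c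

instance : IsProbabilityMeasure (scaledLaw m c) :=
  Measure.isProbabilityMeasure_map (measurable_smul_vec c).aemeasurable

lemma integral_scaledLaw {h : (J → ℝ) → ℝ} (hm : Measurable h) :
    ∫ x, h x ∂(scaledLaw m c) = ∫ x, h (c • x) ∂m :=
  integral_map (measurable_smul_vec c).aemeasurable hm.aestronglyMeasurable

lemma integrable_scaledLaw {h : (J → ℝ) → ℝ} (hm : Measurable h)
    (hi : Integrable (fun x => h (c • x)) m) : Integrable h (scaledLaw m c) :=
  (integrable_map_measure hm.aestronglyMeasurable (measurable_smul_vec c).aemeasurable).2 hi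

variable {m c}

lemma integrable_cube_scaledLaw (h3 : ∀ j, Integrable (fun x : J → ℝ => |x j| ^ 3) m) (j : J) :
    Integrable (fun x : J → ℝ => |x j| ^ 3) (scaledLaw m c) := by
  refine integrable_scaledLaw m c (by fun_prop) ?_
  simp only [Pi.smul_apply, smul_eq_mul, abs_mul, mul_pow]
  exact (h3 j).const_mul _

lemma mean_scaledLaw (hmean : ∀ j, ∫ x : J → ℝ, x j ∂m = 0) (j : J) :
    ∫ x : J → ℝ, x j ∂(scaledLaw m c) = 0 := by
  rw [integral_scaledLaw m c (h := fun x => x j) (by fun_prop)]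
  simp only [Pi.smul_apply, smul_eq_mul, integral_const_mul, hmean, mul_zero]

lemma cubeMoment_scaledLaw (hc : 0 ≤ c) (j : J) :
    cubeMoment (scaledLaw m c) j = c ^ 3 * cubeMoment m j := by
  rw [cubeMoment, integral_scaledLaw m c (h := fun x => |x j| ^ 3) (by fun_prop), cubeMoment,
    ← integral_const_mul]
  simp only [Pi.smul_apply, smul_eq_mul, abs_mul, mul_pow, abs_of_nonneg hc]

end scaled

lemma measurable_stepMoment (m : Measure (J → ℝ)) [IsProbabilityMeasure m] :
    Measurable (stepMoment m) := by
  have h : Measurable fun p : (J → ℝ) × (J → ℝ) =>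
      softAvg (p.1 + p.2) (fun j => |p.2 j| ^ 3 + cubeMoment m j) :=
    measurable_softAvg (by fun_prop) (by fun_prop)
  exact (h.stronglyMeasurable.integral_prod_right (ν := m)).measurable

lemma stepMoment_nonneg (m : Measure (J → ℝ)) (w : J → ℝ) : 0 ≤ stepMoment m w :=
  integral_nonneg fun x => softAvg_nonneg fun j => by
    have := cubeMoment_nonneg m j
    positivity

lemma stepMoment_le [Nonempty J] {m : Measure (J → ℝ)} [IsProbabilityMeasure m]
    (h3 : ∀ j, Integrable (fun x : J → ℝ => |x j| ^ 3) m) (w : J → ℝ) :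
    stepMoment m w ≤ ∫ x : J → ℝ, ∑ j, (|x j| ^ 3 + cubeMoment m j) ∂m :=
  integral_mono (integrable_softAvg (by fun_prop) (by fun_prop) fun j => (h3 j).add
    (integrable_const _)) (integrable_finsetSum _ fun j _ => (h3 j).add (integrable_const _))
    fun x => softAvg_le_sum fun j => by
      have := cubeMoment_nonneg m j
      positivity

section

variable {L : Bool → N → Measure (J → ℝ)} [∀ b i, IsProbabilityMeasure (L b i)]
  [Nonempty J] {K B : ℝ} {f f₁ f₂ f₃ : ℝ → ℝ}

lemma iSup_sum_cube_le (x : N → J → ℝ) : ⨆ j, ∑ i, |x i j| ^ 3 ≤ ∑ j, ∑ i, |x i j| ^ 3 :=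
  ciSup_le fun j => Finset.single_le_sum (f := fun j => ∑ i, |x i j| ^ 3)
    (fun j _ => Finset.sum_nonneg fun i _ => by positivity) (Finset.mem_univ j)

lemma sum_cube_le_iSup (x : N → J → ℝ) (j : J) : ∑ i, |x i j| ^ 3 ≤ ⨆ j, ∑ i, |x i j| ^ 3 :=
  le_ciSup (f := fun j => ∑ i, |x i j| ^ 3) (Set.finite_range _).bddAbove j

lemma measurable_iSup_sum_cube :
    Measurable fun x : N → J → ℝ => ⨆ j, ∑ i, |x i j| ^ 3 :=
  Measurable.iSup fun j => by fun_prop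

lemma iSup_sum_cube_nonneg (x : N → J → ℝ) : 0 ≤ ⨆ j, ∑ i, |x i j| ^ 3 :=
  Real.iSup_nonneg fun j => Finset.sum_nonneg fun i _ => by positivity

lemma integrable_pi_cube {m : N → Measure (J → ℝ)} [∀ i, IsProbabilityMeasure (m i)]
    (h3 : ∀ i j, Integrable (fun x : J → ℝ => |x j| ^ 3) (m i)) (i : N) (j : J) :
    Integrable (fun x : N → J → ℝ => |x i j| ^ 3) (Measure.pi m) :=
  (measurePreserving_eval m i).integrable_comp_of_integrable (h3 i j)

lemma integrable_iSup_sum_cube {m : N → Measure (J → ℝ)} [∀ i, IsProbabilityMeasure (m i)]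
    (h3 : ∀ i j, Integrable (fun x : J → ℝ => |x j| ^ 3) (m i)) :
    Integrable (fun x : N → J → ℝ => ⨆ j, ∑ i, |x i j| ^ 3) (Measure.pi m) := by
  refine Integrable.mono' (integrable_finsetSum Finset.univ fun j _ =>
    integrable_finsetSum Finset.univ fun i _ => integrable_pi_cube h3 i j)
    measurable_iSup_sum_cube.aestronglyMeasurable (Filter.Eventually.of_forall fun x => ?_)
  rw [Real.norm_of_nonneg (iSup_sum_cube_nonneg x)]
  exact iSup_sum_cube_le x

lemma realSumCube_nonneg (m : N → Measure (J → ℝ)) : 0 ≤ realSumCube m :=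
  integral_nonneg iSup_sum_cube_nonneg

lemma sum_cubeMoment_le {m : N → Measure (J → ℝ)} [∀ i, IsProbabilityMeasure (m i)]
    (h3 : ∀ i j, Integrable (fun x : J → ℝ => |x j| ^ 3) (m i)) (j : J) :
    ∑ i, cubeMoment (m i) j ≤ realSumCube m := by
  have h : ∀ i, cubeMoment (m i) j = ∫ x : N → J → ℝ, |x i j| ^ 3 ∂(Measure.pi m) := by
    intro i
    have hp := measurePreserving_eval m i
    rw [cubeMoment, ← hp.map_eq, integral_map hp.measurable.aemeasurable
      (Measurable.aestronglyMeasurable (by fun_prop))]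
  simp only [h]
  rw [← integral_finsetSum _ fun i _ => integrable_pi_cube h3 i j]
  exact integral_mono (integrable_finsetSum _ fun i _ => integrable_pi_cube h3 i j)
    (integrable_iSup_sum_cube h3) fun x => sum_cube_le_iSup x j

lemma integral_markDensity (β : Bool) (s : ℝ) :
    ∫ z, markDensity β s z ∂(refLaw L) = 1 := by
  have := integral_markDensity_mul L β s true (h := fun _ => 1) measurable_const
  simpa using this

section weights

variable {s : ℝ}

lemma integrable_density_softAvg (hs0 : 0 < s) (hs1 : s < 1) (β : Bool)
    {c : (N → State J) → J → ℝ} (hm : Measurable c)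
    (hc : ∀ j, Integrable (fun z => c z j) (refLaw L)) :
    Integrable (fun z => markDensity β s z * softAvg (pathSum β s z) (c z)) (refLaw L) :=
  (integrable_softAvg (measurable_pathSum β s) hm hc).bdd_mul
    (measurable_markDensity β s).aestronglyMeasurable
    (Filter.Eventually.of_forall fun z => abs_prod_pathWeight_le_three hs0 hs1 β _ z)

/-- The softmax weights of the full interpolated sum are common to all summands, so the sum over
the summands can be taken before the maximum over the coordinates. -/
lemma sum_integral_density_cube_le (hs0 : 0 < s) (hs1 : s < 1) (β b : Bool)
    (h3 : ∀ b i j, Integrable (fun x : J → ℝ => |x j| ^ 3) (L b i)) :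
    ∑ i, ∫ z, markDensity β s z * softAvg (pathSum β s z) (fun j => |(z i).2 b j| ^ 3)
      ∂(refLaw L) ≤ realSumCube (L b) := by
  have hri : ∀ i j, Integrable (fun z : N → State J => |(z i).2 b j| ^ 3) (refLaw L) :=
    fun i j => (measurePreserving_ref_apply L b i).integrable_comp_of_integrable (h3 b i j)
  have hrm : ∀ i, Measurable fun (z : N → State J) j => |(z i).2 b j| ^ 3 := fun i => by fun_prop
  rw [← integral_finsetSum _ fun i _ => integrable_density_softAvg hs0 hs1 β (hrm i) (hri i)]
  simp only [← Finset.mul_sum, ← softAvg_sum]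
  have hS : Integrable (fun z : N → State J => ⨆ j, ∑ i, |(z i).2 b j| ^ 3) (refLaw L) :=
    (measurePreserving_ref L b).integrable_comp_of_integrable (integrable_iSup_sum_cube (h3 b))
  have e := integral_markDensity_mul L β s b (measurable_iSup_sum_cube (J := J) (N := N))
  rw [realSumCube, ← e]
  refine integral_mono (integrable_density_softAvg hs0 hs1 β (by fun_prop)
    fun j => integrable_finsetSum _ fun i _ => hri i j)
    (hS.bdd_mul (measurable_markDensity β s).aestronglyMeasurable
      (Filter.Eventually.of_forall fun z => abs_prod_pathWeight_le_three hs0 hs1 β _ z)) fun z => ?_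
  exact mul_le_mul_of_nonneg_left (softAvg_le fun j => sum_cube_le_iSup (fun i => (z i).2 b) j)
    (markDensity_nonneg hs0 hs1 β z)

lemma sum_integral_density_cubeMoment_le (hs0 : 0 < s) (hs1 : s < 1) (β b : Bool)
    (h3 : ∀ b i j, Integrable (fun x : J → ℝ => |x j| ^ 3) (L b i)) :
    ∑ i, ∫ z, markDensity β s z * softAvg (pathSum β s z) (cubeMoment (L b i))
      ∂(refLaw L) ≤ realSumCube (L b) := by
  have hi : ∀ i, Integrable (fun z => markDensity β s z *
      softAvg (pathSum β s z) (cubeMoment (L b i))) (refLaw L) := fun i =>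
    integrable_density_softAvg hs0 hs1 β (c := fun _ => cubeMoment (L b i)) measurable_const
      fun j => integrable_const _
  have hd : Integrable (markDensity β s) (refLaw L) :=
    Integrable.of_bound (measurable_markDensity β s).aestronglyMeasurable _
      (Filter.Eventually.of_forall fun z => abs_prod_pathWeight_le_three hs0 hs1 β _ z)
  rw [← integral_finsetSum _ fun i _ => hi i]
  have h1 : realSumCube (L b) = ∫ z, markDensity β s z * realSumCube (L b) ∂(refLaw L) := by
    rw [integral_mul_const, integral_markDensity, one_mul]
  rw [h1]
  refine integral_mono (integrable_finsetSum _ fun i _ => hi i) (hd.mul_const _) fun z => ?_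
  simp only
  rw [← Finset.mul_sum, ← softAvg_sum]
  exact mul_le_mul_of_nonneg_left (softAvg_le fun j => sum_cubeMoment_le (h3 b) j)
    (markDensity_nonneg hs0 hs1 β z)

/-- The moments averaged after a step: the step is a fresh copy of the summand with mark `some b`,
so the average is one at the full interpolated sum. The factor `c ^ 3 / famWeight` stays bounded,
even though `famWeight` vanishes at time `0` for the other family. -/
lemma sum_integral_erase_stepMoment_le (hs0 : 0 < s) (hs1 : s < 1) (β b : Bool)
    (h3 : ∀ b i j, Integrable (fun x : J → ℝ => |x j| ^ 3) (L b i)) :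
    ∑ i, ∫ z, markDensityErase β s i z *
        stepMoment (scaledLaw (L b i) (pathScale β s b)) (pathSumErase β s i z) ∂(refLaw L) ≤
      128 * realSumCube (L b) := by
  set c := pathScale β s b with hc
  have hc0 : 0 < c := pathScale_pos hs0 β b
  have hw := famWeight_pos hs0 hs1 β b
  have key : ∀ i, famWeight β s b * ∫ z, markDensityErase β s i z *
        stepMoment (scaledLaw (L b i) c) (pathSumErase β s i z) ∂(refLaw L) ≤
      c ^ 3 * (∫ z, markDensity β s z * softAvg (pathSum β s z) (fun j => |(z i).2 b j| ^ 3)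
        ∂(refLaw L) + ∫ z, markDensity β s z * softAvg (pathSum β s z) (cubeMoment (L b i))
        ∂(refLaw L)) := by
    intro i
    have hri : ∀ j, Integrable (fun z : N → State J => |(z i).2 b j| ^ 3) (refLaw L) :=
      fun j => (measurePreserving_ref_apply L b i).integrable_comp_of_integrable (h3 b i j)
    have h := weight_mul_integral_erase_le (L := L) hs0 hs1 β i (some b)
      (h := fun v j => c ^ 3 * (|v b j| ^ 3 + cubeMoment (L b i) j)) (by fun_prop)
      (fun v j => by have := cubeMoment_nonneg (L b i) j; positivity)
      (fun j => (((measurePreserving_eval (fun b => L b i) b).integrable_comp_of_integrable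
        (h3 b i j)).add (integrable_const _)).const_mul _)
    have e1 : ∀ w : J → ℝ, ∫ v : Bool → J → ℝ, softAvg (w + pathStep β s (some b, v))
        (fun j => c ^ 3 * (|v b j| ^ 3 + cubeMoment (L b i) j)) ∂(Measure.pi fun b => L b i) =
        stepMoment (scaledLaw (L b i) c) w := by
      intro w
      have e2 : stepMoment (scaledLaw (L b i) c) w = ∫ x, softAvg (w + c • x)
          (fun j => c ^ 3 * (|x j| ^ 3 + cubeMoment (L b i) j)) ∂(L b i) := by
        rw [stepMoment, integral_scaledLaw (L b i) c (measurable_softAvg (by fun_prop)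
          (by fun_prop))]
        simp only [Pi.smul_apply, smul_eq_mul, abs_mul, mul_pow, abs_of_pos hc0,
          cubeMoment_scaledLaw hc0.le, mul_add]
      rw [e2, ← integral_family (L := L) (h := fun x => softAvg (w + c • x)
          (fun j => c ^ 3 * (|x j| ^ 3 + cubeMoment (L b i) j)))
          (measurable_softAvg (by fun_prop) (by fun_prop))]
      rfl
    simp only [e1] at h
    simp only [softAvg_const_mul, softAvg_add, mul_left_comm _ (c ^ 3), mul_add] at h
    rw [integral_add ((integrable_density_softAvg hs0 hs1 β (by fun_prop) hri).const_mul _)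
      ((integrable_density_softAvg hs0 hs1 β (c := fun _ => cubeMoment (L b i)) measurable_const
      fun j => integrable_const _).const_mul _), integral_const_mul, integral_const_mul,
      ← mul_add] at h
    exact h
  have hsum := Finset.sum_le_sum fun i (_ : i ∈ Finset.univ) => key i
  rw [← Finset.mul_sum, ← Finset.mul_sum, Finset.sum_add_distrib] at hsum
  have h1 := sum_integral_density_cube_le hs0 hs1 β b h3
  have h2 := sum_integral_density_cubeMoment_le hs0 hs1 β b h3
  have hM := realSumCube_nonneg (L b)
  have hq := cube_scale_div_le hs0 hs1 β b
  rw [← hc, div_le_iff₀ hw] at hq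
  have hc3 : 0 < c ^ 3 := by positivity
  refine le_of_mul_le_mul_left ?_ hw
  nlinarith [mul_le_mul_of_nonneg_left (add_le_add h1 h2) hc3.le, mul_le_mul_of_nonneg_right hq hM]

/-- The moments averaged before a step: the sum without the summand `i` is the full sum when that
summand is deleted, at the cost of the inverse of the deletion probability. -/
lemma sum_integral_erase_cubeMoment_le (hs0 : 0 < s) (hs1 : s < 1) (β b : Bool)
    (h3 : ∀ b i j, Integrable (fun x : J → ℝ => |x j| ^ 3) (L b i)) :
    s ^ 2 * ∑ i, ∫ z, markDensityErase β s i z * softAvg (pathSumErase β s i z)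
        (cubeMoment (scaledLaw (L b i) (pathScale β s b))) ∂(refLaw L) ≤
      16 * realSumCube (L b) := by
  set c := pathScale β s b with hc
  have hc0 : 0 < c := pathScale_pos hs0 β b
  have key : ∀ i, pathWeight β s none * ∫ z, markDensityErase β s i z *
        softAvg (pathSumErase β s i z) (cubeMoment (scaledLaw (L b i) c)) ∂(refLaw L) ≤
      c ^ 3 * ∫ z, markDensity β s z * softAvg (pathSum β s z) (cubeMoment (L b i))
        ∂(refLaw L) := by
    intro i
    have h := weight_mul_integral_erase_le (L := L) hs0 hs1 β i none
      (h := fun _ => cubeMoment (scaledLaw (L b i) c)) measurable_const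
      (fun v j => cubeMoment_nonneg _ j) (fun j => integrable_const _)
    have e : cubeMoment (scaledLaw (L b i) c) = fun j => c ^ 3 * cubeMoment (L b i) j := by
      ext j
      exact cubeMoment_scaledLaw hc0.le j
    simp only [pathStep, Option.elim_none, add_zero, integral_const, probReal_univ, one_smul] at h
    refine h.trans_eq ?_
    rw [e, ← integral_const_mul]
    simp only [softAvg_const_mul, mul_left_comm _ (c ^ 3)]
  have hsum := Finset.sum_le_sum fun i (_ : i ∈ Finset.univ) => key i
  rw [← Finset.mul_sum, ← Finset.mul_sum] at hsum
  have h2 := sum_integral_density_cubeMoment_le hs0 hs1 β b h3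
  have hM := realSumCube_nonneg (L b)
  have hp := pathWeight_none_ge hs0 hs1 β
  have hc3 : c ^ 3 ≤ 2 ^ 3 := pow_le_pow_left₀ hc0.le (pathScale_le_two hs0 hs1 β b) 3
  have hS : 0 ≤ ∑ i, ∫ z, markDensityErase β s i z * softAvg (pathSumErase β s i z)
        (cubeMoment (scaledLaw (L b i) c)) ∂(refLaw L) :=
    Finset.sum_nonneg fun i _ => integral_nonneg fun z => mul_nonneg
      (markDensityErase_nonneg hs0 hs1 β i z) (softAvg_nonneg (cubeMoment_nonneg _))
  nlinarith [mul_le_mul_of_nonneg_left h2 (pow_pos hc0 3).le, mul_le_mul_of_nonneg_right hc3 hM,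
    mul_le_mul_of_nonneg_right hp hS]

lemma abs_integral_pathTerm_le (hf : HasBoundedDerivs K f f₁ f₂ f₃) (hB : ∀ x, |f x| ≤ B)
    (hL : MomentMatched L) (hs0 : 0 < s) (hs1 : s < 1) (β : Bool) (w : J → ℝ) (i : N)
    {R : Bool → ℝ}
    (h₀ : ∀ b, |∫ x, rem₀ f f₁ f₂ w (pathScale β s b • x) ∂(L b i)| ≤ R b)
    (h₁ : ∀ b, |∫ x, rem₁ f₁ f₂ w (pathScale β s b • x) ∂(L b i)| ≤ R b) :
    |∫ y, pathTerm f f₁ β s w y ∂(stateLaw L i)| ≤ 16 * s * ∑ b, R b := by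
  rw [integral_pathTerm hf hB hL β hs0 w i, Finset.mul_sum]
  refine (Finset.abs_sum_le_sum_abs _ _).trans (Finset.sum_le_sum fun b _ => ?_)
  have h1 := mul_le_mul (abs_famWeightDeriv_le hs0 hs1 β b) (h₀ b) (abs_nonneg _) (by positivity)
  have h2 := mul_le_mul (abs_logScale_le hs0 hs1 β b) (h₁ b) (abs_nonneg _) (by positivity)
  rw [← abs_mul] at h1 h2
  exact (abs_add_le _ _).trans (by linarith)

/-- The derivative along the path is bounded by the third moments of maximal sums. The time `s`
balances the two terms of the one-step bound: deletion of a summand has probability of order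
`s ^ 2`. -/
lemma abs_deriv_pathFun_le_cube (hf : HasBoundedDerivs K f f₁ f₂ f₃) (hB : ∀ x, |f x| ≤ B)
    (hL : MomentMatched L) (h3 : ∀ b i j, Integrable (fun x : J → ℝ => |x j| ^ 3) (L b i))
    (hs0 : 0 < s) (hs1 : s < 1) (β : Bool) :
    |∑ i, ∫ z, markDensityErase β s i z *
        pathTerm f f₁ β s (pathSumErase β s i z) (z i) ∂(refLaw L)| ≤
      200000 * K * ∑ b, realSumCube (L b) := by
  have hK := hf.nonneg
  set T : Bool → N → (J → ℝ) → ℝ := fun b i => stepMoment (scaledLaw (L b i) (pathScale β s b))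
    with hT
  set V : Bool → N → (J → ℝ) → ℝ := fun b i w =>
    softAvg w (cubeMoment (scaledLaw (L b i) (pathScale β s b))) with hV
  have hw : ∀ i w, |∫ y, pathTerm f f₁ β s w y ∂(stateLaw L i)| ≤
      ∑ b, K * (1440 * T b i w + 32 * s ^ 2 * V b i w) := by
    intro i w
    have hR := fun b => abs_integral_rem_le hf
      (mean_scaledLaw (c := pathScale β s b) (hL.mean b i))
      (integrable_cube_scaledLaw (c := pathScale β s b) (h3 b i)) w (l := 1 / s)
      (by rw [le_div_iff₀ hs0]; linarith)
    have h := abs_integral_pathTerm_le hf hB hL hs0 hs1 β w i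
      (R := fun b => K * (90 * (1 / s) * T b i w + 2 * (V b i w / (1 / s))))
      (fun b => by
        rw [← integral_scaledLaw (L b i) _ (measurable_rem₀ hf w)]
        exact (hR b).1)
      (fun b => by
        rw [← integral_scaledLaw (L b i) _ (measurable_rem₁ hf w)]
        exact (hR b).2)
    refine h.trans_eq ?_
    rw [Finset.mul_sum]
    refine Finset.sum_congr rfl fun b _ => ?_
    field_simp
    ring
  have hTi : ∀ b i, Integrable (fun z => markDensityErase β s i z * T b i (pathSumErase β s i z))
      (refLaw L) := fun b i => by
    have hT0 : Integrable (fun z => T b i (pathSumErase β s i z)) (refLaw L) := by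
      refine Integrable.of_bound ((measurable_stepMoment _).comp
        (measurable_pathSumErase β s i)).aestronglyMeasurable
        (∫ x : J → ℝ, ∑ j, (|x j| ^ 3 + cubeMoment (scaledLaw (L b i) (pathScale β s b)) j)
          ∂(scaledLaw (L b i) (pathScale β s b))) (Filter.Eventually.of_forall fun z => ?_)
      rw [Real.norm_of_nonneg (stepMoment_nonneg _ _)]
      exact stepMoment_le (integrable_cube_scaledLaw (h3 b i)) _
    exact hT0.bdd_mul (measurable_markDensityErase β s i).aestronglyMeasurable
      (Filter.Eventually.of_forall fun z => abs_prod_pathWeight_le_three hs0 hs1 β _ z)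
  have hVi : ∀ b i, Integrable (fun z => markDensityErase β s i z * V b i (pathSumErase β s i z))
      (refLaw L) := fun b i =>
    (integrable_softAvg (c := fun _ => cubeMoment (scaledLaw (L b i) (pathScale β s b)))
      (measurable_pathSumErase β s i) measurable_const fun j => integrable_const _).bdd_mul
      (measurable_markDensityErase β s i).aestronglyMeasurable
      (Filter.Eventually.of_forall fun z => abs_prod_pathWeight_le_three hs0 hs1 β _ z)
  have hi : ∀ i, |∫ z, markDensityErase β s i z *
        pathTerm f f₁ β s (pathSumErase β s i z) (z i) ∂(refLaw L)| ≤
      ∑ b, K * (1440 * ∫ z, markDensityErase β s i z * T b i (pathSumErase β s i z) ∂(refLaw L) +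
        32 * (s ^ 2 * ∫ z, markDensityErase β s i z * V b i (pathSumErase β s i z)
          ∂(refLaw L))) := by
    intro i
    rw [integral_erase_pathTerm hf hB hL β s i]
    have hint : ∀ b, Integrable (fun z => K * (1440 * (markDensityErase β s i z *
        T b i (pathSumErase β s i z)) + 32 * s ^ 2 * (markDensityErase β s i z *
          V b i (pathSumErase β s i z)))) (refLaw L) := fun b =>
      (((hTi b i).const_mul _).add ((hVi b i).const_mul _)).const_mul _
    have h := norm_integral_le_of_norm_le (f := fun z => markDensityErase β s i z *
        ∫ y, pathTerm f f₁ β s (pathSumErase β s i z) y ∂(stateLaw L i))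
      (integrable_finsetSum Finset.univ fun b _ => hint b)
      (Filter.Eventually.of_forall fun z => by
        rw [norm_mul, Real.norm_of_nonneg (markDensityErase_nonneg hs0 hs1 β i z)]
        refine (mul_le_mul_of_nonneg_left (hw i (pathSumErase β s i z))
          (markDensityErase_nonneg hs0 hs1 β i z)).trans_eq ?_
        rw [Finset.mul_sum]
        exact Finset.sum_congr rfl fun b _ => by ring)
    rw [Real.norm_eq_abs] at h
    refine h.trans_eq ?_
    rw [integral_finsetSum _ fun b _ => hint b]
    refine Finset.sum_congr rfl fun b _ => ?_
    rw [integral_const_mul, integral_add ((hTi b i).const_mul _) ((hVi b i).const_mul _),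
      integral_const_mul, integral_const_mul, mul_assoc 32]
  refine (Finset.abs_sum_le_sum_abs _ _).trans ((Finset.sum_le_sum fun i _ => hi i).trans ?_)
  rw [Finset.sum_comm, Finset.mul_sum]
  refine Finset.sum_le_sum fun b _ => ?_
  rw [← Finset.mul_sum, Finset.sum_add_distrib, ← Finset.mul_sum, ← Finset.mul_sum,
    ← Finset.mul_sum]
  have h1 := sum_integral_erase_stepMoment_le hs0 hs1 β b h3
  have h2 := sum_integral_erase_cubeMoment_le hs0 hs1 β b h3
  have hM := realSumCube_nonneg (L b)
  rw [mul_comm (200000 : ℝ) K, mul_assoc]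
  refine mul_le_mul_of_nonneg_left ?_ hK
  simp only [hT, hV]
  linarith

/-- The derivative along the path is bounded by the sum of the absolute moments of order `q`. -/
lemma abs_deriv_pathFun_le_rpow (hf : HasBoundedDerivs K f f₁ f₂ f₃) (hB : ∀ x, |f x| ≤ B)
    (hL : MomentMatched L) {q : ℝ} (hq2 : 2 ≤ q) (hq3 : q ≤ 3)
    (hq : ∀ b i, Integrable (fun x : J → ℝ => ‖x‖ ^ q) (L b i))
    (hs0 : 0 < s) (hs1 : s < 1) (β : Bool) :
    |∑ i, ∫ z, markDensityErase β s i z *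
        pathTerm f f₁ β s (pathSumErase β s i z) (z i) ∂(refLaw L)| ≤
      2560 * K * ∑ i, ∑ b, ∫ x, ‖x‖ ^ q ∂(L b i) := by
  have hK := hf.nonneg
  have hR : ∀ (R : (J → ℝ) → ℝ) (b : Bool) (i : N), (∀ x, |R x| ≤ 20 * K * ‖x‖ ^ q) →
      |∫ x, R (pathScale β s b • x) ∂(L b i)| ≤ 160 * K * ∫ x, ‖x‖ ^ q ∂(L b i) := by
    intro R b i hR
    rw [← integral_const_mul]
    refine norm_integral_le_of_norm_le (f := fun x => R (pathScale β s b • x))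
      ((hq b i).const_mul _) (Filter.Eventually.of_forall
      fun x => (hR _).trans ?_)
    have hc0 := pathScale_pos hs0 β b
    have hc2 := pathScale_le_two hs0 hs1 β b
    have hc : pathScale β s b ^ q ≤ 8 := by
      calc pathScale β s b ^ q ≤ 2 ^ q := Real.rpow_le_rpow hc0.le hc2 (by linarith)
        _ ≤ 2 ^ (3 : ℝ) := Real.rpow_le_rpow_of_exponent_le (by norm_num) hq3
        _ = 8 := by norm_num
    rw [norm_smul, Real.mul_rpow (norm_nonneg _) (norm_nonneg _), Real.norm_of_nonneg hc0.le]
    have hx : 0 ≤ ‖x‖ ^ q := by positivity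
    nlinarith [mul_nonneg hK hx, mul_le_mul_of_nonneg_right hc (mul_nonneg hK hx)]
  have hx : ∀ w x : J → ℝ, |rem₀ f f₁ f₂ w x| ≤ 20 * K * ‖x‖ ^ q ∧
      |rem₁ f₁ f₂ w x| ≤ 20 * K * ‖x‖ ^ q := fun w x =>
    abs_rem_le_rpow hf w x (fun j => norm_le_pi_norm x j) hq2 hq3
  have hw : ∀ i w, |∫ y, pathTerm f f₁ β s w y ∂(stateLaw L i)| ≤
      2560 * K * ∑ b, ∫ x, ‖x‖ ^ q ∂(L b i) := by
    intro i w
    have h := abs_integral_pathTerm_le hf hB hL hs0 hs1 β w i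
      (R := fun b => 160 * K * ∫ x, ‖x‖ ^ q ∂(L b i))
      (fun b => hR _ b i fun x => (hx w x).1) (fun b => hR _ b i fun x => (hx w x).2)
    refine h.trans ?_
    rw [← Finset.mul_sum]
    have hS : 0 ≤ K * ∑ b, ∫ x, ‖x‖ ^ q ∂(L b i) := mul_nonneg hK
      (Finset.sum_nonneg fun b _ => integral_nonneg fun x => by positivity)
    nlinarith
  refine (Finset.abs_sum_le_sum_abs _ _).trans ?_
  rw [Finset.mul_sum]
  refine Finset.sum_le_sum fun i _ => ?_
  rw [integral_erase_pathTerm hf hB hL β s i]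
  have hd : Integrable (markDensityErase β s i) (refLaw L) :=
    Integrable.of_bound (measurable_markDensityErase β s i).aestronglyMeasurable _
      (Filter.Eventually.of_forall fun z => abs_prod_pathWeight_le_three hs0 hs1 β _ z)
  have h := norm_integral_le_of_norm_le (f := fun z => markDensityErase β s i z *
        ∫ y, pathTerm f f₁ β s (pathSumErase β s i z) y ∂(stateLaw L i))
      (hd.mul_const (2560 * K * ∑ b, ∫ x, ‖x‖ ^ q ∂(L b i)))
      (Filter.Eventually.of_forall fun z => by
        rw [norm_mul, Real.norm_of_nonneg (markDensityErase_nonneg hs0 hs1 β i z)]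
        exact mul_le_mul_of_nonneg_left (hw i _) (markDensityErase_nonneg hs0 hs1 β i z))
  rwa [integral_mul_const, integral_markDensityErase, one_mul, Real.norm_eq_abs] at h

end weights

/-- At time `0` all marks are `some β` almost surely. -/
lemma pathFun_zero (hf : Measurable f) (β : Bool) :
    pathFun f L β 0 = ∫ x, f (smoothMax (∑ i, x i)) ∂(Measure.pi (L β)) := by
  have hm : Measurable fun x : N → J → ℝ => f (smoothMax (∑ i, x i)) :=
    hf.comp (measurable_smoothMax.comp (by fun_prop))
  rw [← integral_markDensity_mul L β 0 β hm, pathFun]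
  refine integral_congr_ae (Filter.Eventually.of_forall fun z => ?_)
  simp only
  by_cases h : ∀ i, (z i).1 = some β
  · congr 4
    refine Finset.sum_congr rfl fun i _ => ?_
    simp [pathStep, h i, pathScale]
  · push Not at h
    obtain ⟨i, hi⟩ := h
    have h0 : markDensity β 0 z = 0 := by
      refine Finset.prod_eq_zero (Finset.mem_univ i) ?_
      rcases hz : (z i).1 with _ | b
      · simp [pathWeight, famWeight]
      · have : b ≠ β := fun hb => hi (by rw [hz, hb])
        simp [pathWeight, famWeight, this]
    simp [h0]

/-- At time `1` the law of the path does not depend on the family it started from. -/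
lemma pathFun_one (L : Bool → N → Measure (J → ℝ)) (f : ℝ → ℝ) (β : Bool) :
    pathFun f L β 1 = pathFun f L true 1 := by
  have h1 : ∀ b, famWeight β 1 b = 1 / 8 := fun b => by
    unfold famWeight
    split_ifs <;> norm_num
  have h1' : ∀ b, famWeight true 1 b = 1 / 8 := fun b => by
    unfold famWeight
    split_ifs <;> norm_num
  have h2 : pathScale β 1 = pathScale true 1 := by
    ext b
    unfold pathScale
    split_ifs <;> norm_num
  have h3 : pathWeight β 1 = pathWeight true 1 := by
    ext k
    cases k <;> simp only [pathWeight, h1, h1']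
  simp only [pathFun, markDensity, pathSum, pathStep, h2, h3]

/-- The mean value theorem on the two paths from the families to their common midpoint. -/
lemma abs_sub_le_of_deriv_le (hf : HasBoundedDerivs K f f₁ f₂ f₃) (hB : ∀ x, |f x| ≤ B)
    (hL : MomentMatched L) {R : ℝ}
    (hR : ∀ β s, 0 < s → s < 1 → |∑ i, ∫ z, markDensityErase β s i z *
        pathTerm f f₁ β s (pathSumErase β s i z) (z i) ∂(refLaw L)| ≤ R) :
    |∫ x, f (smoothMax (∑ i, x i)) ∂(Measure.pi (L false)) -
      ∫ x, f (smoothMax (∑ i, x i)) ∂(Measure.pi (L true))| ≤ 2 * R := by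
  have h : ∀ β, |pathFun f L β 1 - pathFun f L β 0| ≤ R := by
    intro β
    have hd := fun s => (hasDerivAt_pathFun hf hB hL β s).2
    obtain ⟨s, hs, e⟩ := exists_hasDerivAt_eq_slope (pathFun f L β) _ zero_lt_one
      (fun s _ => (hd s).continuousAt.continuousWithinAt) (fun s _ => hd s)
    rw [sub_zero, div_one] at e
    rw [← e]
    exact hR β s hs.1 hs.2
  have h1 := h false
  have h2 := h true
  rw [pathFun_zero hf.measurable.1] at h1 h2
  rw [pathFun_one] at h1
  rw [abs_le] at *
  constructor <;> linarith [h1.1, h1.2, h2.1, h2.2]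

/-- Comparison of smooth maxima of independent sums by the third moments of maximal sums. -/
theorem abs_integral_sub_le_cube (hf : HasBoundedDerivs K f f₁ f₂ f₃) (hB : ∀ x, |f x| ≤ B)
    (hL : MomentMatched L) (h3 : ∀ b i j, Integrable (fun x : J → ℝ => |x j| ^ 3) (L b i)) :
    |∫ x, f (smoothMax (∑ i, x i)) ∂(Measure.pi (L false)) -
      ∫ x, f (smoothMax (∑ i, x i)) ∂(Measure.pi (L true))| ≤
      400000 * K * ∑ b, realSumCube (L b) := by
  refine (abs_sub_le_of_deriv_le hf hB hL fun β s hs0 hs1 =>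
    abs_deriv_pathFun_le_cube hf hB hL h3 hs0 hs1 β).trans_eq ?_
  ring

/-- Comparison of smooth maxima of independent sums by sums of maximal moments. -/
theorem abs_integral_sub_le_rpow (hf : HasBoundedDerivs K f f₁ f₂ f₃) (hB : ∀ x, |f x| ≤ B)
    (hL : MomentMatched L) {q : ℝ} (hq2 : 2 ≤ q) (hq3 : q ≤ 3)
    (hq : ∀ b i, Integrable (fun x : J → ℝ => ‖x‖ ^ q) (L b i)) :
    |∫ x, f (smoothMax (∑ i, x i)) ∂(Measure.pi (L false)) -
      ∫ x, f (smoothMax (∑ i, x i)) ∂(Measure.pi (L true))| ≤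
      5120 * K * ∑ i, ∑ b, ∫ x, ‖x‖ ^ q ∂(L b i) := by
  refine (abs_sub_le_of_deriv_le hf hB hL fun β s hs0 hs1 =>
    abs_deriv_pathFun_le_rpow hf hB hL hq2 hq3 hq hs0 hs1 β).trans_eq ?_
  ring

end

end Comparison

/-! ### Smoothing of indicators -/

open scoped Convolution in
/-- The derivatives of `1_A ⋆ ψ` are bounded by the `L¹` norms of the derivatives of `ψ`,
uniformly in `A`. -/
lemma exists_hasBoundedDerivs_convolution {ψ : ℝ → ℝ} (hψ : ContDiff ℝ 3 ψ)
    (hc : HasCompactSupport ψ) :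
    ∃ C : ℝ, 0 < C ∧ ∀ A : Set ℝ, MeasurableSet A → ∃ f₁ f₂ f₃ : ℝ → ℝ,
      HasBoundedDerivs C (fun x => ∫ t, A.indicator 1 t * ψ (x - t)) f₁ f₂ f₃ := by
  have hψ₁ : ContDiff ℝ 2 (deriv ψ) := ((contDiff_succ_iff_deriv (n := 2)).1 hψ).2.2
  have hψ₂ : ContDiff ℝ 1 (deriv (deriv ψ)) := ((contDiff_succ_iff_deriv (n := 1)).1 hψ₁).2.2
  have hψ₃ : ContDiff ℝ 0 (deriv (deriv (deriv ψ))) :=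
    ((contDiff_succ_iff_deriv (n := 0)).1 hψ₂).2.2
  have hb : ∀ g : ℝ → ℝ, Continuous g → HasCompactSupport g → ∀ A : Set ℝ, ∀ x,
      |(A.indicator (1 : ℝ → ℝ) ⋆[ContinuousLinearMap.mul ℝ ℝ, volume] g) x| ≤ ∫ t, |g t| := by
    intro g hg hgc A x
    rw [convolution_def, ← Real.norm_eq_abs, ← integral_sub_left_eq_self (fun t => |g t|) volume x]
    have hgi : Integrable g := hg.integrable_of_hasCompactSupport hgc
    refine norm_integral_le_of_norm_le (hgi.abs.comp_sub_left x)
      (Filter.Eventually.of_forall fun t => ?_)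
    rw [ContinuousLinearMap.mul_apply', norm_mul, Real.norm_eq_abs, Real.norm_eq_abs]
    refine mul_le_of_le_one_left (abs_nonneg _) ?_
    by_cases h : t ∈ A <;> simp [h]
  refine ⟨(∫ t, |deriv ψ t|) + (∫ t, |deriv (deriv ψ) t|) +
    (∫ t, |deriv (deriv (deriv ψ)) t|) + 1, by positivity, fun A hA => ?_⟩
  have hloc : LocallyIntegrable (A.indicator (1 : ℝ → ℝ)) volume :=
    (locallyIntegrable_const (1 : ℝ)).indicator hA
  have h₁ : 0 ≤ ∫ t, |deriv ψ t| := integral_nonneg fun _ => abs_nonneg _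
  have h₂ : 0 ≤ ∫ t, |deriv (deriv ψ) t| := integral_nonneg fun _ => abs_nonneg _
  have h₃ : 0 ≤ ∫ t, |deriv (deriv (deriv ψ)) t| := integral_nonneg fun _ => abs_nonneg _
  refine ⟨_, _, _, ⟨fun x => hc.hasDerivAt_convolution_right (ContinuousLinearMap.mul ℝ ℝ) hloc
    (hψ.of_le (by norm_num)) x, fun x => hc.deriv.hasDerivAt_convolution_right _ hloc
    (hψ₁.of_le (by norm_num)) x, fun x => hc.deriv.deriv.hasDerivAt_convolution_right _ hloc
    hψ₂ x, fun x => ?_, fun x => ?_, fun x => ?_⟩⟩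
  · linarith [hb _ hψ₁.continuous hc.deriv A x]
  · linarith [hb _ hψ₂.continuous hc.deriv.deriv A x]
  · linarith [hb _ hψ₃.continuous hc.deriv.deriv.deriv A x]

lemma HasBoundedDerivs.congr_left {C : ℝ} {f g f₁ f₂ f₃ : ℝ → ℝ}
    (h : HasBoundedDerivs C f f₁ f₂ f₃) (hg : ∀ x, g x = f x) :
    HasBoundedDerivs C g f₁ f₂ f₃ := by
  rwa [funext hg]

/-- Rescaling by `δ ≥ 1`: the `k`-th derivative gains `δ⁻ᵏ ≤ δ⁻¹`. -/
lemma HasBoundedDerivs.comp_div {C δ : ℝ} {f f₁ f₂ f₃ : ℝ → ℝ}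
    (h : HasBoundedDerivs C f f₁ f₂ f₃) (hδ : 1 ≤ δ) :
    HasBoundedDerivs (C / δ) (fun x => f (x / δ)) (fun x => f₁ (x / δ) / δ)
      (fun x => f₂ (x / δ) / δ ^ 2) (fun x => f₃ (x / δ) / δ ^ 3) := by
  have hC := h.nonneg
  have hδ0 : 0 < δ := by linarith
  have hd : ∀ x, HasDerivAt (fun x : ℝ => x / δ) (1 / δ) x := fun x =>
    (hasDerivAt_id x).div_const δ
  have hp : ∀ k : ℕ, k ≠ 0 → ∀ y : ℝ, |y| ≤ C → |y / δ ^ k| ≤ C / δ := by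
    intro k hk y hy
    rw [abs_div, abs_of_pos (by positivity : 0 < δ ^ k)]
    exact div_le_div₀ hC hy hδ0 (le_self_pow₀ hδ hk)
  refine ⟨fun x => ?_, fun x => ?_, fun x => ?_, fun x => ?_, fun x => ?_, fun x => ?_⟩
  · exact ((h.deriv₁ _).comp x (hd x)).congr_deriv (by ring)
  · exact (((h.deriv₂ _).comp x (hd x)).div_const δ).congr_deriv (by field_simp)
  · exact (((h.deriv₃ _).comp x (hd x)).div_const (δ ^ 2)).congr_deriv (by field_simp)
  · simpa using hp 1 one_ne_zero _ (h.bound₁ (x / δ))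
  · exact hp 2 two_ne_zero _ (h.bound₂ (x / δ))
  · exact hp 3 three_ne_zero _ (h.bound₃ (x / δ))

/-- There is a noise distribution on `[-1, 1]` that turns every indicator, at every scale
`δ ≥ 1`, into a function whose first three derivatives are at most `C / δ`. -/
theorem exists_smoothing_noise :
    ∃ C : ℝ, 0 < C ∧ ∃ m : Measure ℝ, IsProbabilityMeasure m ∧ (∀ᵐ u ∂m, |u| ≤ 1) ∧
      ∀ A : Set ℝ, MeasurableSet A → ∀ δ : ℝ, 1 ≤ δ → ∃ f₁ f₂ f₃ : ℝ → ℝ,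
        HasBoundedDerivs (C / δ) (fun x => m.real {u | x + δ * u ∈ A}) f₁ f₂ f₃ := by
  let φ : ContDiffBump (0 : ℝ) := ⟨1 / 2, 1, by norm_num, by norm_num⟩
  set ψ : ℝ → ℝ := φ.normed volume with hψ
  have hψ0 : ∀ u, 0 ≤ ψ u := fun u => φ.nonneg_normed u
  have hψi : Integrable ψ := φ.integrable_normed
  have hψm : Measurable ψ := φ.continuous_normed.measurable
  obtain ⟨C, hC, h⟩ := exists_hasBoundedDerivs_convolution (ψ := ψ) φ.contDiff_normed
    φ.hasCompactSupport_normed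
  refine ⟨C, hC, volume.withDensity fun u => ENNReal.ofReal (ψ u), ⟨?_⟩, ?_, fun A hA δ hδ => ?_⟩
  · rw [withDensity_apply _ MeasurableSet.univ, Measure.restrict_univ,
      ← ofReal_integral_eq_lintegral_ofReal hψi (Filter.Eventually.of_forall hψ0),
      φ.integral_normed, ENNReal.ofReal_one]
  · rw [ae_withDensity_iff (by fun_prop)]
    refine Filter.Eventually.of_forall fun u hu => ?_
    have h1 : u ∈ Function.support ψ := fun h0 => hu (by rw [h0, ENNReal.ofReal_zero])
    rw [hψ, φ.support_normed_eq, mem_ball_zero_iff, Real.norm_eq_abs] at h1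
    exact h1.le
  · have hδ0 : δ ≠ 0 := by positivity
    obtain ⟨f₁, f₂, f₃, hf⟩ := h ((fun y => δ * y) ⁻¹' A) (measurable_const_mul δ hA)
    refine ⟨_, _, _, (hf.comp_div hδ).congr_left fun x => ?_⟩
    have hS : MeasurableSet {u | x + δ * u ∈ A} :=
      ((measurable_const_add x).comp (measurable_const_mul δ)) hA
    rw [measureReal_def, withDensity_apply _ hS, ← ofReal_integral_eq_lintegral_ofReal
      hψi.integrableOn (Filter.Eventually.of_forall hψ0), ENNReal.toReal_ofReal
      (integral_nonneg hψ0), ← integral_indicator hS, ← integral_add_left_eq_self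
      (fun t => ((fun y => δ * y) ⁻¹' A).indicator 1 t * ψ (x / δ - t)) (x / δ)]
    refine integral_congr_ae (Filter.Eventually.of_forall fun u => ?_)
    have h1 : ψ (x / δ - (x / δ + u)) = ψ u := by
      rw [sub_add_cancel_left]
      exact φ.normed_neg u
    have h2 : x / δ + u ∈ (fun y => δ * y) ⁻¹' A ↔ u ∈ {u | x + δ * u ∈ A} := by
      simp only [Set.mem_preimage, Set.mem_ofPred_eq, mul_add, mul_div_cancel₀ _ hδ0]
    dsimp only
    rw [h1]
    by_cases hu : u ∈ {u | x + δ * u ∈ A}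
    · simp only [Set.indicator_of_mem (h2.2 hu), Set.indicator_of_mem hu, Pi.one_apply, one_mul]
    · simp only [Set.indicator_of_notMem (mt h2.1 hu), Set.indicator_of_notMem hu, zero_mul]

/-! ### Couplings -/

/-- Maximal coupling: if `α` exceeds `β` by at most `η` on every event, then a point with law `α`
can be moved to one with law `β` so that it moves with probability at most `η`. -/
lemma exists_maximal_coupling (α β : Measure ℝ) [IsProbabilityMeasure α] [IsProbabilityMeasure β]
    {η : ℝ≥0∞} (h : ∀ A, MeasurableSet A → α A ≤ β A + η) :
    ∃ κ : Kernel ℝ ℝ, IsMarkovKernel κ ∧ α.bind κ = β ∧ ∫⁻ a, κ a {a}ᶜ ∂α ≤ η := by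
  obtain ⟨S, hS, h1, h2⟩ := hahn_decomposition β α
  set g : Measure ℝ := α.restrict S + β.restrict Sᶜ with hg
  have happ : ∀ T, MeasurableSet T → g T = α (T ∩ S) + β (T ∩ Sᶜ) := fun T hT => by
    rw [hg, Measure.add_apply, Measure.restrict_apply hT, Measure.restrict_apply hT]
  have hα : g ≤ α := Measure.le_iff.2 fun T hT => by
    rw [happ T hT, ← measure_inter_add_sdiff T hS, Set.sdiff_eq]
    exact add_le_add le_rfl (h2 _ (hT.inter hS.compl) Set.inter_subset_right)
  have hβ : g ≤ β := Measure.le_iff.2 fun T hT => by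
    rw [happ T hT, ← measure_inter_add_sdiff T hS, Set.sdiff_eq]
    exact add_le_add (h1 _ (hT.inter hS) Set.inter_subset_right) le_rfl
  have hgfin : IsFiniteMeasure g := ⟨(hα _).trans_lt (measure_lt_top α _)⟩
  set t : ℝ≥0∞ := 1 - g Set.univ with ht
  have hαt : (α - g) Set.univ = t := by
    rw [Measure.sub_apply MeasurableSet.univ hα, measure_univ]
  have hβt : (β - g) Set.univ = t := by
    rw [Measure.sub_apply MeasurableSet.univ hβ, measure_univ]
  have htη : t ≤ η := by
    rw [← hαt, Measure.sub_apply MeasurableSet.univ hα, happ _ MeasurableSet.univ,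
      Set.univ_inter, Set.univ_inter, ← measure_add_measure_compl hS (μ := α),
      ENNReal.add_sub_add_eq_sub_left (measure_ne_top _ _), tsub_le_iff_left]
    exact h _ hS.compl
  have htop : t ≠ ∞ := (tsub_le_self.trans_lt ENNReal.one_lt_top).ne
  -- The common part `g` stays put, the excess parts are coupled independently. If `t = 0` they
  -- vanish, and `t⁻¹ = ∞` multiplies the zero measure.
  set D : Measure (ℝ × ℝ) := g.map (fun a => (a, a)) + t⁻¹ • ((α - g).prod (β - g)) with hD
  have hdiag : Measurable fun a : ℝ => (a, a) := measurable_id.prodMk measurable_id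
  have hsc : ∀ ρ : Measure ℝ, ρ Set.univ = t → t⁻¹ • t • ρ = ρ := by
    intro ρ hρ
    rcases eq_or_ne t 0 with h0 | h0
    · rw [h0] at hρ
      rw [Measure.measure_univ_eq_zero.1 hρ, smul_zero, smul_zero]
    · rw [smul_smul, ENNReal.inv_mul_cancel h0 htop, one_smul]
  have hfst : D.fst = α := by
    rw [hD, Measure.fst, Measure.map_add _ _ measurable_fst, Measure.map_smul,
      Measure.map_map measurable_fst hdiag, Measure.map_fst_prod, hβt, hsc _ hαt, add_comm]
    exact (congrArg _ Measure.map_id).trans (Measure.sub_add_cancel_of_le hα)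
  have hsnd : D.snd = β := by
    rw [hD, Measure.snd, Measure.map_add _ _ measurable_snd, Measure.map_smul,
      Measure.map_map measurable_snd hdiag, Measure.map_snd_prod, hαt, hsc _ hβt, add_comm]
    exact (congrArg _ Measure.map_id).trans (Measure.sub_add_cancel_of_le hβ)
  have hDfin : IsFiniteMeasure D := ⟨by
    rw [← Measure.fst_univ, hfst, measure_univ]; exact ENNReal.one_lt_top⟩
  have hdis : α ⊗ₘ D.condKernel = D := by
    conv_lhs => rw [← hfst]
    exact D.disintegrate D.condKernel
  refine ⟨D.condKernel, inferInstance, ?_, ?_⟩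
  · rw [← Measure.snd_compProd, hdis, hsnd]
  · have hset : MeasurableSet {p : ℝ × ℝ | p.2 ≠ p.1} :=
      (measurableSet_eq_fun measurable_snd measurable_fst).compl
    have h3 : ∫⁻ a, D.condKernel a {a}ᶜ ∂α = D {p | p.2 ≠ p.1} := by
      conv_rhs => rw [← hdis]
      rw [Measure.compProd_apply hset]
      rfl
    rw [h3, hD, Measure.add_apply, Measure.map_apply hdiag hset, Measure.smul_apply, smul_eq_mul]
    have h4 : (fun a : ℝ => (a, a)) ⁻¹' {p | p.2 ≠ p.1} = ∅ := by ext; simp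
    rw [h4, measure_empty, zero_add]
    refine (mul_le_mul_right (measure_mono (Set.subset_univ _)) t⁻¹).trans ?_
    rw [← Set.univ_prod_univ, Measure.prod_prod, hαt, hβt, ← mul_assoc]
    exact (mul_le_of_le_one_left zero_le (ENNReal.inv_mul_le_one t)).trans htη

/-- If noisy versions of `Z` and `W` have nearly the same law, then a copy of `W` close to `Z`
lives on the space of `Z` enlarged by a uniform variable. The kernels give the noisy versions, which
exceed `Z` and `W` by an amount in `[p, q]`. -/
theorem exists_coupled_copy {Ω Ω' : Type*} [MeasurableSpace Ω] [MeasurableSpace Ω']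
    {μ : Measure Ω} [IsProbabilityMeasure μ] {ν : Measure Ω'} [IsProbabilityMeasure ν]
    {Z : Ω → ℝ} {W : Ω' → ℝ} (hZ : Measurable Z) (hW : Measurable W)
    (κ : Kernel Ω ℝ) [IsMarkovKernel κ] (κ' : Kernel Ω' ℝ) [IsMarkovKernel κ'] {p q r : ℝ}
    (hκ : ∀ ω, ∀ᵐ a ∂(κ ω), p ≤ a - Z ω ∧ a - Z ω ≤ q)
    (hκ' : ∀ ω, ∀ᵐ a ∂(κ' ω), p ≤ a - W ω ∧ a - W ω ≤ q) (hr : q - p < r) {η : ℝ≥0∞}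
    (h : ∀ A, MeasurableSet A → ∫⁻ ω, κ ω A ∂μ ≤ ∫⁻ ω, κ' ω A ∂ν + η) :
    ∃ Zd : Ω × I → ℝ, Measurable Zd ∧
      IdentDistrib Zd W (μ.prod (volume : Measure I)) ν ∧
      (μ.prod (volume : Measure I)) {x | r ≤ |Z x.1 - Zd x|} ≤ η := by
  obtain ⟨κ₂, hκ₂, hbind, hne⟩ := exists_maximal_coupling (μ.bind κ) (ν.bind κ') (η := η)
    fun A hA => by
      rw [Measure.bind_apply hA κ.measurable.aemeasurable,
        Measure.bind_apply hA κ'.measurable.aemeasurable]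
      exact h A hA
  have hm : Measurable fun x : Ω' × ℝ => (x.2, W x.1) :=
    measurable_snd.prodMk (hW.comp measurable_fst)
  set ρ : Measure (ℝ × ℝ) := (ν ⊗ₘ κ').map fun x => (x.2, W x.1) with hρ
  have hρp : IsProbabilityMeasure ρ := Measure.isProbabilityMeasure_map hm.aemeasurable
  have hfst : ρ.fst = ν.bind κ' := by
    rw [hρ, Measure.fst, Measure.map_map measurable_fst hm, ← Measure.snd_compProd]
    rfl
  have hsnd : ρ.snd = ν.map W := by
    rw [hρ, Measure.snd, Measure.map_map measurable_snd hm]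
    conv_rhs => rw [← Measure.fst_compProd (μ := ν) (κ := κ'), Measure.fst,
      Measure.map_map hW measurable_fst]
    rfl
  set κ₃ : Kernel ℝ ℝ := ρ.condKernel with hκ₃
  have hdis : ν.bind κ' ⊗ₘ κ₃ = ρ := by
    conv_lhs => rw [← hfst]
    exact ρ.disintegrate ρ.condKernel
  set G : Set (ℝ × ℝ) := {x | p ≤ x.1 - x.2 ∧ x.1 - x.2 ≤ q}ᶜ with hG
  have hGm : MeasurableSet G :=
    ((measurable_fst.sub measurable_snd) (measurableSet_Icc (a := p) (b := q))).compl
  have hG0 : ∫⁻ b, κ₃ b (Prod.mk b ⁻¹' G) ∂(ν.bind κ') = 0 := by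
    rw [← Measure.compProd_apply hGm, hdis, hρ, Measure.map_apply hm hGm,
      Measure.compProd_apply (hm hGm), lintegral_eq_zero_iff' (Measurable.aemeasurable
        (Kernel.measurable_kernel_prodMk_left (hm hGm)))]
    exact Filter.Eventually.of_forall fun ω => hκ' ω
  set τ : Kernel Ω ℝ := κ₃ ∘ₖ (κ₂ ∘ₖ κ) with hτ
  obtain ⟨f, hf, hfmap⟩ := τ.exists_measurable_map_eq_unitInterval
  have hfm : ∀ ω, Measurable (f ω) := fun ω => hf.comp measurable_prodMk_left
  have hlaw : μ.bind τ = ν.map W := by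
    rw [hτ, ← Measure.comp_assoc, ← Measure.comp_assoc, hbind, ← Measure.snd_compProd, hdis, hsnd]
  refine ⟨Function.uncurry f, hf, ⟨hf.aemeasurable, hW.aemeasurable, ?_⟩, ?_⟩
  · rw [← hlaw]
    ext A hA
    rw [Measure.map_apply hf hA, Measure.prod_apply (hf hA),
      Measure.bind_apply hA τ.measurable.aemeasurable]
    refine lintegral_congr fun ω => ?_
    rw [← hfmap ω, Measure.map_apply (hfm ω) hA]
    rfl
  · have hset : MeasurableSet {x : Ω × I | r ≤ |Z x.1 - Function.uncurry f x|} :=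
      measurableSet_le measurable_const ((hZ.comp measurable_fst).sub hf).abs
    have hset' : ∀ ω, MeasurableSet {w : ℝ | r ≤ |Z ω - w|} := fun ω =>
      measurableSet_le measurable_const (by fun_prop)
    rw [Measure.prod_apply hset]
    -- a large deviation forces the point moved by the maximal coupling to differ
    have key : ∀ ω, volume (Prod.mk ω ⁻¹' {x : Ω × I | r ≤ |Z x.1 - Function.uncurry f x|}) ≤
        ∫⁻ a, (κ₂ a {a}ᶜ + ∫⁻ b, κ₃ b (Prod.mk b ⁻¹' G) ∂(κ₂ a)) ∂(κ ω) := by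
      intro ω
      have e1 : volume (Prod.mk ω ⁻¹' {x : Ω × I | r ≤ |Z x.1 - Function.uncurry f x|}) =
          τ ω {w | r ≤ |Z ω - w|} := by
        rw [← hfmap ω, Measure.map_apply (hfm ω) (hset' ω)]
        rfl
      rw [e1, hτ, Kernel.comp_apply' _ _ _ (hset' ω), Kernel.lintegral_comp _ _ _
        (κ₃.measurable_coe (hset' ω))]
      refine lintegral_mono_ae ?_
      filter_upwards [hκ ω] with a ha
      have hsing : MeasurableSet ({a}ᶜ : Set ℝ) := (measurableSet_singleton a).compl
      rw [← lintegral_indicator_one hsing, ← lintegral_add_left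
        (measurable_one.indicator hsing)]
      refine lintegral_mono fun b => ?_
      by_cases hab : b = a
      · refine le_add_left (measure_mono fun w hw => ?_)
        intro hbw
        obtain ⟨h1, h2⟩ := hbw
        have h3 : r ≤ |Z ω - w| := hw
        dsimp only at h1 h2
        have h4 : |Z ω - w| ≤ q - p := abs_le.2 ⟨by linarith [ha.1, ha.2], by
          linarith [ha.1, ha.2]⟩
        linarith
      · rw [Set.indicator_of_mem (show b ∈ ({a}ᶜ : Set ℝ) from hab)]
        exact le_add_right prob_le_one
    refine (lintegral_mono key).trans ?_
    have hm₁ : Measurable fun a => κ₂ a {a}ᶜ :=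
      Kernel.measurable_kernel_prodMk_left (κ := κ₂) (t := {x : ℝ × ℝ | x.2 ≠ x.1})
        (measurableSet_eq_fun measurable_snd measurable_fst).compl
    have hm₂ : Measurable fun b => κ₃ b (Prod.mk b ⁻¹' G) :=
      Kernel.measurable_kernel_prodMk_left hGm
    have hm₃ : Measurable fun a => ∫⁻ b, κ₃ b (Prod.mk b ⁻¹' G) ∂(κ₂ a) :=
      hm₂.lintegral_kernel
    rw [← Measure.lintegral_bind (m := μ) (μ := κ) (f := fun a => κ₂ a {a}ᶜ +
      ∫⁻ b, κ₃ b (Prod.mk b ⁻¹' G) ∂(κ₂ a)) κ.measurable.aemeasurable (hm₁.add hm₃).aemeasurable,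
      lintegral_add_left hm₁, ← Measure.lintegral_bind κ₂.measurable.aemeasurable
        hm₂.aemeasurable, hbind, hG0, add_zero]
    exact hne

/-! ### Laws of the scaled vectors -/

/-- The coordinates of the random vector `γ V`, as a plain function of the index. -/
def scaledCoords {Ω : Type*} {d : ℕ} (γ : ℝ) (V : Ω → EuclideanSpace ℝ (Fin d)) (ω : Ω) :
    Fin d → ℝ := fun j => γ * V ω j

section vectors

variable {Ω : Type*} [MeasurableSpace Ω] {n d : ℕ} {P : Measure Ω} {γ : ℝ}
  {V : Fin n → Ω → EuclideanSpace ℝ (Fin d)} {U : Ω → EuclideanSpace ℝ (Fin d)}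

lemma measurable_coord (hU : Measurable U) (j : Fin d) : Measurable fun ω => U ω j := by
  fun_prop

lemma measurable_scaledCoords (γ : ℝ) (hU : Measurable U) : Measurable (scaledCoords γ U) :=
  measurable_pi_lambda _ fun j => (measurable_coord hU j).const_mul γ

lemma measurable_maxSum (hV : ∀ i, Measurable (V i)) : Measurable (maxSum V) :=
  Measurable.iSup fun j => Finset.measurable_sum _ fun i _ => measurable_coord (hV i) j

/-- The smooth maximum of the scaled sums. -/
def smoothMaxSum (γ : ℝ) (V : Fin n → Ω → EuclideanSpace ℝ (Fin d)) (ω : Ω) : ℝ :=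
  smoothMax (∑ i, scaledCoords γ (V i) ω)

lemma measurable_smoothMaxSum (hV : ∀ i, Measurable (V i)) : Measurable (smoothMaxSum γ V) :=
  measurable_smoothMax.comp (Finset.measurable_sum _ fun i _ => measurable_scaledCoords γ (hV i))

lemma sum_scaledCoords_apply (ω : Ω) (j : Fin d) :
    (∑ i, scaledCoords γ (V i) ω) j = γ * ∑ i, V i ω j := by
  rw [Finset.sum_apply, Finset.mul_sum]
  rfl

lemma le_smoothMaxSum [Nonempty (Fin d)] (hγ : 0 < γ) (ω : Ω) :
    maxSum V ω ≤ γ⁻¹ * smoothMaxSum γ V ω := by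
  refine ciSup_le fun j => ?_
  rw [le_inv_mul_iff₀ hγ, ← sum_scaledCoords_apply]
  exact le_smoothMax _ j

lemma smoothMaxSum_le [Nonempty (Fin d)] (hγ : 0 < γ) (ω : Ω) :
    γ⁻¹ * smoothMaxSum γ V ω ≤ maxSum V ω + γ⁻¹ * Real.log d := by
  rw [inv_mul_le_iff₀ hγ, mul_add, mul_inv_cancel_left₀ hγ.ne']
  have h := smoothMax_le (w := ∑ i, scaledCoords γ (V i) ω) (a := γ * maxSum V ω) fun j => by
    rw [sum_scaledCoords_apply]
    exact mul_le_mul_of_nonneg_left (le_ciSup (f := fun j => ∑ i, V i ω j)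
      (Set.finite_range _).bddAbove j) hγ.le
  rwa [Fintype.card_fin] at h

lemma pi_map_scaledCoords [IsProbabilityMeasure P] (hV : ∀ i, Measurable (V i))
    (hind : iIndepFun V P) :
    Measure.pi (fun i => P.map (scaledCoords γ (V i))) =
      P.map fun ω i => scaledCoords γ (V i) ω := by
  have h := hind.comp (fun _ x j => γ * x j) fun _ => measurable_pi_lambda _ fun j => by fun_prop
  exact ((iIndepFun_iff_map_fun_eq_pi_map fun i =>
    (measurable_scaledCoords γ (hV i)).aemeasurable).1 h).symm

lemma ofReal_integral_le_lintegral {α : Type*} [MeasurableSpace α] {m : Measure α} {g : α → ℝ}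
    (hg : Measurable g) (h0 : ∀ x, 0 ≤ g x) :
    ENNReal.ofReal (∫ x, g x ∂m) ≤ ∫⁻ x, ENNReal.ofReal (g x) ∂m := by
  rw [integral_eq_lintegral_of_nonneg_ae (Filter.Eventually.of_forall h0) hg.aestronglyMeasurable]
  exact ENNReal.ofReal_toReal_le

lemma integrable_cube_of_maxSumCube_ne_top (hV : ∀ i, Measurable (V i))
    (h : maxSumCube P V ≠ ∞) (i : Fin n) (j : Fin d) :
    Integrable (fun x : Fin d → ℝ => |x j| ^ 3) (P.map (scaledCoords γ (V i))) := by
  rw [integrable_map_measure (Measurable.aestronglyMeasurable (by fun_prop))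
    (measurable_scaledCoords γ (hV i)).aemeasurable]
  have h1 : Integrable (fun ω => |V i ω j| ^ 3) P := by
    refine ⟨((measurable_coord (hV i) j).abs.pow_const 3).aestronglyMeasurable, ?_⟩
    rw [hasFiniteIntegral_iff_ofReal (Filter.Eventually.of_forall fun ω => by positivity)]
    refine lt_of_le_of_lt (lintegral_mono fun ω => ?_) h.lt_top
    refine le_trans ?_ (le_iSup (fun j => ∑ i, ENNReal.ofReal (|V i ω j| ^ 3)) j)
    exact Finset.single_le_sum (f := fun i => ENNReal.ofReal (|V i ω j| ^ 3))
      (fun _ _ => zero_le) (Finset.mem_univ i)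
  refine (h1.const_mul (|γ| ^ 3)).congr (Filter.Eventually.of_forall fun ω => ?_)
  simp only [Function.comp, scaledCoords, abs_mul, mul_pow]

lemma ofReal_realSumCube_le [IsProbabilityMeasure P] [Nonempty (Fin d)] (hγ : 0 < γ)
    (hV : ∀ i, Measurable (V i)) (hind : iIndepFun V P) :
    ENNReal.ofReal (realSumCube fun i => P.map (scaledCoords γ (V i))) ≤
      ENNReal.ofReal (γ ^ 3) * maxSumCube P V := by
  have hm : Measurable fun ω i => scaledCoords γ (V i) ω :=
    measurable_pi_lambda _ fun i => measurable_scaledCoords γ (hV i)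
  rw [realSumCube, pi_map_scaledCoords hV hind]
  refine (ofReal_integral_le_lintegral measurable_iSup_sum_cube iSup_sum_cube_nonneg).trans ?_
  rw [lintegral_map (measurable_iSup_sum_cube.ennreal_ofReal) hm, maxSumCube,
    ← lintegral_const_mul' _ _ ENNReal.ofReal_ne_top]
  refine lintegral_mono fun ω => ?_
  obtain ⟨j, hj⟩ := exists_eq_ciSup_of_finite (f := fun j => ∑ i, |scaledCoords γ (V i) ω j| ^ 3)
  rw [← hj]
  refine le_trans ?_ (mul_le_mul_right
    (le_iSup (fun j => ∑ i, ENNReal.ofReal (|V i ω j| ^ 3)) j) _)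
  rw [← ENNReal.ofReal_sum_of_nonneg fun i _ => by positivity,
    ← ENNReal.ofReal_mul (by positivity), Finset.mul_sum]
  simp only [scaledCoords, abs_mul, mul_pow, abs_of_pos hγ, le_refl]

lemma ofReal_norm_rpow_le [Nonempty (Fin d)] (hγ : 0 < γ) {q : ℝ} (hq : 0 ≤ q) (ω : Ω) :
    ENNReal.ofReal (‖scaledCoords γ U ω‖ ^ q) ≤
      ENNReal.ofReal (γ ^ q) * ⨆ j, ENNReal.ofReal (|U ω j| ^ q) := by
  obtain ⟨j, hj⟩ := Finite.exists_max fun j => ‖scaledCoords γ U ω j‖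
  have h1 : ‖scaledCoords γ U ω‖ ≤ γ * |U ω j| := by
    refine ((pi_norm_le_iff_of_nonneg (norm_nonneg _)).2 hj).trans_eq ?_
    rw [scaledCoords, norm_mul, Real.norm_of_nonneg hγ.le, Real.norm_eq_abs]
  refine le_trans ?_ (mul_le_mul_right (le_iSup (fun j => ENNReal.ofReal (|U ω j| ^ q)) j) _)
  rw [← ENNReal.ofReal_mul (by positivity), ← Real.mul_rpow hγ.le (abs_nonneg _)]
  exact ENNReal.ofReal_le_ofReal (Real.rpow_le_rpow (norm_nonneg _) h1 hq)

lemma lintegral_norm_rpow_le [Nonempty (Fin d)] (hγ : 0 < γ) (hU : Measurable U) {q : ℝ}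
    (hq : 0 ≤ q) :
    ∫⁻ x : Fin d → ℝ, ENNReal.ofReal (‖x‖ ^ q) ∂(P.map (scaledCoords γ U)) ≤
      ENNReal.ofReal (γ ^ q) * maxMoment P U q := by
  rw [lintegral_map (by fun_prop) (measurable_scaledCoords γ hU), maxMoment,
    ← lintegral_const_mul' _ _ ENNReal.ofReal_ne_top]
  exact lintegral_mono fun ω => ofReal_norm_rpow_le hγ hq ω

lemma integrable_norm_rpow_of_maxMoment_ne_top [Nonempty (Fin d)] (hγ : 0 < γ)
    (hU : Measurable U) {q : ℝ} (hq : 0 ≤ q) (h : maxMoment P U q ≠ ∞) :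
    Integrable (fun x : Fin d → ℝ => ‖x‖ ^ q) (P.map (scaledCoords γ U)) := by
  refine ⟨Measurable.aestronglyMeasurable (by fun_prop), ?_⟩
  rw [hasFiniteIntegral_iff_ofReal (Filter.Eventually.of_forall fun ω => by positivity)]
  exact (lintegral_norm_rpow_le hγ hU hq).trans_lt (ENNReal.mul_lt_top ENNReal.ofReal_lt_top
    h.lt_top)

end vectors

/-! ### Second moments of the Gaussian vectors -/

section gaussian

variable {Ω : Type*} [MeasurableSpace Ω] {d : ℕ} {μ : Measure Ω}
  {U : Ω → EuclideanSpace ℝ (Fin d)}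

lemma integrable_mul_coord (hU : Measurable U) (h2 : ∀ j, Integrable (fun ω => U ω j ^ 2) μ)
    (j k : Fin d) : Integrable (fun ω => U ω j * U ω k) μ :=
  ((memLp_two_iff_integrable_sq (measurable_coord hU j).aestronglyMeasurable).2
    (h2 j)).integrable_mul
    ((memLp_two_iff_integrable_sq (measurable_coord hU k).aestronglyMeasurable).2 (h2 k))

/-- Without positivity `multivariateGaussian` would be a point mass. -/
lemma posSemidef_secondMoment (hU : Measurable U)
    (h2 : ∀ j, Integrable (fun ω => U ω j ^ 2) μ) : (secondMoment μ U).PosSemidef := by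
  refine Matrix.PosSemidef.of_dotProduct_mulVec_nonneg ?_ fun x => ?_
  · ext j k
    simp only [secondMoment, Matrix.conjTranspose_apply, Matrix.of_apply, star_trivial, mul_comm]
  · have e : ∀ ω, (∑ j, x j * U ω j) ^ 2 = ∑ j, ∑ k, x j * x k * (U ω j * U ω k) := fun ω => by
      rw [pow_two, Finset.sum_mul_sum]
      exact Finset.sum_congr rfl fun j _ => Finset.sum_congr rfl fun k _ => by ring
    have h : star x ⬝ᵥ (secondMoment μ U).mulVec x = ∫ ω, (∑ j, x j * U ω j) ^ 2 ∂μ := by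
      simp only [e]
      rw [integral_finsetSum _ fun j _ => integrable_finsetSum _ fun k _ =>
        (integrable_mul_coord hU h2 j k).const_mul _]
      refine Finset.sum_congr rfl fun j _ => ?_
      rw [integral_finsetSum _ fun k _ => (integrable_mul_coord hU h2 j k).const_mul _,
        Matrix.mulVec, dotProduct, Finset.mul_sum]
      refine Finset.sum_congr rfl fun k _ => ?_
      rw [integral_const_mul, star_trivial, secondMoment, Matrix.of_apply]
      ring
    rw [h]
    exact integral_nonneg fun ω => sq_nonneg _

lemma memLp_coord_multivariateGaussian (S : Matrix (Fin d) (Fin d) ℝ) (j : Fin d) :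
    MemLp (fun x : EuclideanSpace ℝ (Fin d) => x j) 2 (multivariateGaussian 0 S) :=
  (EuclideanSpace.proj (𝕜 := ℝ) j).comp_memLp' IsGaussian.memLp_two_id

lemma integral_coord_multivariateGaussian (S : Matrix (Fin d) (Fin d) ℝ) (j : Fin d) :
    ∫ x : EuclideanSpace ℝ (Fin d), x j ∂(multivariateGaussian 0 S) = 0 := by
  have h := (EuclideanSpace.proj (𝕜 := ℝ) j).integral_comp_comm
    (IsGaussian.integrable_id (μ := multivariateGaussian (0 : EuclideanSpace ℝ (Fin d)) S))
  simp only [id] at h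
  rw [integral_id_multivariateGaussian, map_zero] at h
  exact h

lemma integral_mul_coord_multivariateGaussian {S : Matrix (Fin d) (Fin d) ℝ}
    (hS : S.PosSemidef) (j k : Fin d) :
    ∫ x : EuclideanSpace ℝ (Fin d), x j * x k ∂(multivariateGaussian 0 S) = S j k := by
  have h := covariance_eval_multivariateGaussian (μ := (0 : EuclideanSpace ℝ (Fin d))) hS j k
  rw [covariance_eq_sub (memLp_coord_multivariateGaussian S j)
    (memLp_coord_multivariateGaussian S k), integral_coord_multivariateGaussian, zero_mul,
    sub_zero] at h
  exact h

end gaussian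

/-! ### Comparison of noisy maxima -/

section moments

variable {Ω : Type*} [MeasurableSpace Ω] {d : ℕ} {P : Measure Ω}
  {U : Ω → EuclideanSpace ℝ (Fin d)} {γ : ℝ}

lemma integral_scaledCoords (hU : Measurable U) (j : Fin d) :
    ∫ x : Fin d → ℝ, x j ∂(P.map (scaledCoords γ U)) = γ * ∫ ω, U ω j ∂P := by
  rw [integral_map (measurable_scaledCoords γ hU).aemeasurable
    (Measurable.aestronglyMeasurable (by fun_prop)), ← integral_const_mul]
  rfl

lemma integral_mul_scaledCoords (hU : Measurable U) (j k : Fin d) :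
    ∫ x : Fin d → ℝ, x j * x k ∂(P.map (scaledCoords γ U)) = γ ^ 2 * ∫ ω, U ω j * U ω k ∂P := by
  rw [integral_map (measurable_scaledCoords γ hU).aemeasurable
    (Measurable.aestronglyMeasurable (by fun_prop)), ← integral_const_mul]
  refine integral_congr_ae (Filter.Eventually.of_forall fun ω => ?_)
  simp only [scaledCoords]
  ring

lemma integrable_sq_scaledCoords (hU : Measurable U) {j : Fin d}
    (h : Integrable (fun ω => U ω j ^ 2) P) :
    Integrable (fun x : Fin d → ℝ => x j ^ 2) (P.map (scaledCoords γ U)) := by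
  rw [integrable_map_measure (Measurable.aestronglyMeasurable (by fun_prop))
    (measurable_scaledCoords γ hU).aemeasurable]
  refine (h.const_mul (γ ^ 2)).congr (Filter.Eventually.of_forall fun ω => ?_)
  simp only [Function.comp, scaledCoords, mul_pow]

end moments

section comparison

variable {Ω Ω' : Type*} [MeasurableSpace Ω] [MeasurableSpace Ω'] {n d : ℕ}
  {μ : Measure Ω} [IsProbabilityMeasure μ] {ν : Measure Ω'} [IsProbabilityMeasure ν]
  {X : Fin n → Ω → EuclideanSpace ℝ (Fin d)} {Y : Fin n → Ω' → EuclideanSpace ℝ (Fin d)}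
  {γ : ℝ}

/-- The laws of the scaled vectors `γ X_i` (index `false`) and `γ Y_i` (index `true`). -/
def scaledLaws (μ : Measure Ω) (X : Fin n → Ω → EuclideanSpace ℝ (Fin d)) (ν : Measure Ω')
    (Y : Fin n → Ω' → EuclideanSpace ℝ (Fin d)) (γ : ℝ) (b : Bool) (i : Fin n) :
    Measure (Fin d → ℝ) :=
  bif b then ν.map (scaledCoords γ (Y i)) else μ.map (scaledCoords γ (X i))

lemma isProbabilityMeasure_scaledLaws (hX : ∀ i, Measurable (X i)) (hY : ∀ i, Measurable (Y i))
    (b : Bool) (i : Fin n) : IsProbabilityMeasure (scaledLaws μ X ν Y γ b i) := by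
  cases b
  · exact Measure.isProbabilityMeasure_map (measurable_scaledCoords γ (hX i)).aemeasurable
  · exact Measure.isProbabilityMeasure_map (measurable_scaledCoords γ (hY i)).aemeasurable

lemma momentMatched_scaledLaws (hX : ∀ i, Measurable (X i)) (hY : ∀ i, Measurable (Y i))
    (h2 : ∀ i j, Integrable (fun ω => X i ω j ^ 2) μ) (h0 : ∀ i j, ∫ ω, X i ω j ∂μ = 0)
    (hlaw : ∀ i, HasLaw (Y i) (multivariateGaussian 0 (secondMoment μ (X i))) ν) (γ : ℝ) :
    MomentMatched (scaledLaws μ X ν Y γ) := by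
  have hYm : ∀ i {g : EuclideanSpace ℝ (Fin d) → ℝ}, Measurable g →
      ∫ ω, g (Y i ω) ∂ν = ∫ x, g x ∂(multivariateGaussian 0 (secondMoment μ (X i))) := by
    intro i g hg
    rw [← (hlaw i).map_eq, integral_map (hY i).aemeasurable hg.aestronglyMeasurable]
  refine ⟨fun b i j => ?_, fun b i j => ?_, fun i j k => ?_⟩
  · cases b
    · exact (integral_scaledCoords (hX i) j).trans (by rw [h0, mul_zero])
    · refine (integral_scaledCoords (hY i) j).trans ?_
      rw [hYm i (g := fun x => x j) (by fun_prop), integral_coord_multivariateGaussian, mul_zero]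
  · cases b
    · exact integrable_sq_scaledCoords (hX i) (h2 i j)
    · refine integrable_sq_scaledCoords (hY i) ?_
      have h := (memLp_coord_multivariateGaussian (secondMoment μ (X i)) j).integrable_sq
      rw [← (hlaw i).map_eq, integrable_map_measure (Measurable.aestronglyMeasurable
        (by fun_prop)) (hY i).aemeasurable] at h
      exact h
  · refine (integral_mul_scaledCoords (hY i) j k).trans
      (Eq.trans ?_ (integral_mul_scaledCoords (hX i) j k).symm)
    rw [hYm i (g := fun x => x j * x k) (by fun_prop),
      integral_mul_coord_multivariateGaussian (posSemidef_secondMoment (hX i) (h2 i))]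
    rfl

lemma integral_smoothMaxSum {V : Fin n → Ω → EuclideanSpace ℝ (Fin d)}
    (hV : ∀ i, Measurable (V i)) (hind : iIndepFun V μ) {f : ℝ → ℝ} (hf : Measurable f) :
    ∫ ω, f (smoothMaxSum γ V ω) ∂μ =
      ∫ x, f (smoothMax (∑ i, x i)) ∂(Measure.pi fun i => μ.map (scaledCoords γ (V i))) := by
  have hg : Measurable fun x : Fin n → Fin d → ℝ => f (smoothMax (∑ i, x i)) :=
    hf.comp (measurable_smoothMax.comp (by fun_prop))
  rw [pi_map_scaledCoords hV hind, integral_map (Measurable.aemeasurable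
    (measurable_pi_lambda _ fun i => measurable_scaledCoords γ (hV i))) hg.aestronglyMeasurable]
  rfl

variable [Nonempty (Fin d)] {K B : ℝ} {f f₁ f₂ f₃ : ℝ → ℝ}

lemma ofReal_abs_sub_le_cube (hf : HasBoundedDerivs K f f₁ f₂ f₃) (hK : 0 < K)
    (hB : ∀ x, |f x| ≤ B) (hγ : 0 < γ) (hX : ∀ i, Measurable (X i)) (hY : ∀ i, Measurable (Y i))
    (hXi : iIndepFun X μ) (hYi : iIndepFun Y ν) (hL : MomentMatched (scaledLaws μ X ν Y γ)) :
    ENNReal.ofReal |∫ ω, f (smoothMaxSum γ X ω) ∂μ - ∫ ω, f (smoothMaxSum γ Y ω) ∂ν| ≤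
      ENNReal.ofReal (400000 * K * γ ^ 3) * (maxSumCube μ X + maxSumCube ν Y) := by
  by_cases htop : maxSumCube μ X + maxSumCube ν Y = ∞
  · rw [htop, ENNReal.mul_top (by simpa using by positivity)]
    exact le_top
  obtain ⟨h1, h2⟩ := ENNReal.add_ne_top.1 htop
  have := isProbabilityMeasure_scaledLaws (μ := μ) (ν := ν) (γ := γ) hX hY
  have h := abs_integral_sub_le_cube hf hB hL fun b i j => by
    cases b
    · exact integrable_cube_of_maxSumCube_ne_top hX h1 i j
    · exact integrable_cube_of_maxSumCube_ne_top hY h2 i j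
  rw [integral_smoothMaxSum hX hXi hf.measurable.1, integral_smoothMaxSum hY hYi hf.measurable.1]
  refine (ENNReal.ofReal_le_ofReal h).trans ?_
  rw [Fintype.sum_bool, ENNReal.ofReal_mul (by positivity),
    ENNReal.ofReal_mul (q := γ ^ 3) (by positivity), mul_assoc, mul_add (ENNReal.ofReal (γ ^ 3)),
    ENNReal.ofReal_add (realSumCube_nonneg _) (realSumCube_nonneg _), add_comm]
  exact mul_le_mul_right (add_le_add (ofReal_realSumCube_le hγ hX hXi)
    (ofReal_realSumCube_le hγ hY hYi)) _

lemma ofReal_abs_sub_le_rpow (hf : HasBoundedDerivs K f f₁ f₂ f₃) (hK : 0 < K)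
    (hB : ∀ x, |f x| ≤ B) (hγ : 0 < γ) (hX : ∀ i, Measurable (X i)) (hY : ∀ i, Measurable (Y i))
    (hXi : iIndepFun X μ) (hYi : iIndepFun Y ν) (hL : MomentMatched (scaledLaws μ X ν Y γ))
    {q : ℝ} (hq2 : 2 ≤ q) (hq3 : q ≤ 3) :
    ENNReal.ofReal |∫ ω, f (smoothMaxSum γ X ω) ∂μ - ∫ ω, f (smoothMaxSum γ Y ω) ∂ν| ≤
      ENNReal.ofReal (5120 * K * γ ^ q) *
        ∑ i, (maxMoment μ (X i) q + maxMoment ν (Y i) q) := by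
  have hq : 0 ≤ q := by linarith
  by_cases htop : ∑ i, (maxMoment μ (X i) q + maxMoment ν (Y i) q) = ∞
  · rw [htop, ENNReal.mul_top (by simpa using by positivity)]
    exact le_top
  have h12 : ∀ i, maxMoment μ (X i) q ≠ ∞ ∧ maxMoment ν (Y i) q ≠ ∞ := fun i =>
    ENNReal.add_ne_top.1 (ENNReal.sum_ne_top.1 htop i (Finset.mem_univ i))
  have := isProbabilityMeasure_scaledLaws (μ := μ) (ν := ν) (γ := γ) hX hY
  have h := abs_integral_sub_le_rpow hf hB hL hq2 hq3 fun b i => by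
    cases b
    · exact integrable_norm_rpow_of_maxMoment_ne_top hγ (hX i) hq (h12 i).1
    · exact integrable_norm_rpow_of_maxMoment_ne_top hγ (hY i) hq (h12 i).2
  have hm : Measurable fun x : Fin d → ℝ => ‖x‖ ^ q := by fun_prop
  have h0 : ∀ b i, 0 ≤ ∫ x, ‖x‖ ^ q ∂(scaledLaws μ X ν Y γ b i) := fun b i =>
    integral_nonneg fun x => by positivity
  rw [integral_smoothMaxSum hX hXi hf.measurable.1, integral_smoothMaxSum hY hYi hf.measurable.1]
  refine (ENNReal.ofReal_le_ofReal h).trans ?_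
  rw [ENNReal.ofReal_mul (by positivity), ENNReal.ofReal_mul (q := γ ^ q) (by positivity),
    mul_assoc, Finset.mul_sum Finset.univ _ (ENNReal.ofReal (γ ^ q)),
    ENNReal.ofReal_sum_of_nonneg fun i _ => Finset.sum_nonneg fun b _ => h0 b i]
  refine mul_le_mul_right (Finset.sum_le_sum fun i _ => ?_) _
  rw [Fintype.sum_bool, ENNReal.ofReal_add (h0 _ i) (h0 _ i), mul_add, add_comm]
  exact add_le_add
    ((ofReal_integral_le_lintegral hm fun x => by positivity).trans
      (lintegral_norm_rpow_le hγ (hX i) hq))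
    ((ofReal_integral_le_lintegral hm fun x => by positivity).trans
      (lintegral_norm_rpow_le hγ (hY i) hq))

/-- If `f` has first three derivatives of order `1 / (γ δ)`, its expectations at the two smooth
maxima differ by at most a multiple of `L_n(γ, δ, ι)`. -/
lemma ofReal_abs_sub_le_Ln {C δ ι : ℝ} (hC : 0 < C) (hδ : 0 < δ) (hγδ : 1 ≤ γ * δ)
    (hι0 : 0 ≤ ι) (hι1 : ι ≤ 1)
    (hf : HasBoundedDerivs (C / (γ * δ)) f f₁ f₂ f₃)
    (hB : ∀ x, |f x| ≤ B) (hγ : 0 < γ) (hX : ∀ i, Measurable (X i)) (hY : ∀ i, Measurable (Y i))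
    (hXi : iIndepFun X μ) (hYi : iIndepFun Y ν) (hL : MomentMatched (scaledLaws μ X ν Y γ)) :
    ENNReal.ofReal |∫ ω, f (smoothMaxSum γ X ω) ∂μ - ∫ ω, f (smoothMaxSum γ Y ω) ∂ν| ≤
      ENNReal.ofReal (400000 * C) * Ln μ X ν Y γ δ ι := by
  have hK : 0 < C / (γ * δ) := by positivity
  rw [Ln, mul_min]
  refine le_min ?_ ?_
  · refine (ofReal_abs_sub_le_cube hf hK hB hγ hX hY hXi hYi hL).trans ?_
    rw [← mul_assoc, ← ENNReal.ofReal_mul (by positivity)]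
    refine mul_le_mul_left (ENNReal.ofReal_le_ofReal (le_of_eq ?_)) _
    field_simp
  · refine (ofReal_abs_sub_le_rpow hf hK hB hγ hX hY hXi hYi hL (q := 2 + ι) (by linarith)
      (by linarith)).trans ?_
    rw [← mul_assoc, ← ENNReal.ofReal_mul (by positivity)]
    refine mul_le_mul_left (ENNReal.ofReal_le_ofReal ?_) _
    have h1 : γ ^ ((4 + 2 * ι) / 3) * δ ^ (-((2 + ι) / 3)) =
        γ ^ (2 + ι) / (γ * δ) * (γ * δ) ^ ((1 - ι) / 3) := by
      rw [Real.mul_rpow hγ.le hδ.le, show (4 + 2 * ι) / 3 = (2 + ι) - 1 + (1 - ι) / 3 by ring,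
        show -((2 + ι) / 3) = -1 + (1 - ι) / 3 by ring, Real.rpow_add hγ, Real.rpow_add hδ,
        Real.rpow_sub_one hγ.ne', Real.rpow_neg_one]
      field_simp
    have h2 : 1 ≤ (γ * δ) ^ ((1 - ι) / 3) := Real.one_le_rpow hγδ (by linarith)
    rw [h1]
    have h3 : 0 ≤ C * (γ ^ (2 + ι) / (γ * δ)) := by positivity
    calc 5120 * (C / (γ * δ)) * γ ^ (2 + ι) = 5120 * (C * (γ ^ (2 + ι) / (γ * δ))) := by ring
      _ ≤ 400000 * (C * (γ ^ (2 + ι) / (γ * δ))) * 1 := by linarith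
      _ ≤ 400000 * (C * (γ ^ (2 + ι) / (γ * δ))) * (γ * δ) ^ ((1 - ι) / 3) :=
        mul_le_mul_of_nonneg_left h2 (by positivity)
      _ = _ := by ring

end comparison

/-- The Markov kernel that adds to `F ω` independent noise of law `m`, scaled by `δ`. -/
def noiseKernel {Ω : Type*} [MeasurableSpace Ω] (m : Measure ℝ) [IsProbabilityMeasure m]
    {F : Ω → ℝ} (hF : Measurable F) (δ : ℝ) : Kernel Ω ℝ where
  toFun ω := m.map fun u => F ω + δ * u
  measurable' := by
    refine Measure.measurable_of_measurable_coe _ fun A hA => ?_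
    have hm : Measurable fun x : Ω × ℝ => F x.1 + δ * x.2 := by fun_prop
    have h : ∀ ω, m.map (fun u => F ω + δ * u) A =
        m (Prod.mk ω ⁻¹' ((fun x : Ω × ℝ => F x.1 + δ * x.2) ⁻¹' A)) := fun ω =>
      Measure.map_apply (by fun_prop) hA
    simp only [h]
    exact measurable_measure_prodMk_left (hm hA)

section noise

variable {Ω : Type*} [MeasurableSpace Ω] {m : Measure ℝ} [IsProbabilityMeasure m]
  {F : Ω → ℝ} {δ : ℝ}

lemma noiseKernel_apply (hF : Measurable F) (ω : Ω) {A : Set ℝ} (hA : MeasurableSet A) :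
    noiseKernel m hF δ ω A = m {u | F ω + δ * u ∈ A} :=
  Measure.map_apply (by fun_prop) hA

instance (hF : Measurable F) : IsMarkovKernel (noiseKernel m hF δ) :=
  ⟨fun ω => Measure.isProbabilityMeasure_map (f := fun u => F ω + δ * u)
    (Measurable.aemeasurable (by fun_prop))⟩

lemma noiseKernel_ae (hF : Measurable F) (hδ : 0 ≤ δ) (hm : ∀ᵐ u ∂m, |u| ≤ 1) {Z : Ω → ℝ}
    {l : ℝ} (hl : ∀ ω, Z ω ≤ F ω ∧ F ω ≤ Z ω + l) (ω : Ω) :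
    ∀ᵐ a ∂(noiseKernel m hF δ ω), -δ ≤ a - Z ω ∧ a - Z ω ≤ l + δ := by
  have hs : MeasurableSet {a : ℝ | -δ ≤ a - Z ω ∧ a - Z ω ≤ l + δ} :=
    (measurable_sub_const (Z ω)) (measurableSet_Icc (a := -δ) (b := l + δ))
  refine (ae_map_iff (Measurable.aemeasurable (by fun_prop)) hs).2 ?_
  filter_upwards [hm] with u hu
  obtain ⟨h1, h2⟩ := abs_le.1 hu
  obtain ⟨h3, h4⟩ := hl ω
  constructor <;> nlinarith

end noise

/-! ### The approximation of the maximum -/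

/-- The law of the noisy smooth maximum on the original scale, evaluated on `A`, as the expectation
of the smoothed indicator of `γ A` at the smooth maximum on the scale of `γ`. -/
lemma lintegral_noiseKernel_smoothMaxSum {Ω : Type*} [MeasurableSpace Ω] {n d : ℕ}
    {P : Measure Ω} [IsProbabilityMeasure P] {V : Fin n → Ω → EuclideanSpace ℝ (Fin d)}
    (hV : ∀ i, Measurable (V i)) {m : Measure ℝ} [IsProbabilityMeasure m] {γ δ : ℝ}
    (hγ : 0 < γ) {A : Set ℝ} (hA : MeasurableSet A) {f : ℝ → ℝ} (hfm : Measurable f)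
    (hf : ∀ x, f x = m.real {u | x + γ * δ * u ∈ (fun y => γ⁻¹ * y) ⁻¹' A}) :
    ∫⁻ ω, noiseKernel m ((measurable_smoothMaxSum hV (γ := γ)).const_mul γ⁻¹) δ ω A ∂P =
      ENNReal.ofReal (∫ ω, f (smoothMaxSum γ V ω) ∂P) := by
  have h0 : ∀ x, 0 ≤ f x := fun x => by rw [hf]; exact measureReal_nonneg
  have hi : Integrable (fun ω => f (smoothMaxSum γ V ω)) P :=
    Integrable.of_bound (hfm.comp (measurable_smoothMaxSum hV)).aestronglyMeasurable 1
      (Filter.Eventually.of_forall fun ω => by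
        rw [Real.norm_of_nonneg (h0 _), hf]
        exact measureReal_le_one)
  rw [ofReal_integral_eq_lintegral_ofReal hi (Filter.Eventually.of_forall fun ω => h0 _)]
  refine lintegral_congr fun ω => ?_
  rw [noiseKernel_apply _ _ hA, hf, ofReal_measureReal]
  congr 1
  ext u
  simp only [Set.mem_ofPred_eq, Set.mem_preimage, mul_add, mul_assoc, inv_mul_cancel_left₀ hγ.ne']

/-- The coupling with error probability at most a multiple of `L_n(γ, δ, ι)`. -/
theorem exists_gaussian_coupling :
    ∃ C : ℝ, 0 < C ∧
      ∀ (n d : ℕ), 1 ≤ d →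
      ∀ (Ω : Type*) [MeasurableSpace Ω] (μ : Measure Ω) [IsProbabilityMeasure μ]
        (Ω' : Type*) [MeasurableSpace Ω'] (ν : Measure Ω') [IsProbabilityMeasure ν]
        (X : Fin n → Ω → EuclideanSpace ℝ (Fin d)) (Y : Fin n → Ω' → EuclideanSpace ℝ (Fin d))
        (ι : ℝ), 0 ≤ ι → ι ≤ 1 →
        (∀ i, Measurable (X i)) → iIndepFun X μ →
        (∀ i j, Integrable (fun ω => |X i ω j| ^ (2 + ι)) μ) →
        (∀ i j, ∫ ω, X i ω j ∂μ = 0) →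
        (∀ i, Measurable (Y i)) → iIndepFun Y ν →
        (∀ i, HasLaw (Y i) (multivariateGaussian 0 (secondMoment μ (X i))) ν) →
      ∀ γ δ : ℝ, 0 < γ → 0 < δ → 1 < γ * δ →
        ∃ Zd : Ω × I → ℝ, Measurable Zd ∧
          IdentDistrib Zd (maxSum Y) (μ.prod (volume : Measure I)) ν ∧
          (μ.prod (volume : Measure I))
              {p | γ⁻¹ * Real.log d + 3 * δ ≤ |maxSum X p.1 - Zd p|} ≤
            ENNReal.ofReal C * Ln μ X ν Y γ δ ι := by
  obtain ⟨C, hC, m, hm, hm1, hsm⟩ := exists_smoothing_noise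
  refine ⟨400000 * C, by positivity, fun n d hd Ω _ μ _ Ω' _ ν _ X Y ι hι0 hι1 hX hXi hq h0 hY
    hYi hlaw γ δ hγ hδ hγδ => ?_⟩
  have : Nonempty (Fin d) := ⟨⟨0, hd⟩⟩
  have h2 : ∀ i j, Integrable (fun ω => X i ω j ^ 2) μ := fun i j =>
    (integrable_abs_rpow_of_le (measurable_coord (hX i) j) (hq i j) (p := 2) (by norm_num)
      (by linarith)).congr (Filter.Eventually.of_forall fun ω => by
        simp only [Real.rpow_two, sq_abs])
  have hL := momentMatched_scaledLaws hX hY h2 h0 hlaw γ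
  refine exists_coupled_copy (measurable_maxSum hX) (measurable_maxSum hY)
    (noiseKernel m ((measurable_smoothMaxSum hX (γ := γ)).const_mul γ⁻¹) δ)
    (noiseKernel m ((measurable_smoothMaxSum hY (γ := γ)).const_mul γ⁻¹) δ)
    (noiseKernel_ae _ hδ.le hm1 fun ω => ⟨le_smoothMaxSum hγ ω, smoothMaxSum_le hγ ω⟩)
    (noiseKernel_ae _ hδ.le hm1 fun ω => ⟨le_smoothMaxSum hγ ω, smoothMaxSum_le hγ ω⟩)
    (by linarith) fun A hA => ?_
  obtain ⟨f₁, f₂, f₃, hf⟩ := hsm _ (measurable_const_mul γ⁻¹ hA) (γ * δ) hγδ.le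
  rw [lintegral_noiseKernel_smoothMaxSum hX hγ hA hf.measurable.1 fun x => rfl,
    lintegral_noiseKernel_smoothMaxSum hY hγ hA hf.measurable.1 fun x => rfl]
  refine le_trans ?_ (add_le_add le_rfl (ofReal_abs_sub_le_Ln hC hδ hγδ.le hι0 hι1 hf
    (B := 1) (fun x => ?_) hγ hX hY hXi hYi hL))
  · refine le_trans (ENNReal.ofReal_le_ofReal ?_) ENNReal.ofReal_add_le
    linarith [le_abs_self (∫ ω, m.real {u | smoothMaxSum γ X ω + γ * δ * u ∈
      (fun y => γ⁻¹ * y) ⁻¹' A} ∂μ - ∫ ω, m.real {u | smoothMaxSum γ Y ω + γ * δ * u ∈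
      (fun y => γ⁻¹ * y) ⁻¹' A} ∂ν)]
  · rw [abs_of_nonneg measureReal_nonneg]
    exact measureReal_le_one

end GaussMax

end

theorem theorem1 :
    ∃ C : ℝ, 0 < C ∧
      ∀ (n d : ℕ), 1 ≤ d →
      ∀ (Ω : Type*) [MeasurableSpace Ω] (μ : Measure Ω) [IsProbabilityMeasure μ]
        (Ω' : Type*) [MeasurableSpace Ω'] (ν : Measure Ω') [IsProbabilityMeasure ν]
        (X : Fin n → Ω → EuclideanSpace ℝ (Fin d)) (Y : Fin n → Ω' → EuclideanSpace ℝ (Fin d))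
        (ι : ℝ), 0 ≤ ι → ι ≤ 1 →
        (∀ i, Measurable (X i)) → iIndepFun X μ →
        (∀ i j, Integrable (fun ω => |X i ω j| ^ (2 + ι)) μ) →
        (∀ i j, ∫ ω, X i ω j ∂μ = 0) →
        (∀ i, Measurable (Y i)) → iIndepFun Y ν →
        (∀ i, HasLaw (Y i) (multivariateGaussian 0 (GaussMax.secondMoment μ (X i))) ν) →
      ∀ γ δ : ℝ, 0 < γ → 0 < δ → 1 < γ * δ → GaussMax.eps γ δ < 1 →
        -- `Zd` lives on the space of `X`, enlarged by an independent uniform variable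
        ∃ Zd : Ω × I → ℝ, Measurable Zd ∧
          IdentDistrib Zd (GaussMax.maxSum Y) (μ.prod (volume : Measure I)) ν ∧
          (μ.prod (volume : Measure I))
              {p | γ⁻¹ * Real.log d + 3 * δ ≤ |GaussMax.maxSum X p.1 - Zd p|} ≤
            ENNReal.ofReal C *
              ((ENNReal.ofReal (GaussMax.eps γ δ) + GaussMax.Ln μ X ν Y γ δ ι) /
                ENNReal.ofReal (1 - GaussMax.eps γ δ)) := by
  obtain ⟨C, hC, h⟩ := GaussMax.exists_gaussian_coupling
  refine ⟨C, hC, fun n d hd Ω _ μ _ Ω' _ ν _ X Y ι hι0 hι1 hX hXi hq h0 hY hYi hlaw γ δ hγ hδ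
    hγδ _ => ?_⟩
  obtain ⟨Zd, hZ, hid, hle⟩ := h n d hd Ω μ Ω' ν X Y ι hι0 hι1 hX hXi hq h0 hY hYi hlaw γ δ hγ hδ
    hγδ
  -- `L ≤ (ε + L) / (1 - ε)`
  refine ⟨Zd, hZ, hid, hle.trans (mul_le_mul_right ?_ _)⟩
  have he : 0 ≤ GaussMax.eps γ δ := mul_nonneg (by linarith) (Real.exp_pos _).le
  calc GaussMax.Ln μ X ν Y γ δ ι = GaussMax.Ln μ X ν Y γ δ ι / 1 := (div_one _).symm
    _ ≤ _ := ENNReal.div_le_div le_add_self (by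
      rw [← ENNReal.ofReal_one]
      exact ENNReal.ofReal_le_ofReal (by linarith))
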